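/- **Setting.** Let $X=\mathcal{O}_{\mathbb{P}^1}(-1,-1,0)$ be the total space of $\mathcal{O}(-1)\oplus\mathcal{O}(-1)\oplus\mathcal{O}$ over $\mathbb{P}^1$ (over $\mathbb{C}$), with projection $\pi:X\to\mathbb{P}^1$, let $Z_0,Z_\infty\in\mathbb{P}^1$ be the torus fixed points, and let $T_0=\{(t_0,t_1,t_2,t_3)\in(\mathbb{C}^*)^4: t_0t_1t_2t_3=1\}$ act on $X$ so that $z,x_1,x_2,x_3$ (the coordinate of $\mathbb{P}^1\setminus\{Z_\infty\}$ vanishing at $Z_0$ and the three fibre coordinates over it) have weights $t_0,t_1,t_2,t_3$; equivalently, the normal bundle of the zero section is $\mathcal{O}(-Z_\infty)\otimes t_1^{-1}\oplus\mathcal{O}(-Z_\infty)\otimes t_2^{-1}\oplus\mathcal{O}\otimes t_3^{-1}$. Let $Y=\mathcal{O}_{\mathbb{P}^1}(-1,0)=\{x_2=0\}\subset X$, whose zero section has normal bundle $N=\mathcal{O}(-Z_\infty)\otimes t_1^{-1}\oplus\mathcal{O}\otimes t_3^{-1}$ in $Y$. Let $\lambda_i$ be the equivariant parameter of $t_i$,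 so $\lambda_0+\lambda_1+\lambda_2+\lambda_3=0$, and $\Lambda=\mathbb{Q}(\lambda_0,\lambda_1,\lambda_2,m)$. For a virtual $T_0$-representation $V=\sum_w n_w t^w$ put $e_{T_0}(V)=\prod_w(w\cdot\lambda)^{n_w}$ and $e_{T_0\times\mathbb{C}^*}(V^\vee\otimes e^m)=\prod_w(m-w\cdot\lambda)^{n_w}$. **Joyce–Song pairs.** For a compactly supported coherent sheaf $F$ on $X$ let $d(F)=\operatorname{rank}\pi_*F$ and let $\chi(F)$ be its Euler characteristic; the slope is $\chi(F)/d(F)$, and $\infty$ if $d(F)=0$. A Joyce–Song (JS) stable pair is $I=(\mathcal{O}_X\xrightarrow{s}F)$ with $F$ a compactly supported one-dimensional slope-semistable sheaf, $s\neq0$, such that $\chi(F')/d(F')<\chi(F)/d(F)$ for all subsheaves $\operatorname{Im}(s)\subset F'\subsetneq F$. Let $P^{\mathrm{JS}}_n(X,d)^{T_0}$ be the set of isomorphism classes of JS stable pairs with $(d(F),\chi(F))=(d,n)$ that are fixed by $T_0$. **The invariant.** For a $T_0$-fixed pair, with the $T_0$-equivariant structure on $F$ for which $s$ is invariant, put $\chi_X(I,I)_0^{1/2}=-\chi_X(F)+\chi_Y(F,F)$.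 Here $\chi_X(F)=\sum_i(-1)^iH^i(X,F)$, and $\chi_Y(F,F)$ is taken after pushing $F$ forward to $\mathbb{P}^1$ and including it in $Y$ by the zero section, that is, $\chi_Y(F,F)=\sum_{p=0}^{2}(-1)^p\chi_{\mathbb{P}^1}(\pi_*F,\pi_*F\otimes\wedge^pN)$. With the sign rule for sheaves scheme-theoretically supported on $Y$, define $$P^{\mathrm{JS}}_{n,d}(e^m)=\sum_{I\in P^{\mathrm{JS}}_n(X,d)^{T_0}}(-1)^{\chi(F)+d(F)}\,e_{T_0}\big(-\chi_X(F)+\chi_Y(F,F)\big)\cdot e_{T_0\times\mathbb{C}^*}\big(\chi_X(F)^\vee\otimes e^m\big)\in\Lambda .$$ **Theorem.** Let $k\ge0$ and $d\ge1$ be integers and $n=d(k+1)$. The invariant is well defined: $P^{\mathrm{JS}}_n(X,d)^{T_0}$ is finite; for each of its elements, $F$ is scheme-theoretically supported on $Y$ and has exactly one $T_0$-equivariant structure for which $s$ is invariant; $\chi_X(F)$ and $-\chi_X(F)+\chi_Y(F,F)$ have finitely many weights, and the trivial weight has multiplicity $0$ in the latter. Moreover, in $\Lambda$, $$\begin{aligned}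 P^{\mathrm{JS}}_{n,d}(e^m)&=\frac{(-1)^{n}}{1!\,2!\cdots k!}\sum_{\substack{d_0+\cdots+d_k=d\\ d_0,\ldots,d_k\ge0}}\frac{1}{d_0!\cdots d_k!}\prod_{0\le i<j\le k}\Big((j-i)+(d_i-d_j)\frac{\lambda_3}{\lambda_0}\Big)\\ &\quad\times\prod_{i=0}^k\Bigg(\prod_{\substack{0\le a\le d_i-1\\ -i\le b\le k-i}}\Big(\frac{m}{\lambda_3}-a-b\frac{\lambda_0}{\lambda_3}\Big)\prod_{\substack{1\le a\le d_i\\ 1\le b\le k-i}}\frac{1}{a+b\frac{\lambda_0}{\lambda_3}}\prod_{\substack{1\le a\le d_i\\ 1\le b\le i}}\frac{1}{a-b\frac{\lambda_0}{\lambda_3}}\Bigg). \end{aligned}$$ -/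

import Mathlib

noncomputable section

namespace ResolvedConifold

/-! ### The fourfold `X = O(-1,-1,0)` over the projective line

`X` is covered by two copies of affine 4-space, the parts over `ℙ¹ ∖ {Z_∞}` and `ℙ¹ ∖ {Z_0}`:
`U₀` with base coordinate `z` and fibre coordinates `x₁, x₂, x₃`, and `U_∞` with base coordinate
`w` and fibre coordinates `y₁, y₂, y₃`.  They are glued along `z ≠ 0`, `w ≠ 0` by
`w = z⁻¹`, `y₁ = z x₁`, `y₂ = z x₂`, `y₃ = x₃`. -/

/-- The coordinate ring `ℂ[z][x₁, x₂, x₃]` (or `ℂ[w][y₁, y₂, y₃]`) of one chart.  The fibre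
coordinates with indices `1, 2, 3` are the variables `0, 1, 2`. -/
abbrev ChartRing : Type := MvPolynomial (Fin 3) (Polynomial ℂ)

/-- The coordinate ring `ℂ[z, z⁻¹][x₁, x₂, x₃]` of the overlap of the two charts. -/
abbrev OverlapRing : Type := MvPolynomial (Fin 3) (LaurentPolynomial ℂ)

/-- The coordinate of the base line, as a function on a chart (`z` on `U₀`, `w` on `U_∞`). -/
def base : ChartRing := MvPolynomial.C Polynomial.X

/-- The fibre coordinates of a chart. -/
def fib (i : Fin 3) : ChartRing := MvPolynomial.X i

/-- The function `z ^ a` on the overlap. -/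
def zpw (a : ℤ) : OverlapRing := MvPolynomial.C (LaurentPolynomial.T a)

theorem zpw_mul (a b : ℤ) : zpw a * zpw b = zpw (a + b) := by
  rw [zpw, zpw, zpw, ← MvPolynomial.C_mul, ← LaurentPolynomial.T_add]

theorem zpw_zero : zpw 0 = 1 := by
  rw [zpw, LaurentPolynomial.T_zero, MvPolynomial.C_1]

/-- The fibre coordinates `x₁, x₂, x₃` on the overlap. -/
def fib01 (i : Fin 3) : OverlapRing := MvPolynomial.X i

/-- Restriction of functions from `U₀` to the overlap. -/
def rho0 : ChartRing →+* OverlapRing := MvPolynomial.map (Polynomial.toLaurent (R := ℂ))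

/-- Restriction of functions from `U_∞` to the overlap:
`w ↦ z⁻¹`, `y₁ ↦ z x₁`, `y₂ ↦ z x₂`, `y₃ ↦ x₃`. -/
def rho1 : ChartRing →+* OverlapRing :=
  MvPolynomial.eval₂Hom
    ((MvPolynomial.C (σ := Fin 3) (R := LaurentPolynomial ℂ)).comp
      ((LaurentPolynomial.invert (R := ℂ)).toRingEquiv.toRingHom.comp
        (Polynomial.toLaurent (R := ℂ))))
    ![zpw 1 * fib01 0, zpw 1 * fib01 1, fib01 2]

theorem rho0_algebraMap (c : ℂ) :
    rho0 (algebraMap ℂ ChartRing c) = algebraMap ℂ OverlapRing c := by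
  simp [rho0, MvPolynomial.algebraMap_eq, IsScalarTower.algebraMap_apply ℂ (Polynomial ℂ) ChartRing,
    IsScalarTower.algebraMap_apply ℂ (LaurentPolynomial ℂ) OverlapRing]

theorem rho1_algebraMap (c : ℂ) :
    rho1 (algebraMap ℂ ChartRing c) = algebraMap ℂ OverlapRing c := by
  simp [rho1, MvPolynomial.algebraMap_eq, IsScalarTower.algebraMap_apply ℂ (Polynomial ℂ) ChartRing,
    IsScalarTower.algebraMap_apply ℂ (LaurentPolynomial ℂ) OverlapRing]

/-! ### Quasi-coherent sheaves on `X` -/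

/-- A quasi-coherent sheaf on `X`: its modules of sections over `U₀`, over `U_∞` and over the
overlap, with the restriction maps, which are localizations at `z` and at `w`. -/
structure XSheaf where
  M0 : Type
  M1 : Type
  M01 : Type
  [grp0 : AddCommGroup M0]
  [grp1 : AddCommGroup M1]
  [grp01 : AddCommGroup M01]
  [mod0 : Module ChartRing M0]
  [mod1 : Module ChartRing M1]
  [mod01 : Module OverlapRing M01]
  res0 : M0 →ₛₗ[rho0] M01
  res1 : M1 →ₛₗ[rho1] M01
  res0_surj : ∀ y : M01, ∃ (n : ℕ) (a : M0), zpw n • y = res0 a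
  res0_ker : ∀ a : M0, res0 a = 0 → ∃ n : ℕ, base ^ n • a = 0
  res1_surj : ∀ y : M01, ∃ (n : ℕ) (b : M1), zpw (-n) • y = res1 b
  res1_ker : ∀ b : M1, res1 b = 0 → ∃ n : ℕ, base ^ n • b = 0

attribute [instance] XSheaf.grp0 XSheaf.grp1 XSheaf.grp01 XSheaf.mod0 XSheaf.mod1 XSheaf.mod01

namespace XSheaf

variable (F : XSheaf)

instance : Module (Polynomial ℂ) F.M0 := Module.compHom F.M0 (algebraMap (Polynomial ℂ) ChartRing)
instance : Module (Polynomial ℂ) F.M1 := Module.compHom F.M1 (algebraMap (Polynomial ℂ) ChartRing)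
instance : Module (LaurentPolynomial ℂ) F.M01 :=
  Module.compHom F.M01 (algebraMap (LaurentPolynomial ℂ) OverlapRing)
instance : Module ℂ F.M0 := Module.compHom F.M0 (algebraMap ℂ ChartRing)
instance : Module ℂ F.M1 := Module.compHom F.M1 (algebraMap ℂ ChartRing)
instance : Module ℂ F.M01 := Module.compHom F.M01 (algebraMap ℂ OverlapRing)

instance : IsScalarTower (Polynomial ℂ) ChartRing F.M0 :=
  IsScalarTower.of_algebraMap_smul fun _ _ => rfl
instance : IsScalarTower (Polynomial ℂ) ChartRing F.M1 :=
  IsScalarTower.of_algebraMap_smul fun _ _ => rfl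
instance : IsScalarTower (LaurentPolynomial ℂ) OverlapRing F.M01 :=
  IsScalarTower.of_algebraMap_smul fun _ _ => rfl
instance : IsScalarTower ℂ ChartRing F.M0 := IsScalarTower.of_algebraMap_smul fun _ _ => rfl
instance : IsScalarTower ℂ ChartRing F.M1 := IsScalarTower.of_algebraMap_smul fun _ _ => rfl
instance : IsScalarTower ℂ OverlapRing F.M01 := IsScalarTower.of_algebraMap_smul fun _ _ => rfl
instance : IsScalarTower ℂ (Polynomial ℂ) F.M0 := IsScalarTower.of_algebraMap_smul fun c a => by
  change algebraMap (Polynomial ℂ) ChartRing (algebraMap ℂ (Polynomial ℂ) c) • a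
    = algebraMap ℂ ChartRing c • a
  rw [← IsScalarTower.algebraMap_apply]
instance : IsScalarTower ℂ (Polynomial ℂ) F.M1 := IsScalarTower.of_algebraMap_smul fun c a => by
  change algebraMap (Polynomial ℂ) ChartRing (algebraMap ℂ (Polynomial ℂ) c) • a
    = algebraMap ℂ ChartRing c • a
  rw [← IsScalarTower.algebraMap_apply]
instance : IsScalarTower ℂ (LaurentPolynomial ℂ) F.M01 :=
  IsScalarTower.of_algebraMap_smul fun c a => by
    change algebraMap (LaurentPolynomial ℂ) OverlapRing (algebraMap ℂ (LaurentPolynomial ℂ) c) • a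
      = algebraMap ℂ OverlapRing c • a
    rw [← IsScalarTower.algebraMap_apply]
instance : SMulCommClass (Polynomial ℂ) ℂ F.M0 := IsScalarTower.to_smulCommClass'
instance : SMulCommClass (Polynomial ℂ) ℂ F.M1 := IsScalarTower.to_smulCommClass'
instance : SMulCommClass (LaurentPolynomial ℂ) ℂ F.M01 := IsScalarTower.to_smulCommClass'

/-- The restriction from `U₀` to the overlap as a `ℂ`-linear map. -/
def res0C : F.M0 →ₗ[ℂ] F.M01 where
  toFun := F.res0
  map_add' := F.res0.map_add
  map_smul' c a := by
    change F.res0 (algebraMap ℂ ChartRing c • a) = algebraMap ℂ OverlapRing c • F.res0 a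
    rw [F.res0.map_smulₛₗ, rho0_algebraMap]

/-- The restriction from `U_∞` to the overlap as a `ℂ`-linear map. -/
def res1C : F.M1 →ₗ[ℂ] F.M01 where
  toFun := F.res1
  map_add' := F.res1.map_add
  map_smul' c a := by
    change F.res1 (algebraMap ℂ ChartRing c • a) = algebraMap ℂ OverlapRing c • F.res1 a
    rw [F.res1.map_smulₛₗ, rho1_algebraMap]

/-- The Čech differential `(a, b) ↦ a - b` on the overlap. -/
def cech : (F.M0 × F.M1) →ₗ[ℂ] F.M01 :=
  F.res0C.comp (LinearMap.fst ℂ _ _) - F.res1C.comp (LinearMap.snd ℂ _ _)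

/-- Coherent with compact support.  As the projection `π : X → ℙ¹` is affine, a coherent sheaf on
`X` has proper support if and only if `π_* F` is coherent, that is, its two modules of sections are
finitely generated over `ℂ[z]` and over `ℂ[w]`. -/
def IsCoherentCompact : Prop :=
  Module.Finite (Polynomial ℂ) F.M0 ∧ Module.Finite (Polynomial ℂ) F.M1

/-- Scheme-theoretic support on the threefold `Y = O(-1,0) = {x₂ = 0}`. -/
def IsSupportedOnY : Prop :=
  (∀ a : F.M0, fib 1 • a = 0) ∧ (∀ b : F.M1, fib 1 • b = 0)

end XSheaf

/-- `dim H⁰ - dim H¹` for the two-term complex `A → B` that the linear map `δ` induces on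
subspaces `A ≤ V`, `B ≤ W` with `δ(A) ≤ B`. -/
def twoTermEuler {V W : Type*} [AddCommGroup V] [Module ℂ V] [AddCommGroup W] [Module ℂ W]
    (δ : V →ₗ[ℂ] W) (A : Submodule ℂ V) (B : Submodule ℂ W) : ℤ :=
  (Module.finrank ℂ (A ⊓ LinearMap.ker δ : Submodule ℂ V) : ℤ)
    - (Module.finrank ℂ (B ⧸ (A.map δ).submoduleOf B) : ℤ)

/-- A quasi-coherent subsheaf: submodules of sections over the two charts that generate the same
submodule over the overlap. -/
structure Subsheaf (F : XSheaf) where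
  N0 : Submodule ChartRing F.M0
  N1 : Submodule ChartRing F.M1
  glue : Submodule.span OverlapRing (F.res0 '' N0) = Submodule.span OverlapRing (F.res1 '' N1)

namespace Subsheaf

variable {F : XSheaf}

/-- The sections of the subsheaf over the overlap. -/
def N01 (N : Subsheaf F) : Submodule OverlapRing F.M01 :=
  Submodule.span OverlapRing (F.res0 '' N.N0)

/-- The subsheaf `F` of `F`. -/
def whole (F : XSheaf) : Subsheaf F where
  N0 := ⊤
  N1 := ⊤
  glue := by
    have h0 : Submodule.span OverlapRing (F.res0 '' (⊤ : Submodule ChartRing F.M0)) = ⊤ := by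
      refine eq_top_iff.2 fun y _ => ?_
      obtain ⟨n, a, h⟩ := F.res0_surj y
      have : y = zpw (-n) • F.res0 a := by
        rw [← h, ← mul_smul]; rw [zpw_mul]; simp [zpw_zero]
      rw [this]
      exact Submodule.smul_mem _ _ (Submodule.subset_span ⟨a, trivial, rfl⟩)
    have h1 : Submodule.span OverlapRing (F.res1 '' (⊤ : Submodule ChartRing F.M1)) = ⊤ := by
      refine eq_top_iff.2 fun y _ => ?_
      obtain ⟨n, b, h⟩ := F.res1_surj y
      have : y = zpw n • F.res1 b := by
        rw [← h, ← mul_smul]; rw [zpw_mul]; simp [zpw_zero]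
      rw [this]
      exact Submodule.smul_mem _ _ (Submodule.subset_span ⟨b, trivial, rfl⟩)
    rw [h0, h1]

/-- The degree: the rank of the push-forward to `ℙ¹`. -/
def deg (N : Subsheaf F) : ℕ := Module.finrank (Polynomial ℂ) N.N0

/-- The Euler characteristic, computed by the Čech complex of the two affine charts. -/
def chi (N : Subsheaf F) : ℤ :=
  twoTermEuler F.cech ((N.N0.restrictScalars ℂ).prod (N.N1.restrictScalars ℂ))
    (N.N01.restrictScalars ℂ)

/-- The slope `χ / d`, which is `∞` if `d = 0`. -/
def slope (N : Subsheaf F) : WithTop ℚ :=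
  if N.deg = 0 then ⊤ else (((N.chi : ℚ) / (N.deg : ℚ) : ℚ) : WithTop ℚ)

end Subsheaf

/-! ### Joyce–Song pairs -/

/-- A pair `(F, s)` of a quasi-coherent sheaf and a section `s : O_X → F`. -/
structure SheafPair where
  F : XSheaf
  s0 : F.M0
  s1 : F.M1
  glue : F.res0 s0 = F.res1 s1

namespace SheafPair

def deg (P : SheafPair) : ℕ := (Subsheaf.whole P.F).deg

def chi (P : SheafPair) : ℤ := (Subsheaf.whole P.F).chi

/-- Joyce–Song stability: `F` is a compactly supported one-dimensional semistable sheaf, `s ≠ 0`,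
and every proper subsheaf that contains the image of `s` has smaller slope than `F`. -/
structure IsJSStable (P : SheafPair) : Prop where
  coherent : P.F.IsCoherentCompact
  oneDim : P.deg ≠ 0
  semistable : ∀ N : Subsheaf P.F, (N.N0 ≠ ⊥ ∨ N.N1 ≠ ⊥) →
    N.slope ≤ (Subsheaf.whole P.F).slope
  section_ne : P.s0 ≠ 0 ∨ P.s1 ≠ 0
  stable : ∀ N : Subsheaf P.F, P.s0 ∈ N.N0 → P.s1 ∈ N.N1 → (N.N0 ≠ ⊤ ∨ N.N1 ≠ ⊤) →
    N.slope < (Subsheaf.whole P.F).slope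

/-- An isomorphism from `(F, s)` to `(F', s')` that covers the action of
`t = (t₀, t₁, t₂, t₃) ∈ (ℂ^*)⁴` on `X`, under which the functions `z, x₁, x₂, x₃` scale by
`t₀, t₁, t₂, t₃`, so that `w, y₁, y₂, y₃` scale by `t₀⁻¹, t₀t₁, t₀t₂, t₃`.
For `t = 1` it is an isomorphism of pairs. -/
structure TwistIso (t : Fin 4 → ℂˣ) (P Q : SheafPair) where
  e0 : P.F.M0 ≃ₗ[ℂ] Q.F.M0
  e1 : P.F.M1 ≃ₗ[ℂ] Q.F.M1
  e01 : P.F.M01 ≃ₗ[ℂ] Q.F.M01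
  e0_base : ∀ a, e0 (base • a) = (t 0 : ℂ) • base • e0 a
  e0_fib : ∀ i a, e0 (fib i • a) = (t i.succ : ℂ) • fib i • e0 a
  e1_base : ∀ b, e1 (base • b) = ((t 0)⁻¹ : ℂ) • base • e1 b
  e1_fib : ∀ i b, e1 (fib i • b) =
    ((![t 0 * t 1, t 0 * t 2, t 3] : Fin 3 → ℂˣ) i : ℂ) • fib i • e1 b
  e01_base : ∀ y, e01 (zpw 1 • y) = (t 0 : ℂ) • zpw 1 • e01 y
  e01_fib : ∀ i y, e01 (fib01 i • y) = (t i.succ : ℂ) • fib01 i • e01 y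
  e_res0 : ∀ a, e01 (P.F.res0 a) = Q.F.res0 (e0 a)
  e_res1 : ∀ b, e01 (P.F.res1 b) = Q.F.res1 (e1 b)
  e_s0 : e0 P.s0 = Q.s0
  e_s1 : e1 P.s1 = Q.s1

/-- Isomorphism of pairs. -/
def Iso (P Q : SheafPair) : Prop := Nonempty (TwistIso 1 P Q)

instance isoSetoid : Setoid SheafPair where
  r := Iso
  iseqv :=
    { refl := fun P => ⟨by
        refine ⟨.refl ℂ _, .refl ℂ _, .refl ℂ _, ?_, ?_, ?_, ?_, ?_, ?_, ?_, ?_, ?_, ?_⟩ <;>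
          first
            | (intro i a; fin_cases i <;> simp)
            | simp⟩
      symm := by
        rintro P Q ⟨e⟩
        have h1 : ∀ i : Fin 3, (![1, 1, 1] : Fin 3 → ℂˣ) i = 1 := by
          intro i; fin_cases i <;> rfl
        refine ⟨⟨e.e0.symm, e.e1.symm, e.e01.symm, ?_, ?_, ?_, ?_, ?_, ?_, ?_, ?_, ?_, ?_⟩⟩
        · intro a; apply e.e0.injective; simp [e.e0_base]
        · intro i a; apply e.e0.injective; simp [e.e0_fib]
        · intro a; apply e.e1.injective; simp [e.e1_base]
        · intro i a; apply e.e1.injective; simp [e.e1_fib, h1]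
        · intro a; apply e.e01.injective; simp [e.e01_base]
        · intro i a; apply e.e01.injective; simp [e.e01_fib]
        · intro a; apply e.e01.injective; simp [e.e_res0]
        · intro a; apply e.e01.injective; simp [e.e_res1]
        · apply e.e0.injective; simp [e.e_s0]
        · apply e.e1.injective; simp [e.e_s1]
      trans := by
        rintro P Q R ⟨e⟩ ⟨f⟩
        have h1 : ∀ i : Fin 3, (![1, 1, 1] : Fin 3 → ℂˣ) i = 1 := by
          intro i; fin_cases i <;> rfl
        refine ⟨⟨e.e0.trans f.e0, e.e1.trans f.e1, e.e01.trans f.e01,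
          ?_, ?_, ?_, ?_, ?_, ?_, ?_, ?_, ?_, ?_⟩⟩
        · intro a; simp [e.e0_base, f.e0_base]
        · intro i a; simp [e.e0_fib, f.e0_fib]
        · intro a; simp [e.e1_base, f.e1_base]
        · intro i a; simp [e.e1_fib, f.e1_fib, h1]
        · intro a; simp [e.e01_base, f.e01_base]
        · intro i a; simp [e.e01_fib, f.e01_fib]
        · intro a; simp [e.e_res0, f.e_res0]
        · intro a; simp [e.e_res1, f.e_res1]
        · simp [e.e_s0, f.e_s0]
        · simp [e.e_s1, f.e_s1] }

/-- `(F, s)` is fixed, up to isomorphism, by every point of the Calabi–Yau torus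
`T₀ = {t₀ t₁ t₂ t₃ = 1}`. -/
def IsFixed (P : SheafPair) : Prop :=
  ∀ t : Fin 4 → ℂˣ, ∏ i, t i = 1 → Nonempty (TwistIso t P P)

end SheafPair

/-- The set `P_n^{JS}(X, d)^{T₀}`: the isomorphism classes of `T₀`-fixed Joyce–Song stable pairs
with `(d(F), χ(F)) = (d, n)`. -/
def fixedLocus (n : ℤ) (d : ℕ) : Set (Quotient SheafPair.isoSetoid) :=
  {p | ∃ P : SheafPair, Quotient.mk _ P = p ∧ P.IsJSStable ∧ P.deg = d ∧ P.chi = n ∧ P.IsFixed}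

/-! ### Equivariant structures and characters -/

/-- The character lattice of `T₀`: `w` stands for `t₀ ^ w₀ t₁ ^ w₁ t₂ ^ w₂`. -/
abbrev Character : Type := Fin 3 → ℤ

/-- The characters `t₀, t₁, t₂` and `t₃ = t₀⁻¹ t₁⁻¹ t₂⁻¹`. -/
def tchar : Fin 4 → Character :=
  ![Pi.single 0 1, Pi.single 1 1, Pi.single 2 1, fun _ => -1]

/-- A `T₀`-equivariant structure on `F` for which `s` is invariant: weight decompositions of the
modules of sections that are compatible with the weights `t₀, t₁, t₂, t₃` of `z, x₁, x₂, x₃`. -/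
structure EquivariantStructure (P : SheafPair) where
  G0 : Character → Submodule ℂ P.F.M0
  G1 : Character → Submodule ℂ P.F.M1
  G01 : Character → Submodule ℂ P.F.M01
  internal0 : DirectSum.IsInternal G0
  internal1 : DirectSum.IsInternal G1
  internal01 : DirectSum.IsInternal G01
  base0 : ∀ χ, ∀ a ∈ G0 χ, base • a ∈ G0 (χ + tchar 0)
  fib0 : ∀ i χ, ∀ a ∈ G0 χ, fib i • a ∈ G0 (χ + tchar i.succ)
  base1 : ∀ χ, ∀ b ∈ G1 χ, base • b ∈ G1 (χ - tchar 0)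
  fib1 : ∀ i χ, ∀ b ∈ G1 χ, fib i • b ∈
    G1 (χ + (![tchar 0 + tchar 1, tchar 0 + tchar 2, tchar 3] : Fin 3 → Character) i)
  base01 : ∀ (a : ℤ) χ, ∀ y ∈ G01 χ, zpw a • y ∈ G01 (χ + a • tchar 0)
  fib_01 : ∀ i χ, ∀ y ∈ G01 χ, fib01 i • y ∈ G01 (χ + tchar i.succ)
  res_0 : ∀ χ, ∀ a ∈ G0 χ, P.F.res0 a ∈ G01 χ
  res_1 : ∀ χ, ∀ b ∈ G1 χ, P.F.res1 b ∈ G01 χ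
  s_0 : P.s0 ∈ G0 0
  s_1 : P.s1 ∈ G1 0

namespace EquivariantStructure

variable {P : SheafPair} (E : EquivariantStructure P)

/-- The class `χ_X(F)` in the representation ring of `T₀`, given by its weight multiplicities. -/
def chiX (μ : Character) : ℤ := twoTermEuler P.F.cech ((E.G0 μ).prod (E.G1 μ)) (E.G01 μ)

/-- The linear endomorphisms of a graded module that shift weights by `μ`. -/
def homDeg {R M : Type} [CommRing R] [AddCommGroup M] [Module R M] [Module ℂ M]
    [SMulCommClass R ℂ M] (G : Character → Submodule ℂ M) (μ : Character) :
    Submodule ℂ (M →ₗ[R] M) where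
  carrier := {φ | ∀ χ, ∀ a ∈ G χ, φ a ∈ G (χ + μ)}
  add_mem' h h' χ a ha := (G _).add_mem (h χ a ha) (h' χ a ha)
  zero_mem' _ _ _ := (G _).zero_mem
  smul_mem' c _ h χ a ha := (G _).smul_mem c (h χ a ha)

/-- Endomorphisms of `π_* F` over `U₀`. -/
abbrev End0 (F : XSheaf) : Type := F.M0 →ₗ[Polynomial ℂ] F.M0
/-- Endomorphisms of `π_* F` over `U_∞`. -/
abbrev End1 (F : XSheaf) : Type := F.M1 →ₗ[Polynomial ℂ] F.M1
/-- Endomorphisms of `π_* F` over the overlap. -/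
abbrev End01 (F : XSheaf) : Type := F.M01 →ₗ[LaurentPolynomial ℂ] F.M01

/-- Let `L = O_{ℙ¹}(-l Z_∞) ⊗ ν`, with the generator `e₀` of weight `ν` over `U₀` and the generator
`e_∞ = z ^ (-l) e₀` over `U_∞`.  These are the sections of weight `μ` of
`Hom(π_* F, π_* F ⊗ L)` over `U₀`, each with its restriction to the overlap (in terms of `e₀`). -/
def hom0 (ν μ : Character) : Submodule ℂ (End0 P.F × End01 P.F) where
  carrier := {φ | φ.1 ∈ homDeg E.G0 (μ - ν) ∧ φ.2 ∈ homDeg E.G01 (μ - ν) ∧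
    ∀ a, φ.2 (P.F.res0C a) = P.F.res0C (φ.1 a)}
  add_mem' h h' := ⟨Submodule.add_mem _ h.1 h'.1, Submodule.add_mem _ h.2.1 h'.2.1, fun a => by
    simp [h.2.2 a, h'.2.2 a]⟩
  zero_mem' := ⟨Submodule.zero_mem _, Submodule.zero_mem _, fun a => by simp⟩
  smul_mem' c _ h := ⟨Submodule.smul_mem _ c h.1, Submodule.smul_mem _ c h.2.1, fun a => by
    simp [h.2.2 a]⟩

/-- The sections of weight `μ` of `Hom(π_* F, π_* F ⊗ L)` over `U_∞` (in terms of `e_∞`), each with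
its restriction to the overlap (in terms of `e₀`). -/
def hom1 (l : ℤ) (ν μ : Character) : Submodule ℂ (End1 P.F × End01 P.F) where
  carrier := {φ | φ.1 ∈ homDeg E.G1 (μ - ν + l • tchar 0) ∧ φ.2 ∈ homDeg E.G01 (μ - ν) ∧
    ∀ b, φ.2 (P.F.res1C b) = (LaurentPolynomial.T (-l) : LaurentPolynomial ℂ) •
      P.F.res1C (φ.1 b)}
  add_mem' h h' := ⟨Submodule.add_mem _ h.1 h'.1, Submodule.add_mem _ h.2.1 h'.2.1, fun a => by
    simp [h.2.2 a, h'.2.2 a]⟩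
  zero_mem' := ⟨Submodule.zero_mem _, Submodule.zero_mem _, fun a => by simp⟩
  smul_mem' c _ h := ⟨Submodule.smul_mem _ c h.1, Submodule.smul_mem _ c h.2.1, fun a => by
    have := h.2.2 a
    simp only [Prod.smul_snd, Prod.smul_fst, LinearMap.smul_apply, map_smul, this]
    rw [smul_comm]⟩

/-- The multiplicity of `μ` in `χ_{ℙ¹}(π_* F, π_* F ⊗ L)`, for `L = O_{ℙ¹}(-l Z_∞) ⊗ ν` and `F` pure
(so that `π_* F` is locally free), by the Čech complex of the sheaf `Hom(π_* F, π_* F ⊗ L)`. -/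
def chiP1 (l : ℤ) (ν μ : Character) : ℤ :=
  twoTermEuler
    (((LinearMap.snd ℂ (End0 P.F) (End01 P.F)).comp (LinearMap.fst ℂ _ _)
      - (LinearMap.snd ℂ (End1 P.F) (End01 P.F)).comp (LinearMap.snd ℂ _ _) :
      ((End0 P.F × End01 P.F) × (End1 P.F × End01 P.F)) →ₗ[ℂ] End01 P.F))
    ((E.hom0 ν μ).prod (E.hom1 l ν μ)) (homDeg E.G01 (μ - ν))

/-- The class `χ_Y(i_* π_* F, i_* π_* F)`, where `i : ℙ¹ → Y` is the zero section.  By the Koszul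
resolution of `i_* O_{ℙ¹}`, `RHom_Y(i_* E, i_* E)` has the pieces `RHom_{ℙ¹}(E, E ⊗ ⋀ᵖ N)[-p]`,
so the class is the alternating sum of `χ_{ℙ¹}(π_* F, π_* F ⊗ ⋀ᵖ N)` over `p = 0, 1, 2`, where
`N = O(-Z_∞) ⊗ t₁⁻¹ ⊕ O ⊗ t₃⁻¹` is the normal bundle of the zero section in `Y`. -/
def chiY (μ : Character) : ℤ :=
  E.chiP1 0 0 μ - (E.chiP1 1 (-tchar 1) μ + E.chiP1 0 (-tchar 3) μ)
    + E.chiP1 1 (-tchar 1 - tchar 3) μ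

/-- The square root `-χ_X(F) + χ_Y(F, F)` of `χ_X(I, I)₀`. -/
def halfClass (μ : Character) : ℤ := -E.chiX μ + E.chiY μ

end EquivariantStructure

/-! ### Equivariant parameters and the invariant -/

/-- The field `Λ = ℚ(λ₀, λ₁, λ₂, m)`. -/
abbrev Lam : Type := FractionRing (MvPolynomial (Fin 4) ℚ)

/-- The equivariant parameters `λ₀, λ₁, λ₂` and `λ₃ = -(λ₀ + λ₁ + λ₂)` of `T₀`. -/
def lam : Fin 4 → Lam :=
  ![algebraMap (MvPolynomial (Fin 4) ℚ) Lam (MvPolynomial.X 0),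
    algebraMap (MvPolynomial (Fin 4) ℚ) Lam (MvPolynomial.X 1),
    algebraMap (MvPolynomial (Fin 4) ℚ) Lam (MvPolynomial.X 2),
    -algebraMap (MvPolynomial (Fin 4) ℚ) Lam (MvPolynomial.X 0 + MvPolynomial.X 1 + MvPolynomial.X 2)]

/-- The equivariant weight `m` of `e^m`. -/
def mm : Lam := algebraMap (MvPolynomial (Fin 4) ℚ) Lam (MvPolynomial.X 3)

/-- The Euler class (first Chern class) of a character. -/
def charClass (w : Character) : Lam :=
  (w 0 : Lam) * lam 0 + (w 1 : Lam) * lam 1 + (w 2 : Lam) * lam 2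

/-- The Euler class `e_{T₀}(V)` of a virtual representation `V`, given by its multiplicities. -/
def eulerClass (V : Character → ℤ) : Lam := ∏ᶠ w, charClass w ^ V w

/-- The Euler class `e_{T₀ × ℂ^*}(V^∨ ⊗ e^m)`. -/
def eulerClassDualTwist (V : Character → ℤ) : Lam := ∏ᶠ w, (mm + charClass (-w)) ^ V w

/-- The contribution of a `T₀`-equivariant pair whose sheaf is supported on `Y`:
`(-1)^{χ(F) + d(F)} e(-χ_X(F) + χ_Y(F, F)) · e(χ_X(F)^∨ ⊗ e^m)`. -/
def contribution {P : SheafPair} (E : EquivariantStructure P) : Lam :=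
  (-1 : Lam) ^ (P.chi + P.deg : ℤ) * eulerClass E.halfClass * eulerClassDualTwist E.chiX

open Classical in
/-- The contribution of an isomorphism class, by an equivariant structure on a representative. -/
def classContribution (p : Quotient SheafPair.isoSetoid) : Lam :=
  if h : Nonempty (EquivariantStructure p.out) then contribution h.some else 0

/-- The tautological Joyce–Song invariant `P^{JS}_{n,d}(e^m)`. -/
def tautJS (n : ℤ) (d : ℕ) : Lam := ∑ᶠ p ∈ fixedLocus n d, classContribution p

end ResolvedConifold

end

/-! The fixed stable pairs are isolated and indexed by compositions `d = d_0 + … + d_k`; the formula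
is the sum of their contributions.

Classification. Since `π` is affine, work with `π_* F` through its sections over the two charts,
seen inside the overlap. Semistability excludes torsion. Let `m` be the last twist with `H⁰(F(-m)) ≠
0`. Evaluation at `Z_0` gives `h⁰(F(-j)) ≤ h⁰(F(-j-1)) + d`, so `d(k+1) = χ(F) ≤ h⁰(F) ≤ d(m+1)` and
`m ≥ k`. Conversely `H⁰(F(-m)) ⊗ O(m)` is a subsheaf of slope `m+1`, so `m ≤ k`. Hence `π_* F = V ⊗
O(k)` with `V = H⁰(F(-k))` of dimension `d` (`twistSpace_eq`, `image0_eq_span`). The coordinates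
`x₁, x₂` map `V` into `H⁰(F(-k-1)) = 0`, so `F` is `V` with the endomorphism `x₃`, supported on `Y`.
The section is `∑ z^p v_p` with `v_p ∈ V`, and Joyce–Song stability says that the `v_p` generate `V`
over `ℂ[x₃]` (`span_pow_fibMap`). If the pair is fixed, `x₃^a v_p` is an eigenvector with eigenvalue
`t_0^(-p) t_3^a`. For generic `t` these differ, so `V = ⨁_p ℂ[x₃]/x₃^(d_p)` (`exists_normalForm`).
Every such normal form is stable and fixed (`isJSStable`, `twistIso`), and the heights `d_p` can be
recovered from the pair (`unique`).

Contribution. In a normal form `z^q x₃^a y_p` has weight `t_0^(q-p) t_3^a`, and invariance of the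
section forces this grading. Thus `χ_X(F) = ∑ t_0^(j-i) t_3^a` over all `i, j` and `a < d_i`. In
`χ_Y(F, F)` the terms twisted by `O(-1)` vanish, and the factor `1 - t_3⁻¹` makes the rest telescope
to `∑ t_0^(j-i) (t_3^a - t_3^(a-d_j))`. Hence `-χ_X(F) + χ_Y(F, F) = -∑ t_0^(j-i) t_3^(a-d_j)`,
which has no trivial weight (`halfClass_eq_multiplicity`). Pairing the factors of `(i, j)` and `(j,
i)` turns its Euler class into the stated product (`prod_pairs`). -/

noncomputable section
namespace ResolvedConifold

/-! ### Linear algebra -/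

section LinearAlgebra

variable {κ K W : Type*} [Field K] [AddCommGroup W] [Module K W]

theorem span_image_inf_span_image {v : κ → W} (hv : LinearIndependent K v) (s t : Set κ) :
    Submodule.span K (v '' s) ⊓ Submodule.span K (v '' t) = Submodule.span K (v '' (s ∩ t)) := by
  simp only [Finsupp.span_image_eq_map_linearCombination]
  rw [← Submodule.map_inf _ hv, Finsupp.supported_inter]

theorem finrank_span_image {v : κ → W} (hv : LinearIndependent K v) (s : Set κ) :
    Module.finrank K (Submodule.span K (v '' s)) = s.ncard := by
  have h : LinearIndependent K (fun x : s => v x) := hv.comp _ Subtype.val_injective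
  have := Module.finrank_eq_nat_card_basis (Module.Basis.span h)
  rw [Set.image_eq_range, this, Nat.card_coe_set_eq]

/-- The span of the basis vectors of weight `χ`. -/
def weightSpan {X : Type*} (b : κ → W) (w : κ → X) (χ : X) : Submodule K W :=
  Submodule.span K (b '' {x | w x = χ})

theorem self_mem_weightSpan {X : Type*} (b : κ → W) (w : κ → X) (x : κ) :
    b x ∈ weightSpan (K := K) b w (w x) :=
  Submodule.subset_span ⟨x, rfl, rfl⟩

theorem isInternal_weightSpan {X : Type*} [DecidableEq X] (b : Module.Basis κ K W) (w : κ → X) :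
    DirectSum.IsInternal (weightSpan (K := K) b w) := by
  rw [DirectSum.isInternal_submodule_iff_iSupIndep_and_iSup_eq_top]
  constructor
  · rw [iSupIndep_def]
    intro χ
    refine (b.linearIndependent.disjoint_span_image (s := {x | w x = χ}) (t := {x | w x ≠ χ})
      ?_).mono_right ?_
    · rw [Set.disjoint_left]; intro x h h'; exact h' h
    · refine iSup₂_le fun ψ hψ => Submodule.span_mono (Set.image_mono ?_)
      intro x hx; simp only [Set.mem_ofPred_eq] at hx ⊢; rw [hx]; exact hψ
  · rw [eq_top_iff, ← b.span_eq, Submodule.span_le]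
    rintro _ ⟨x, rfl⟩
    exact Submodule.mem_iSup_of_mem (w x) (self_mem_weightSpan _ _ _)

/-- The part of an element of `G' χ` outside `G χ` lies in `G' χ` and also in the sum of the other
`G' ψ`, so it vanishes. This reduces uniqueness of the equivariant structure to an inclusion of
weight spaces. -/
theorem IsInternal.eq_of_le {X : Type*} [DecidableEq X] {G G' : X → Submodule K W}
    (hG : DirectSum.IsInternal G) (hG' : DirectSum.IsInternal G') (h : ∀ χ, G χ ≤ G' χ) :
    G = G' := by
  funext χ
  refine le_antisymm (h χ) fun y hy => ?_
  rw [DirectSum.isInternal_submodule_iff_iSupIndep_and_iSup_eq_top] at hG hG'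
  have hy' : y ∈ G χ ⊔ ⨆ ψ, ⨆ (_ : ψ ≠ χ), G ψ := by
    rw [← iSup_split_single]; rw [hG.2]; trivial
  obtain ⟨u, hu, v, hv, rfl⟩ := Submodule.mem_sup.1 hy'
  have hv1 : v ∈ G' χ := by simpa using (G' χ).sub_mem hy (h χ hu)
  have hv2 : v ∈ ⨆ ψ, ⨆ (_ : ψ ≠ χ), G' ψ :=
    (iSup₂_mono fun ψ _ => h ψ : (⨆ ψ, ⨆ (_ : ψ ≠ χ), G ψ) ≤ _) hv
  have := Submodule.disjoint_def.1 (hG'.1 χ) v hv1 hv2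
  rwa [this, add_zero]

/-- With injective restrictions the grading over a chart is forced by the grading over the overlap.
-/
theorem IsInternal.eq_comap {X M : Type*} [DecidableEq X] [AddCommGroup M] [Module K M]
    {G : X → Submodule K M} {G' : X → Submodule K W} (hG : DirectSum.IsInternal G)
    (hG' : DirectSum.IsInternal G') (f : M →ₗ[K] W) (hf : Function.Injective f)
    (h : ∀ χ, ∀ a ∈ G χ, f a ∈ G' χ) (χ : X) : G χ = (G' χ).comap f := by
  refine le_antisymm (h χ) fun a ha => ?_
  rw [DirectSum.isInternal_submodule_iff_iSupIndep_and_iSup_eq_top] at hG hG'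
  have ha' : a ∈ G χ ⊔ ⨆ ψ, ⨆ (_ : ψ ≠ χ), G ψ := by
    rw [← iSup_split_single, hG.2]; trivial
  obtain ⟨u, hu, v, hv, rfl⟩ := Submodule.mem_sup.1 ha'
  have hv1 : f v ∈ G' χ := by
    have := (G' χ).sub_mem ha (h χ u hu)
    simpa using this
  have hv2 : f v ∈ ⨆ ψ, ⨆ (_ : ψ ≠ χ), G' ψ := by
    have h2 : (⨆ ψ, ⨆ (_ : ψ ≠ χ), G ψ) ≤ (⨆ ψ, ⨆ (_ : ψ ≠ χ), G' ψ).comap f :=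
      iSup₂_le fun ψ hψ a ha => Submodule.mem_iSup_of_mem ψ
        (Submodule.mem_iSup_of_mem hψ (h ψ a ha))
    exact h2 hv
  have := Submodule.disjoint_def.1 (hG'.1 χ) _ hv1 hv2
  rw [map_eq_zero_iff f hf] at this
  rwa [this, add_zero]

/-- The component of weight `χ` with respect to a grading. -/
def component {X : Type*} [DecidableEq X] {G : X → Submodule K W} (hG : DirectSum.IsInternal G)
    (χ : X) : W →ₗ[K] W :=
  let _ := hG.chooseDecomposition
  { toFun := fun y => DirectSum.decompose G y χ
    map_add' := fun y y' => by simp [DirectSum.decompose_add]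
    map_smul' := fun c y => by simp [DirectSum.decompose_smul, DirectSum.smul_apply] }

section component

variable {X : Type*} [DecidableEq X] {G : X → Submodule K W} (hG : DirectSum.IsInternal G)

theorem component_of_mem {χ : X} {y : W} (hy : y ∈ G χ) (ψ : X) :
    component hG ψ y = if ψ = χ then y else 0 := by
  let _ := hG.chooseDecomposition
  change (DirectSum.decompose G y ψ : W) = _
  split_ifs with h
  · subst h; exact DirectSum.decompose_of_mem_same G hy
  · exact DirectSum.decompose_of_mem_ne G hy (Ne.symm h)

theorem mem_of_component_eq_zero {χ : X} {y : W} (h : ∀ ψ, ψ ≠ χ → component hG ψ y = 0) :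
    y ∈ G χ := by
  classical
  let _ := hG.chooseDecomposition
  rw [← DirectSum.sum_support_decompose G y]
  refine Submodule.sum_mem _ fun ψ _ => ?_
  by_cases hψ : ψ = χ
  · subst hψ; exact (DirectSum.decompose G y ψ).2
  · have h1 : (DirectSum.decompose G y ψ : W) = 0 := h ψ hψ
    rw [h1]; exact Submodule.zero_mem _

/-- Injectivity of `σ` keeps distinct weights distinct after `f`. It is applied to multiplication by
powers of `z`, which translates weights, and to the restriction maps, which preserve them. -/
theorem component_comm {X' M : Type*} [DecidableEq X'] [AddCommGroup M] [Module K M]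
    {G' : X' → Submodule K M} (hG' : DirectSum.IsInternal G') (f : W →ₗ[K] M) (σ : X → X')
    (hσ : Function.Injective σ) (h : ∀ χ, ∀ y ∈ G χ, f y ∈ G' (σ χ)) (χ : X) (y : W) :
    component hG' (σ χ) (f y) = f (component hG χ y) := by
  have hy : y ∈ ⨆ ψ, G ψ := by
    rw [((DirectSum.isInternal_submodule_iff_iSupIndep_and_iSup_eq_top G).1 hG).2]; trivial
  induction hy using Submodule.iSup_induction' with
  | mem ψ y hy =>
    rw [component_of_mem hG hy, component_of_mem hG' (h ψ y hy)]
    by_cases h' : χ = ψ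
    · simp [h']
    · rw [if_neg h', if_neg (fun h'' => h' (hσ h'')), map_zero]
  | zero => simp
  | add a b _ _ ha hb => simp only [map_add, ha, hb]

end component

end LinearAlgebra

/-! ### Euler characteristics of two-term Čech complexes -/

section TwoTerm

variable {V₀ V₁ W : Type*} [AddCommGroup V₀] [Module ℂ V₀] [AddCommGroup V₁] [Module ℂ V₁]
  [AddCommGroup W] [Module ℂ W] {δ : V₀ × V₁ →ₗ[ℂ] W} {f₀ : V₀ →ₗ[ℂ] W} {f₁ : V₁ →ₗ[ℂ] W}
  {A₀ : Submodule ℂ V₀} {A₁ : Submodule ℂ V₁}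

/-- A cocycle is determined by its common image over the overlap, so `H⁰` is the intersection of the
two images. -/
theorem finrank_prod_inf_ker (hδ : ∀ a b, δ (a, b) = f₀ a - f₁ b)
    (h₀ : ∀ a ∈ A₀, f₀ a = 0 → a = 0) (h₁ : ∀ b ∈ A₁, f₁ b = 0 → b = 0) :
    Module.finrank ℂ (A₀.prod A₁ ⊓ LinearMap.ker δ : Submodule ℂ (V₀ × V₁)) =
      Module.finrank ℂ (A₀.map f₀ ⊓ A₁.map f₁ : Submodule ℂ W) := by
  refine LinearEquiv.finrank_eq (LinearEquiv.ofBijective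
    (LinearMap.codRestrict _ ((f₀ ∘ₗ LinearMap.fst ℂ V₀ V₁).domRestrict _) ?_) ⟨?_, ?_⟩)
  · rintro ⟨⟨a, b⟩, ⟨ha, hb⟩, h⟩
    have h' : f₀ a = f₁ b := by
      have h : δ (a, b) = 0 := h
      rw [hδ] at h; exact sub_eq_zero.1 h
    exact ⟨⟨a, ha, rfl⟩, ⟨b, hb, h'.symm⟩⟩
  · rw [injective_iff_map_eq_zero]
    rintro ⟨⟨a, b⟩, ⟨ha, hb⟩, h⟩ h2
    have h' : f₀ a = f₁ b := by
      have h : δ (a, b) = 0 := h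
      rw [hδ] at h; exact sub_eq_zero.1 h
    have h3 : f₀ a = 0 := congrArg Subtype.val h2
    have ha0 := h₀ a ha h3
    have hb0 := h₁ b hb (by rw [← h', h3])
    subst ha0 hb0
    rfl
  · rintro ⟨y, ⟨a, ha, rfl⟩, ⟨b, hb, h⟩⟩
    refine ⟨⟨(a, b), ⟨ha, hb⟩, ?_⟩, rfl⟩
    change δ (a, b) = 0
    rw [hδ, h, sub_self]

/-- The subtracted `finrank` is non-negative whether or not the quotient is finite-dimensional, so
no finiteness of `H¹` enters. -/
theorem twoTermEuler_prod_le (hδ : ∀ a b, δ (a, b) = f₀ a - f₁ b)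
    (h₀ : ∀ a ∈ A₀, f₀ a = 0 → a = 0) (h₁ : ∀ b ∈ A₁, f₁ b = 0 → b = 0) (B : Submodule ℂ W) :
    twoTermEuler δ (A₀.prod A₁) B ≤
      Module.finrank ℂ (A₀.map f₀ ⊓ A₁.map f₁ : Submodule ℂ W) := by
  rw [twoTermEuler, finrank_prod_inf_ker hδ h₀ h₁]
  omega

theorem twoTermEuler_prod_eq (hδ : ∀ a b, δ (a, b) = f₀ a - f₁ b)
    (h₀ : ∀ a ∈ A₀, f₀ a = 0 → a = 0) (h₁ : ∀ b ∈ A₁, f₁ b = 0 → b = 0) {B : Submodule ℂ W}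
    (hB : B ≤ A₀.map f₀ ⊔ A₁.map f₁) :
    twoTermEuler δ (A₀.prod A₁) B =
      Module.finrank ℂ (A₀.map f₀ ⊓ A₁.map f₁ : Submodule ℂ W) := by
  rw [twoTermEuler, finrank_prod_inf_ker hδ h₀ h₁]
  have h : ((A₀.prod A₁).map δ).submoduleOf B = ⊤ := by
    rw [eq_top_iff]
    rintro ⟨y, hy⟩ -
    obtain ⟨_, ⟨a, ha, rfl⟩, _, ⟨b, hb, rfl⟩, rfl⟩ := Submodule.mem_sup.1 (hB hy)
    exact ⟨(a, -b), ⟨ha, A₁.neg_mem hb⟩, by simp [hδ]⟩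
  rw [h]
  have : Module.finrank ℂ (B ⧸ (⊤ : Submodule ℂ B)) = 0 := Module.finrank_zero_of_subsingleton
  omega

end TwoTerm

/-! ### Lattices over the two charts -/

section Lattice

variable {W : Type*} [AddCommGroup W] [Module ℂ W] [Module (LaurentPolynomial ℂ) W]
  [SMulCommClass (LaurentPolynomial ℂ) ℂ W]

/-- Multiplication by `z ^ q`. -/
def shift (q : ℤ) : W →ₗ[ℂ] W where
  toFun y := (LaurentPolynomial.T q : LaurentPolynomial ℂ) • y
  map_add' := smul_add _
  map_smul' c y := smul_comm _ c y

theorem shift_shift (p q : ℤ) (y : W) : shift p (shift q y) = shift (p + q) y := by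
  change (LaurentPolynomial.T p : LaurentPolynomial ℂ) •
      (LaurentPolynomial.T q : LaurentPolynomial ℂ) • y
    = (LaurentPolynomial.T (p + q) : LaurentPolynomial ℂ) • y
  rw [← mul_smul, ← LaurentPolynomial.T_add]

theorem shift_zero (y : W) : shift 0 y = y := by
  change (LaurentPolynomial.T 0 : LaurentPolynomial ℂ) • y = y
  rw [LaurentPolynomial.T_zero, one_smul]

theorem shift_injective (q : ℤ) : Function.Injective (shift q : W → W) := fun y y' h => by
  have := congrArg (shift (-q)) h
  simpa [shift_shift, shift_zero] using this

theorem shift_mem_of_le {A : Submodule ℂ W} (hA : ∀ y ∈ A, shift 1 y ∈ A) {q : ℤ} (hq : 0 ≤ q)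
    {y : W} (hy : y ∈ A) : shift q y ∈ A := by
  lift q to ℕ using hq
  induction q with
  | zero => simpa [shift_zero] using hy
  | succ n ih =>
    have := hA _ ih
    rw [shift_shift] at this
    rwa [Nat.cast_succ, add_comm]

theorem shift_mem_of_nonpos {B : Submodule ℂ W} (hB : ∀ y ∈ B, shift (-1) y ∈ B) {q : ℤ}
    (hq : q ≤ 0) {y : W} (hy : y ∈ B) : shift q y ∈ B := by
  obtain ⟨n, rfl⟩ : ∃ n : ℕ, q = -n := ⟨q.natAbs, by omega⟩
  clear hq
  induction n with
  | zero => simpa [shift_zero] using hy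
  | succ n ih =>
    have := hB _ ih
    rw [shift_shift] at this
    convert this using 2
    push_cast; ring_nf

/-- The sections of the `(-j)`-th twist of the sheaf with sections `A` and `B` over the charts. -/
def twistSections (A B : Submodule ℂ W) (j : ℤ) : Submodule ℂ W := A ⊓ B.comap (shift j)

theorem mem_twistSections {A B : Submodule ℂ W} {j : ℤ} {y : W} :
    y ∈ twistSections A B j ↔ y ∈ A ∧ shift j y ∈ B := Iff.rfl

variable {A B : Submodule ℂ W} {D : Type*} [AddCommGroup D] [Module ℂ D] [FiniteDimensional ℂ D]

/-- Here `ev` plays the role of evaluation at `Z_0`. A section with `ev = 0` is divisible by `z`,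
and dividing by `z` embeds the kernel into the sections of the next twist; the image costs at most
`dim D`. -/
theorem finrank_twistSections_le_succ (ev : A →ₗ[ℂ] D)
    (hker : ∀ a : A, ev a = 0 → shift (-1) (a : W) ∈ A) (j : ℤ)
    (h : FiniteDimensional ℂ (twistSections A B (j + 1))) :
    FiniteDimensional ℂ (twistSections A B j) ∧
      Module.finrank ℂ (twistSections A B j) ≤
        Module.finrank ℂ (twistSections A B (j + 1)) + Module.finrank ℂ D := by
  set f : twistSections A B j →ₗ[ℂ] D :=
    ev ∘ₗ Submodule.inclusion (inf_le_left : twistSections A B j ≤ A) with hf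
  let g : LinearMap.ker f →ₗ[ℂ] twistSections A B (j + 1) :=
    LinearMap.codRestrict _
      (shift (-1) ∘ₗ (twistSections A B j).subtype ∘ₗ (LinearMap.ker f).subtype)
      fun x => by
        refine ⟨hker ⟨x.1.1, x.1.2.1⟩ x.2, ?_⟩
        have h1 : shift j (x.1 : W) ∈ B := x.1.2.2
        change shift (j + 1) (shift (-1) (x.1 : W)) ∈ B
        rw [shift_shift]
        simpa using h1
  have hg : Function.Injective g := fun x y h =>
    Subtype.ext (Subtype.ext (shift_injective (-1) (congrArg Subtype.val h)))
  have h1 : FiniteDimensional ℂ (LinearMap.ker f) := FiniteDimensional.of_injective g hg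
  have h2 : FiniteDimensional ℂ (twistSections A B j ⧸ LinearMap.ker f) :=
    FiniteDimensional.of_injective f.quotKerEquivRange.toLinearMap f.quotKerEquivRange.injective
  have h3 : FiniteDimensional ℂ (twistSections A B j) :=
    Module.Finite.of_submodule_quotient (LinearMap.ker f)
  refine ⟨h3, ?_⟩
  have h4 := LinearMap.finrank_range_add_finrank_ker f
  have h5 := LinearMap.finrank_le_finrank_of_injective hg
  have h6 := (LinearMap.range f).finrank_le
  omega

theorem finrank_twistSections_le_add (ev : A →ₗ[ℂ] D)
    (hker : ∀ a : A, ev a = 0 → shift (-1) (a : W) ∈ A) (i : ℕ) (j : ℤ)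
    (h : FiniteDimensional ℂ (twistSections A B (j + i))) :
    FiniteDimensional ℂ (twistSections A B j) ∧
      Module.finrank ℂ (twistSections A B j) ≤
        Module.finrank ℂ (twistSections A B (j + i)) + i * Module.finrank ℂ D := by
  induction i generalizing j with
  | zero =>
    rw [Nat.cast_zero, add_zero] at h ⊢
    exact ⟨h, by simp⟩
  | succ i ih =>
    have e : j + (i + 1 : ℕ) = j + 1 + i := by push_cast; ring
    rw [e] at h ⊢
    obtain ⟨h1, h2⟩ := ih (j + 1) h
    obtain ⟨h3, h4⟩ := finrank_twistSections_le_succ ev hker j h1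
    refine ⟨h3, ?_⟩
    rw [add_mul, one_mul]
    omega

/-- Multiplication by `z ^ n` places the sections of the `n`-th twist inside the sections of the
untwisted sheaf that are divisible by `z ^ n`. These form a decreasing chain in a finite-dimensional
space, and only `0` is infinitely divisible, so the twists eventually have no sections. -/
theorem exists_twistSections_ne_bot (hA : ∀ y ∈ A, shift 1 y ∈ A)
    (hsep : ∀ y ∈ A, (∀ n : ℕ, shift (-n) y ∈ A) → y = 0)
    (h0 : FiniteDimensional ℂ (twistSections A B 0)) (hne : twistSections A B 0 ≠ ⊥) :
    ∃ m : ℕ, twistSections A B m ≠ ⊥ ∧ twistSections A B (m + 1) = ⊥ := by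
  have key : ∃ m : ℕ, twistSections A B m = ⊥ := by
    by_contra! hcon
    let V := twistSections A B 0
    let f : ℕ →o (Submodule ℂ V)ᵒᵈ :=
      { toFun := fun n => OrderDual.toDual (Submodule.comap (shift (-n) ∘ₗ V.subtype) A)
        monotone' := fun n n' hn y hy => by
          change shift (-n) (y : W) ∈ A
          have hy : shift (-n') (y : W) ∈ A := hy
          have := shift_mem_of_le hA (q := n' - n) (by omega) hy
          rw [shift_shift] at this
          convert this using 2
          ring_nf }
    -- Where the chain is stationary, divisibility by `z ^ n` implies divisibility by every power of
    -- `z`.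
    obtain ⟨n, hn⟩ := IsArtinian.monotone_stabilizes f
    obtain ⟨y, hy, hy0⟩ := (Submodule.ne_bot_iff _).1 (hcon n)
    have hy' : shift n y ∈ V := ⟨shift_mem_of_le hA (by omega) hy.1, by
      change shift 0 (shift (n : ℤ) y) ∈ B
      rw [shift_zero]; exact hy.2⟩
    have h1 : ∀ i : ℕ, shift (-i) (shift n y) ∈ A := by
      have hfn : (⟨shift n y, hy'⟩ : V) ∈ OrderDual.ofDual (f n) := by
        change shift (-n) (shift n y) ∈ A
        rw [shift_shift]; simpa [shift_zero] using hy.1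
      intro i
      rcases le_total n i with hi | hi
      · rw [hn i hi] at hfn; exact hfn
      · have : (⟨shift n y, hy'⟩ : V) ∈ OrderDual.ofDual (f i) := f.monotone hi hfn
        exact this
    have := hsep _ hy'.1 h1
    rw [← map_zero (shift (n : ℤ) : W →ₗ[ℂ] W)] at this
    exact hy0 (shift_injective _ this)
  classical
  obtain ⟨m, hm⟩ : ∃ m, Nat.find key = m + 1 := by
    refine Nat.exists_eq_succ_of_ne_zero fun h => hne ?_
    have := Nat.find_spec key
    rwa [h] at this
  refine ⟨m, Nat.find_min key (by omega), ?_⟩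
  have := Nat.find_spec key
  rw [hm] at this
  exact_mod_cast this

variable {ι : Type*}

/-- The translates by powers of `z` of a family of sections. -/
def translates (h : ι → W) (x : ι × ℤ) : W := shift x.2 (h x.1)

/-- In a relation, let `v` be the coefficient of the lowest power of `z`. The remaining terms show
that `z⁻¹ v` lies in `A`, so `hsep` gives `v = 0`. The induction is on the number of powers of `z`
that occur. -/
theorem linearIndependent_translates (hA : ∀ y ∈ A, shift 1 y ∈ A) {h : ι → W}
    (hh : LinearIndependent ℂ h) (hmem : ∀ i, h i ∈ A)
    (hsep : ∀ v ∈ Submodule.span ℂ (Set.range h), shift (-1) v ∈ A → v = 0) :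
    LinearIndependent ℂ (translates h) := by
  classical
  rw [linearIndependent_iff']
  intro s
  induction hn : (s.image Prod.snd).card using Nat.strong_induction_on generalizing s with
  | _ n ih =>
  intro c hc
  rcases s.eq_empty_or_nonempty with rfl | hs
  · simp
  have hs' : (s.image Prod.snd).Nonempty := hs.image _
  set q := (s.image Prod.snd).min' hs' with hq
  set v : W := ∑ x ∈ s with x.2 = q, c x • h x.1 with hv
  have hsum : shift q v + ∑ x ∈ s with x.2 ≠ q, c x • translates h x = 0 := by
    rw [← hc, ← Finset.sum_filter_add_sum_filter_not s (fun x => x.2 = q), hv, map_sum]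
    refine congrArg₂ _ ?_ rfl
    refine Finset.sum_congr rfl fun x hx => ?_
    rw [map_smul, translates, (Finset.mem_filter.1 hx).2]
  have hv0 : v = 0 := by
    refine hsep v ?_ ?_
    · exact Submodule.sum_mem _ fun x _ => Submodule.smul_mem _ _ (Submodule.subset_span ⟨_, rfl⟩)
    · have h1 : shift (-1) v = -∑ x ∈ s with x.2 ≠ q, c x • shift (-1 - q) (translates h x) := by
        apply shift_injective (q + 1)
        rw [shift_shift, map_neg, map_sum (shift (q + 1)), eq_neg_iff_add_eq_zero, ← hsum]
        refine congrArg₂ _ ?_ ?_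
        · rw [show q + 1 + -1 = q by ring]
        · refine Finset.sum_congr rfl fun x _ => ?_
          rw [map_smul, shift_shift, show q + 1 + (-1 - q) = 0 by ring, shift_zero]
      rw [h1]
      refine A.neg_mem (A.sum_mem fun x hx => A.smul_mem _ ?_)
      rw [translates, shift_shift]
      refine shift_mem_of_le hA ?_ (hmem _)
      have hx' := Finset.mem_filter.1 hx
      have := Finset.min'_le _ _ (Finset.mem_image_of_mem Prod.snd hx'.1)
      have h2 := hx'.2
      rw [← hq] at this
      omega
  rw [hv0, map_zero, zero_add] at hsum
  have h2 := ih _ (by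
    rw [← hn]
    refine Finset.card_lt_card ⟨Finset.image_subset_image (Finset.filter_subset _ _), fun h3 => ?_⟩
    have := h3 (Finset.min'_mem _ hs')
    obtain ⟨x, hx, hx'⟩ := Finset.mem_image.1 this
    exact (Finset.mem_filter.1 hx).2 hx') (s.filter fun x => x.2 ≠ q) rfl c hsum
  intro x hx
  -- The terms in the lowest power add up to `v = 0`, so independence of `h` handles them; the
  -- induction handles the others.
  by_cases hxq : x.2 = q
  · have h3 := linearIndependent_iff'.1 hh (s.filter (fun x => x.2 = q) |>.image Prod.fst)
      (fun i => c (i, q)) (by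
        rw [Finset.sum_image, ← hv0, hv]
        · refine Finset.sum_congr rfl fun x hx => ?_
          rw [← (Finset.mem_filter.1 hx).2]
        · intro x hx y hy hxy
          exact Prod.ext hxy ((Finset.mem_filter.1 hx).2.trans (Finset.mem_filter.1 hy).2.symm))
      x.1 (Finset.mem_image_of_mem _ (Finset.mem_filter.2 ⟨hx, hxq⟩))
    rw [← h3, ← hxq]
  · exact h2 x (Finset.mem_filter.2 ⟨hx, hxq⟩)

theorem shift_mem_span_translates {h : ι → W} {S S' : Set ℤ} (p : ℤ) (hS : ∀ q ∈ S, p + q ∈ S')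
    {y : W} (hy : y ∈ Submodule.span ℂ (translates h '' {x | x.2 ∈ S})) :
    shift p y ∈ Submodule.span ℂ (translates h '' {x | x.2 ∈ S'}) := by
  induction hy using Submodule.span_induction with
  | mem y hy =>
    obtain ⟨x, hx, rfl⟩ := hy
    exact Submodule.subset_span
      ⟨(x.1, p + x.2), hS _ hx, by rw [translates, translates, shift_shift]⟩
  | zero => simp
  | add a b _ _ ha hb => rw [map_add]; exact Submodule.add_mem _ ha hb
  | smul c a _ ha => rw [map_smul]; exact Submodule.smul_mem _ _ ha

theorem shift_mem_span_translates_of_mem {h : ι → W} {S : Set ℤ} {q : ℤ} (hq : q ∈ S)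
    {v : W} (hv : v ∈ Submodule.span ℂ (Set.range h)) :
    shift q v ∈ Submodule.span ℂ (translates h '' {x | x.2 ∈ S}) := by
  refine shift_mem_span_translates (S := {0}) q (by simpa using hq) ?_
  refine Submodule.span_mono ?_ hv
  rintro _ ⟨i, rfl⟩
  exact ⟨(i, 0), rfl, shift_zero _⟩

variable {k : ℤ} {h : ι → W}

/-- Induction on `n`, which measures how far `z ^ (-k) y` is from `A`. For `n = 0` it is a section
of the `k`-th twist. Otherwise subtract from `z ^ (n + 1 - k) y` a section `v` of that twist so that
the difference is divisible by `z`, which lowers `n`. The correction `z ^ (k - n - 1) v` stays in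
`B` because its exponent is at most `k`. -/
theorem mem_span_translates_of_mem_right (hB : ∀ y ∈ B, shift (-1) y ∈ B)
    (hV : twistSections A B k ≤ Submodule.span ℂ (Set.range h))
    (hsurj : ∀ a ∈ A, ∃ v ∈ twistSections A B k, shift (-1) (a - v) ∈ A) (n : ℕ) {y : W}
    (hyB : y ∈ B) (hyA : shift (n - k) y ∈ A) :
    y ∈ Submodule.span ℂ (translates h '' {x | x.2 ∈ Set.Iic k}) := by
  induction n generalizing y with
  | zero =>
    have h1 : shift (-k) y ∈ twistSections A B k := by
      refine ⟨by simpa using hyA, ?_⟩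
      change shift k (shift (-k) y) ∈ B
      rw [shift_shift]
      simpa [shift_zero] using hyB
    have h2 := shift_mem_span_translates_of_mem (S := Set.Iic k) (q := k) (by simp) (hV h1)
    rw [shift_shift] at h2
    simpa [shift_zero] using h2
  | succ n ih =>
    obtain ⟨v, hv, hva⟩ := hsurj _ hyA
    have h1 : shift (k - n - 1) v ∈ B := by
      have := shift_mem_of_nonpos hB (q := -n - 1) (by omega) hv.2
      rw [shift_shift] at this
      convert this using 2; ring_nf
    have h2 : y - shift (k - n - 1) v ∈
        Submodule.span ℂ (translates h '' {x | x.2 ∈ Set.Iic k}) := by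
      refine ih (B.sub_mem hyB h1) ?_
      convert hva using 1
      rw [map_sub, map_sub, shift_shift, shift_shift]
      congr 3 <;> push_cast <;> ring_nf
    have h3 := shift_mem_span_translates_of_mem (S := Set.Iic k) (q := k - n - 1)
      (by simp; omega) (hV hv)
    simpa using Submodule.add_mem _ h2 h3

/-- The same induction from the other chart: write `y = v + z y'` with `v` a section of the `k`-th
twist, and continue with `y'`, which needs one power of `z⁻¹` fewer to reach `B`. -/
theorem mem_span_translates_of_mem_left (hB : ∀ y ∈ B, shift (-1) y ∈ B)
    (hV : twistSections A B k ≤ Submodule.span ℂ (Set.range h))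
    (hsurj : ∀ a ∈ A, ∃ v ∈ twistSections A B k, shift (-1) (a - v) ∈ A) (n : ℕ) {y : W}
    (hyA : y ∈ A) (hyB : shift (k - n) y ∈ B) :
    y ∈ Submodule.span ℂ (translates h '' {x | x.2 ∈ Set.Ici 0}) := by
  induction n generalizing y with
  | zero =>
    have h1 : y ∈ twistSections A B k := ⟨hyA, by simpa using hyB⟩
    have h2 := shift_mem_span_translates_of_mem (S := Set.Ici 0) (q := 0) (by simp) (hV h1)
    rwa [shift_zero] at h2
  | succ n ih =>
    obtain ⟨v, hv, hva⟩ := hsurj _ hyA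
    have h1 : shift (k - n) (shift (-1) (y - v)) ∈ B := by
      have h3 := shift_mem_of_nonpos hB (q := -n - 1) (by omega) hv.2
      rw [shift_shift] at h3
      rw [shift_shift, map_sub]
      refine B.sub_mem ?_ ?_
      · convert hyB using 2; push_cast; ring_nf
      · convert h3 using 2; ring_nf
    have h2 := shift_mem_span_translates (S' := Set.Ici 0) 1 (by simp; omega) (ih hva h1)
    rw [shift_shift] at h2
    have h4 := shift_mem_span_translates_of_mem (S := Set.Ici 0) (q := 0) (by simp) (hV hv)
    rw [shift_zero] at h4
    have h5 := Submodule.add_mem _ h2 h4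
    simpa [shift_zero] using h5

/-- `ev` is injective on the sections of the `k`-th twist, since a section in its kernel divided by
`z` would be a section of the next twist. The dimension bound makes it bijective, so every value of
`ev` is attained by such a section. -/
theorem exists_sub_mem_of_finrank_le (ev : A →ₗ[ℂ] D)
    (hker : ∀ a : A, ev a = 0 → shift (-1) (a : W) ∈ A)
    (hbot : twistSections A B (k + 1) = ⊥)
    (hdim : Module.finrank ℂ D ≤ Module.finrank ℂ (twistSections A B k)) :
    ∀ a ∈ A, ∃ v ∈ twistSections A B k, shift (-1) (a - v) ∈ A := by
  intro a ha
  have hfin : FiniteDimensional ℂ (twistSections A B k) :=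
    (finrank_twistSections_le_succ ev hker k (by rw [hbot]; infer_instance)).1
  set f : twistSections A B k →ₗ[ℂ] D :=
    ev ∘ₗ Submodule.inclusion (inf_le_left : twistSections A B k ≤ A) with hf
  have hinj : Function.Injective f := by
    rw [injective_iff_map_eq_zero]
    intro x hx
    have h1 : shift (-1) (x : W) ∈ twistSections A B (k + 1) := by
      refine ⟨hker ⟨x, x.2.1⟩ hx, ?_⟩
      have h2 : shift k (x : W) ∈ B := x.2.2
      change shift (k + 1) (shift (-1) (x : W)) ∈ B
      rw [shift_shift]
      simpa using h2
    rw [hbot, Submodule.mem_bot, ← map_zero (shift (-1) : W →ₗ[ℂ] W)] at h1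
    exact Subtype.ext (shift_injective _ h1)
  have hsurj : Function.Surjective f := by
    rw [← LinearMap.range_eq_top]
    apply Submodule.eq_top_of_finrank_eq
    have := LinearMap.finrank_range_of_inj hinj
    have := (LinearMap.range f).finrank_le
    omega
  obtain ⟨v, hv⟩ := hsurj (ev ⟨a, ha⟩)
  refine ⟨v, v.2, hker (⟨a, ha⟩ - ⟨v, v.2.1⟩) ?_⟩
  rw [map_sub, sub_eq_zero]
  exact hv.symm

end Lattice

/-! ### Submodules over the coordinate rings -/

section Closure

variable {M : Type*} [AddCommGroup M] [Module ℂ M]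

theorem chart_smul_mem [Module ChartRing M] [IsScalarTower ℂ ChartRing M] {S : Submodule ℂ M}
    (hb : ∀ a ∈ S, base • a ∈ S) (hf : ∀ i, ∀ a ∈ S, fib i • a ∈ S) (c : ChartRing) {a : M}
    (ha : a ∈ S) : c • a ∈ S := by
  induction c using MvPolynomial.induction_on generalizing a with
  | C p =>
    induction p using Polynomial.induction_on generalizing a with
    | C r =>
      have : (MvPolynomial.C (Polynomial.C r) : ChartRing) = algebraMap ℂ ChartRing r := rfl
      rw [this, algebraMap_smul]
      exact S.smul_mem r ha
    | add p q hp hq => rw [map_add, add_smul]; exact S.add_mem (hp ha) (hq ha)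
    | monomial n r ih =>
      rw [pow_succ, ← mul_assoc, map_mul, mul_smul]
      exact ih (hb a ha)
  | add p q hp hq => rw [add_smul]; exact S.add_mem (hp ha) (hq ha)
  | mul_X p i hp => rw [mul_smul]; exact hp (hf i a ha)

theorem overlap_smul_mem [Module OverlapRing M] [IsScalarTower ℂ OverlapRing M]
    {S : Submodule ℂ M} (hz : ∀ q : ℤ, ∀ a ∈ S, zpw q • a ∈ S)
    (hf : ∀ i, ∀ a ∈ S, fib01 i • a ∈ S) (c : OverlapRing) {a : M} (ha : a ∈ S) : c • a ∈ S := by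
  induction c using MvPolynomial.induction_on generalizing a with
  | C p =>
    induction p using LaurentPolynomial.induction_on' generalizing a with
    | add p q hp hq => rw [map_add, add_smul]; exact S.add_mem (hp ha) (hq ha)
    | C_mul_T n r =>
      rw [map_mul, mul_smul]
      have : (MvPolynomial.C (LaurentPolynomial.C r) : OverlapRing) = algebraMap ℂ OverlapRing r :=
        rfl
      rw [this, algebraMap_smul]
      exact S.smul_mem r (hz n a ha)
  | add p q hp hq => rw [add_smul]; exact S.add_mem (hp ha) (hq ha)
  | mul_X p i hp => rw [mul_smul]; exact hp (hf i a ha)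

/-- A subspace that is closed under the coordinate functions of a chart, as a submodule. -/
def chartSubmodule [Module ChartRing M] [IsScalarTower ℂ ChartRing M] (S : Submodule ℂ M)
    (hb : ∀ a ∈ S, base • a ∈ S) (hf : ∀ i, ∀ a ∈ S, fib i • a ∈ S) : Submodule ChartRing M where
  __ := S.toAddSubmonoid
  smul_mem' c _ ha := chart_smul_mem hb hf c ha

/-- A subspace that is closed under the coordinate functions of the overlap, as a submodule. -/
def overlapSubmodule [Module OverlapRing M] [IsScalarTower ℂ OverlapRing M] (S : Submodule ℂ M)
    (hz : ∀ q : ℤ, ∀ a ∈ S, zpw q • a ∈ S) (hf : ∀ i, ∀ a ∈ S, fib01 i • a ∈ S) :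
    Submodule OverlapRing M where
  __ := S.toAddSubmonoid
  smul_mem' c _ ha := overlap_smul_mem hz hf c ha

end Closure

/-! ### Restriction to the overlap -/

theorem rho0_base : rho0 base = zpw 1 := by
  simp [rho0, base, zpw, Polynomial.toLaurent_X]

theorem rho0_fib (i : Fin 3) : rho0 (fib i) = fib01 i := by simp [rho0, fib, fib01]

theorem rho1_base : rho1 base = zpw (-1) := by
  simp [rho1, base, zpw, Polynomial.toLaurent_X]

theorem rho1_fib (i : Fin 3) :
    rho1 (fib i) = (![zpw 1 * fib01 0, zpw 1 * fib01 1, fib01 2] : Fin 3 → OverlapRing) i := by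
  simp [rho1, fib]

namespace XSheaf

variable (F : XSheaf)

theorem zpw_smul (q : ℤ) (y : F.M01) : zpw q • y = shift q y := rfl

/-- Multiplication by a fibre coordinate on the overlap. -/
def fibMap (i : Fin 3) : F.M01 →ₗ[ℂ] F.M01 where
  toFun y := fib01 i • y
  map_add' := smul_add _
  map_smul' c y := smul_comm (fib01 i) (algebraMap ℂ OverlapRing c) y

theorem fibMap_apply (i : Fin 3) (y : F.M01) : F.fibMap i y = fib01 i • y := rfl

theorem fibMap_shift (i : Fin 3) (q : ℤ) (y : F.M01) :
    F.fibMap i (shift q y) = shift q (F.fibMap i y) := by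
  rw [fibMap_apply, fibMap_apply, ← zpw_smul, ← zpw_smul, smul_comm]

theorem res0C_apply (a : F.M0) : F.res0C a = F.res0 a := rfl

theorem res1C_apply (b : F.M1) : F.res1C b = F.res1 b := rfl

theorem res0C_base (a : F.M0) : F.res0C (base • a) = shift 1 (F.res0C a) := by
  rw [res0C_apply, F.res0.map_smulₛₗ, rho0_base]; rfl

theorem res0C_fib (i : Fin 3) (a : F.M0) : F.res0C (fib i • a) = F.fibMap i (F.res0C a) := by
  rw [res0C_apply, F.res0.map_smulₛₗ, rho0_fib]; rfl

theorem res1C_base (b : F.M1) : F.res1C (base • b) = shift (-1) (F.res1C b) := by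
  rw [res1C_apply, F.res1.map_smulₛₗ, rho1_base]; rfl

/-- The exponents `1, 1, 0` come from `y₁ = z x₁`, `y₂ = z x₂`, `y₃ = x₃`. Because of them `x₁` and
`x₂` move a section of one twist to the next, whereas `x₃` preserves the twist. -/
theorem res1C_fib (i : Fin 3) (b : F.M1) :
    F.res1C (fib i • b) = shift ((![1, 1, 0] : Fin 3 → ℤ) i) (F.fibMap i (F.res1C b)) := by
  rw [res1C_apply, F.res1.map_smulₛₗ, rho1_fib]
  fin_cases i
  · exact mul_smul _ _ _
  · exact mul_smul _ _ _
  · exact (shift_zero _).symm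

theorem cech_apply (a : F.M0) (b : F.M1) : F.cech (a, b) = F.res0C a - F.res1C b := rfl

theorem exists_shift_mem_range0 (y : F.M01) :
    ∃ n : ℕ, shift n y ∈ LinearMap.range F.res0C := by
  obtain ⟨n, a, h⟩ := F.res0_surj y
  exact ⟨n, a, h.symm⟩

theorem exists_shift_mem_range1 (y : F.M01) :
    ∃ n : ℕ, shift (-n) y ∈ LinearMap.range F.res1C := by
  obtain ⟨n, a, h⟩ := F.res1_surj y
  exact ⟨n, a, h.symm⟩

end XSheaf

/-! ### Subsheaves as lattices over the overlap -/

namespace Subsheaf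

variable {F : XSheaf}

/-- The image over the overlap of the sections over `U₀`. -/
def image0 (N : Subsheaf F) : Submodule ℂ F.M01 := (N.N0.restrictScalars ℂ).map F.res0C

/-- The image over the overlap of the sections over `U_∞`. -/
def image1 (N : Subsheaf F) : Submodule ℂ F.M01 := (N.N1.restrictScalars ℂ).map F.res1C

variable (N : Subsheaf F)

theorem shift_mem_image0 {y : F.M01} (hy : y ∈ N.image0) : shift 1 y ∈ N.image0 := by
  obtain ⟨a, ha, rfl⟩ := hy
  exact ⟨base • a, N.N0.smul_mem _ ha, F.res0C_base a⟩

theorem fib_mem_image0 (i : Fin 3) {y : F.M01} (hy : y ∈ N.image0) : F.fibMap i y ∈ N.image0 := by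
  obtain ⟨a, ha, rfl⟩ := hy
  exact ⟨fib i • a, N.N0.smul_mem _ ha, F.res0C_fib i a⟩

theorem shift_mem_image1 {y : F.M01} (hy : y ∈ N.image1) : shift (-1) y ∈ N.image1 := by
  obtain ⟨a, ha, rfl⟩ := hy
  exact ⟨base • a, N.N1.smul_mem _ ha, F.res1C_base a⟩

theorem fib_mem_image1 (i : Fin 3) {y : F.M01} (hy : y ∈ N.image1) :
    shift ((![1, 1, 0] : Fin 3 → ℤ) i) (F.fibMap i y) ∈ N.image1 := by
  obtain ⟨a, ha, rfl⟩ := hy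
  exact ⟨fib i • a, N.N1.smul_mem _ ha, F.res1C_fib i a⟩

theorem image1_le_N01 : N.image1 ≤ N.N01.restrictScalars ℂ := by
  rintro _ ⟨a, ha, rfl⟩
  rw [N01, N.glue]
  exact Submodule.subset_span ⟨a, ha, rfl⟩

theorem chi_le (h0 : Function.Injective F.res0C) (h1 : Function.Injective F.res1C) :
    N.chi ≤ Module.finrank ℂ (twistSections N.image0 N.image1 0) := by
  have := twoTermEuler_prod_le (A₀ := N.N0.restrictScalars ℂ) (A₁ := N.N1.restrictScalars ℂ)
    F.cech_apply (fun _ _ h => h0 (h.trans (map_zero _).symm))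
    (fun _ _ h => h1 (h.trans (map_zero _).symm)) (N.N01.restrictScalars ℂ)
  have e : twistSections N.image0 N.image1 0 = N.image0 ⊓ N.image1 := by
    ext y; rw [mem_twistSections, shift_zero]; rfl
  rw [e]
  exact this

theorem chi_eq (h0 : Function.Injective F.res0C) (h1 : Function.Injective F.res1C)
    (h : N.N01.restrictScalars ℂ ≤ N.image0 ⊔ N.image1) :
    N.chi = Module.finrank ℂ (N.image0 ⊓ N.image1 : Submodule ℂ F.M01) :=
  twoTermEuler_prod_eq (A₀ := N.N0.restrictScalars ℂ) (A₁ := N.N1.restrictScalars ℂ)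
    F.cech_apply (fun _ _ h => h0 (h.trans (map_zero _).symm))
    (fun _ _ h => h1 (h.trans (map_zero _).symm)) h

/-- The fibre at `Z_0`: the module over `U₀` is free over the principal ideal domain `ℂ[z]`, and
`ev` takes constant terms of the coordinates in a basis, so its kernel is `z` times the module. -/
theorem exists_evaluation (hfin : Module.Finite (Polynomial ℂ) F.M0)
    (htf : Module.IsTorsionFree (Polynomial ℂ) F.M0) (h0 : Function.Injective F.res0C) :
    ∃ ev : N.image0 →ₗ[ℂ] (Fin N.deg → ℂ), Function.Surjective ev ∧
      ∀ a : N.image0, ev a = 0 ↔ shift (-1) (a : F.M01) ∈ N.image0 := by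
  have hfinN : Module.Finite (Polynomial ℂ) N.N0 :=
    inferInstanceAs (Module.Finite (Polynomial ℂ) (N.N0.restrictScalars (Polynomial ℂ)))
  have htfN : Module.IsTorsionFree (Polynomial ℂ) N.N0 :=
    inferInstanceAs (Module.IsTorsionFree (Polynomial ℂ) (N.N0.restrictScalars (Polynomial ℂ)))
  have hfree : Module.Free (Polynomial ℂ) N.N0 :=
    inferInstanceAs (Module.Free (Polynomial ℂ) (N.N0.restrictScalars (Polynomial ℂ)))
  let β : Module.Basis (Fin N.deg) (Polynomial ℂ) N.N0 := Module.finBasis (Polynomial ℂ) N.N0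
  let ev0 : N.N0.restrictScalars ℂ →ₗ[ℂ] (Fin N.deg → ℂ) :=
    { toFun := fun a i => (β.repr a i).coeff 0
      map_add' := fun a b => funext fun i =>
        (congrArg (fun p => Polynomial.coeff p 0) (DFunLike.congr_fun
          (β.repr.map_add (show N.N0 from a) (show N.N0 from b)) i)).trans
            (Polynomial.coeff_add _ _ _)
      map_smul' := fun c a => funext fun i =>
        (congrArg (fun p => Polynomial.coeff p 0) (DFunLike.congr_fun
          (β.repr.map_smul (Polynomial.C c) (show N.N0 from a)) i)).trans
            (Polynomial.coeff_C_mul _) }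
  have hsurj0 : Function.Surjective ev0 := by
    intro c
    refine ⟨∑ i, (Polynomial.C (c i)) • β i, ?_⟩
    funext i
    change (β.repr (∑ i, (Polynomial.C (c i)) • β i) i).coeff 0 = c i
    rw [β.repr_sum_self]
    simp
  have hker0 : ∀ a, ev0 a = 0 ↔ ∃ a' : N.N0, (a : N.N0) = (Polynomial.X : Polynomial ℂ) • a' := by
    intro a
    constructor
    · intro h
      have h' : ∀ i, ∃ p : Polynomial ℂ, β.repr a i = Polynomial.X * p := fun i =>
        Polynomial.X_dvd_iff.2 (congrFun h i)
      choose p hp using h'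
      refine ⟨∑ i, p i • β i, ?_⟩
      rw [Finset.smul_sum]
      refine (β.sum_repr a).symm.trans (Finset.sum_congr rfl fun i _ => ?_)
      rw [hp, mul_smul]
    · rintro ⟨a', h⟩
      funext i
      change (β.repr a i).coeff 0 = 0
      rw [h, map_smul]
      simp
  let eqv : N.N0.restrictScalars ℂ ≃ₗ[ℂ] N.image0 := Submodule.equivMapOfInjective F.res0C h0 _
  have heqv : ∀ a, (eqv a : F.M01) = F.res0C a := fun a => rfl
  refine ⟨ev0 ∘ₗ eqv.symm.toLinearMap, hsurj0.comp eqv.symm.surjective, fun y => ?_⟩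
  obtain ⟨a, rfl⟩ := eqv.surjective y
  rw [LinearMap.comp_apply, LinearEquiv.coe_coe, eqv.symm_apply_apply, hker0, heqv]
  constructor
  · rintro ⟨a', h⟩
    refine ⟨a', a'.2, ?_⟩
    have h1 : (a : F.M0) = base • (a' : F.M0) := congrArg Subtype.val h
    rw [h1, F.res0C_base, shift_shift, neg_add_cancel, shift_zero]
  · rintro ⟨a', ha', h⟩
    refine ⟨⟨a', ha'⟩, Subtype.ext (h0 ?_)⟩
    change F.res0C a = F.res0C (base • a')
    rw [F.res0C_base, h, shift_shift, add_neg_cancel, shift_zero]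

/-- The subsheaf with given sections `A`, `B` and `U` over the two charts and over the overlap. -/
def ofLattice (A B U : Submodule ℂ F.M01)
    (hA : ∀ y ∈ A, shift 1 y ∈ A) (hAf : ∀ i, ∀ y ∈ A, F.fibMap i y ∈ A)
    (hB : ∀ y ∈ B, shift (-1) y ∈ B)
    (hBf : ∀ i, ∀ y ∈ B, shift ((![1, 1, 0] : Fin 3 → ℤ) i) (F.fibMap i y) ∈ B)
    (hU : ∀ q, ∀ y ∈ U, shift q y ∈ U) (hUf : ∀ i, ∀ y ∈ U, F.fibMap i y ∈ U)
    (hAr : A ≤ LinearMap.range F.res0C) (hBr : B ≤ LinearMap.range F.res1C)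
    (hAU : A ≤ U) (hBU : B ≤ U)
    (hUA : ∀ y ∈ U, ∃ n : ℕ, shift n y ∈ A) (hUB : ∀ y ∈ U, ∃ n : ℕ, shift (-n) y ∈ B) :
    Subsheaf F where
  N0 := chartSubmodule (A.comap F.res0C)
    (fun a ha => by
      rw [Submodule.mem_comap, F.res0C_base]; exact hA _ ha)
    (fun i a ha => by
      rw [Submodule.mem_comap, F.res0C_fib]; exact hAf i _ ha)
  N1 := chartSubmodule (B.comap F.res1C)
    (fun a ha => by
      rw [Submodule.mem_comap, F.res1C_base]; exact hB _ ha)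
    (fun i a ha => by
      rw [Submodule.mem_comap, F.res1C_fib]; exact hBf i _ ha)
  glue := by
    have h0 : Submodule.span OverlapRing (F.res0 '' {a | F.res0C a ∈ A})
        = overlapSubmodule U hU hUf := by
      refine le_antisymm (Submodule.span_le.2 ?_) fun y hy => ?_
      · rintro _ ⟨a, ha, rfl⟩
        exact hAU ha
      · obtain ⟨n, hn⟩ := hUA y hy
        obtain ⟨a, ha⟩ := hAr hn
        have : y = zpw (-n) • F.res0 a := by
          rw [← XSheaf.res0C_apply, ha, XSheaf.zpw_smul, shift_shift, neg_add_cancel, shift_zero]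
        rw [this]
        exact Submodule.smul_mem _ _ (Submodule.subset_span
          ⟨a, by rw [Set.mem_ofPred_eq, ha]; exact hn, rfl⟩)
    have h1 : Submodule.span OverlapRing (F.res1 '' {a | F.res1C a ∈ B})
        = overlapSubmodule U hU hUf := by
      refine le_antisymm (Submodule.span_le.2 ?_) fun y hy => ?_
      · rintro _ ⟨a, ha, rfl⟩
        exact hBU ha
      · obtain ⟨n, hn⟩ := hUB y hy
        obtain ⟨a, ha⟩ := hBr hn
        have : y = zpw n • F.res1 a := by
          rw [← XSheaf.res1C_apply, ha, XSheaf.zpw_smul, shift_shift, add_neg_cancel, shift_zero]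
        rw [this]
        exact Submodule.smul_mem _ _ (Submodule.subset_span
          ⟨a, by rw [Set.mem_ofPred_eq, ha]; exact hn, rfl⟩)
    exact h0.trans h1.symm

end Subsheaf

namespace Subsheaf

variable {F : XSheaf}

section ofLattice

variable {A B U : Submodule ℂ F.M01}
    {hA : ∀ y ∈ A, shift 1 y ∈ A} {hAf : ∀ i, ∀ y ∈ A, F.fibMap i y ∈ A}
    {hB : ∀ y ∈ B, shift (-1) y ∈ B}
    {hBf : ∀ i, ∀ y ∈ B, shift ((![1, 1, 0] : Fin 3 → ℤ) i) (F.fibMap i y) ∈ B}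
    {hU : ∀ q, ∀ y ∈ U, shift q y ∈ U} {hUf : ∀ i, ∀ y ∈ U, F.fibMap i y ∈ U}
    {hAr : A ≤ LinearMap.range F.res0C} {hBr : B ≤ LinearMap.range F.res1C}
    {hAU : A ≤ U} {hBU : B ≤ U}
    {hUA : ∀ y ∈ U, ∃ n : ℕ, shift n y ∈ A} {hUB : ∀ y ∈ U, ∃ n : ℕ, shift (-n) y ∈ B}

theorem image0_ofLattice :
    (ofLattice A B U hA hAf hB hBf hU hUf hAr hBr hAU hBU hUA hUB).image0 = A := by
  refine le_antisymm ?_ fun y hy => ?_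
  · rintro _ ⟨a, ha, rfl⟩
    exact ha
  · obtain ⟨a, rfl⟩ := hAr hy
    exact ⟨a, hy, rfl⟩

theorem image1_ofLattice :
    (ofLattice A B U hA hAf hB hBf hU hUf hAr hBr hAU hBU hUA hUB).image1 = B := by
  refine le_antisymm ?_ fun y hy => ?_
  · rintro _ ⟨a, ha, rfl⟩
    exact ha
  · obtain ⟨a, rfl⟩ := hBr hy
    exact ⟨a, hy, rfl⟩

theorem N01_ofLattice_le :
    (ofLattice A B U hA hAf hB hBf hU hUf hAr hBr hAU hBU hUA hUB).N01.restrictScalars ℂ ≤ U := by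
  have : (ofLattice A B U hA hAf hB hBf hU hUf hAr hBr hAU hBU hUA hUB).N01 ≤
      overlapSubmodule U hU hUf := by
    refine Submodule.span_le.2 ?_
    rintro _ ⟨a, ha, rfl⟩
    exact hAU ha
  exact this

end ofLattice

theorem image0_whole (F : XSheaf) : (whole F).image0 = LinearMap.range F.res0C := by
  rw [LinearMap.range_eq_map]; rfl

theorem image1_whole (F : XSheaf) : (whole F).image1 = LinearMap.range F.res1C := by
  rw [LinearMap.range_eq_map]; rfl

end Subsheaf

/-! ### Torsion and purity -/

namespace XSheaf

variable (F : XSheaf)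

/-- Scalar multiplication on the overlap by Laurent polynomials. -/
theorem laurent_smul (p : LaurentPolynomial ℂ) (y : F.M01) :
    p • y = (MvPolynomial.C p : OverlapRing) • y := rfl

theorem res0C_smul (p : Polynomial ℂ) (a : F.M0) :
    F.res0C (p • a) = Polynomial.toLaurent p • F.res0C a := by
  change F.res0 ((MvPolynomial.C p : ChartRing) • a) = _
  have : rho0 (MvPolynomial.C p) = MvPolynomial.C (Polynomial.toLaurent p) :=
    MvPolynomial.map_C _ _
  rw [F.res0.map_smulₛₗ, this]; rfl

/-- The torsion sections over the overlap. -/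
def torsion01 : Submodule ℂ F.M01 where
  carrier := {y | ∃ p : LaurentPolynomial ℂ, p ≠ 0 ∧ p • y = 0}
  zero_mem' := ⟨1, one_ne_zero, smul_zero _⟩
  add_mem' := by
    rintro x y ⟨p, hp, hx⟩ ⟨q, hq, hy⟩
    refine ⟨p * q, mul_ne_zero hp hq, ?_⟩
    rw [smul_add, mul_smul, mul_smul, hy, smul_zero, add_zero, smul_comm, hx, smul_zero]
  smul_mem' := by
    rintro c x ⟨p, hp, hx⟩
    exact ⟨p, hp, by rw [smul_comm, hx, smul_zero]⟩

theorem overlap_smul_mem_torsion01 (c : OverlapRing) {y : F.M01} (hy : y ∈ F.torsion01) :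
    c • y ∈ F.torsion01 := by
  obtain ⟨p, hp, h⟩ := hy
  refine ⟨p, hp, ?_⟩
  rw [laurent_smul] at h ⊢
  rw [smul_comm, h, smul_zero]

/-- The torsion subsheaf. -/
def torsionSubsheaf : Subsheaf F :=
  Subsheaf.ofLattice (F.torsion01 ⊓ LinearMap.range F.res0C) (F.torsion01 ⊓ LinearMap.range F.res1C)
    F.torsion01
    (fun y hy => by
      refine ⟨F.overlap_smul_mem_torsion01 (zpw 1) hy.1, ?_⟩
      obtain ⟨a, ha⟩ := hy.2
      exact ⟨base • a, by rw [res0C_base, ha]⟩)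
    (fun i y hy => by
      refine ⟨F.overlap_smul_mem_torsion01 (fib01 i) hy.1, ?_⟩
      obtain ⟨a, ha⟩ := hy.2
      exact ⟨fib i • a, by rw [res0C_fib, ha]⟩)
    (fun y hy => by
      refine ⟨F.overlap_smul_mem_torsion01 (zpw (-1)) hy.1, ?_⟩
      obtain ⟨a, ha⟩ := hy.2
      exact ⟨base • a, by rw [res1C_base, ha]⟩)
    (fun i y hy => by
      refine ⟨F.overlap_smul_mem_torsion01 (zpw _)
        (F.overlap_smul_mem_torsion01 (fib01 i) hy.1), ?_⟩
      obtain ⟨a, ha⟩ := hy.2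
      exact ⟨fib i • a, by rw [res1C_fib, ha]⟩)
    (fun q y hy => F.overlap_smul_mem_torsion01 (zpw q) hy)
    (fun i y hy => F.overlap_smul_mem_torsion01 (fib01 i) hy)
    inf_le_right inf_le_right inf_le_left inf_le_left
    (fun y hy => by
      obtain ⟨n, hn⟩ := F.exists_shift_mem_range0 y
      exact ⟨n, F.overlap_smul_mem_torsion01 (zpw n) hy, hn⟩)
    (fun y hy => by
      obtain ⟨n, hn⟩ := F.exists_shift_mem_range1 y
      exact ⟨n, F.overlap_smul_mem_torsion01 (zpw (-n)) hy, hn⟩)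

theorem mem_torsionSubsheaf0 (a : F.M0) :
    a ∈ F.torsionSubsheaf.N0 ↔ F.res0C a ∈ F.torsion01 :=
  ⟨fun h => h.1, fun h => ⟨h, a, rfl⟩⟩

theorem mem_torsionSubsheaf1 (b : F.M1) :
    b ∈ F.torsionSubsheaf.N1 ↔ F.res1C b ∈ F.torsion01 :=
  ⟨fun h => h.1, fun h => ⟨h, b, rfl⟩⟩

theorem exists_smul_eq_zero_of_mem_torsionSubsheaf {a : F.M0} (ha : a ∈ F.torsionSubsheaf.N0) :
    ∃ p : Polynomial ℂ, p ≠ 0 ∧ p • a = 0 := by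
  obtain ⟨p, hp, h⟩ := (F.mem_torsionSubsheaf0 a).1 ha
  -- A power of `z` turns the annihilating Laurent polynomial into a polynomial; a further power is
  -- needed because `res0` is only injective up to `z`-torsion.
  obtain ⟨n, p', hp'⟩ := LaurentPolynomial.exists_T_pow p
  have h1 : F.res0C (p' • a) = 0 := by
    rw [res0C_smul, hp', mul_comm, mul_smul, h, smul_zero]
  obtain ⟨m, hm⟩ := F.res0_ker _ h1
  have hp'0 : p' ≠ 0 := by
    rintro rfl
    rw [map_zero, eq_comm] at hp'
    exact hp ((mul_eq_zero.1 hp').resolve_right (LaurentPolynomial.isUnit_T n).ne_zero)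
  refine ⟨Polynomial.X ^ m * p', mul_ne_zero (pow_ne_zero _ Polynomial.X_ne_zero) hp'0, ?_⟩
  rw [mul_smul]
  have : (base ^ m : ChartRing) = MvPolynomial.C (Polynomial.X ^ m) := by rw [base, map_pow]
  rw [this] at hm
  exact hm

theorem deg_torsionSubsheaf (hfin : Module.Finite (Polynomial ℂ) F.M0) :
    F.torsionSubsheaf.deg = 0 := by
  have hfinN : Module.Finite (Polynomial ℂ) F.torsionSubsheaf.N0 :=
    inferInstanceAs (Module.Finite (Polynomial ℂ)
      (F.torsionSubsheaf.N0.restrictScalars (Polynomial ℂ)))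
  refine (Module.finrank_eq_zero_iff_isTorsion (R := Polynomial ℂ)
    (M := F.torsionSubsheaf.N0)).2 ?_
  rintro ⟨a, ha⟩
  obtain ⟨p, hp, h⟩ := F.exists_smul_eq_zero_of_mem_torsionSubsheaf ha
  exact ⟨⟨p, mem_nonZeroDivisors_of_ne_zero hp⟩, Subtype.ext h⟩

/-- A sheaf without torsion: both restrictions to the overlap are injective. -/
structure IsPure : Prop where
  torsionFree : Module.IsTorsionFree (Polynomial ℂ) F.M0
  injective0 : Function.Injective F.res0C
  injective1 : Function.Injective F.res1C

variable {F}

theorem isPure_of_torsionSubsheaf (h0 : F.torsionSubsheaf.N0 = ⊥) (h1 : F.torsionSubsheaf.N1 = ⊥) :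
    F.IsPure where
  torsionFree := by
    rw [Module.isTorsionFree_iff_smul_eq_zero]
    intro p a h
    by_contra! hcon
    have : a ∈ F.torsionSubsheaf.N0 := by
      rw [mem_torsionSubsheaf0]
      refine ⟨Polynomial.toLaurent p, Polynomial.toLaurent_ne_zero.2 hcon.1, ?_⟩
      rw [← res0C_smul, h, map_zero]
    rw [h0] at this
    exact hcon.2 this
  injective0 := by
    rw [injective_iff_map_eq_zero]
    intro a ha
    have : a ∈ F.torsionSubsheaf.N0 := by
      rw [mem_torsionSubsheaf0, ha]; exact Submodule.zero_mem _
    rwa [h0] at this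
  injective1 := by
    rw [injective_iff_map_eq_zero]
    intro a ha
    have : a ∈ F.torsionSubsheaf.N1 := by
      rw [mem_torsionSubsheaf1, ha]; exact Submodule.zero_mem _
    rwa [h1] at this

end XSheaf

/-- The torsion subsheaf has rank `0`, hence slope `∞`. If it were non-zero it would contradict
semistability, the slope of `F` being finite. -/
theorem SheafPair.IsJSStable.isPure {P : SheafPair} (hP : P.IsJSStable) : P.F.IsPure := by
  have h : ¬ (P.F.torsionSubsheaf.N0 ≠ ⊥ ∨ P.F.torsionSubsheaf.N1 ≠ ⊥) := fun hne => by
    have := hP.semistable _ hne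
    rw [Subsheaf.slope, if_pos (P.F.deg_torsionSubsheaf hP.coherent.1), Subsheaf.slope,
      if_neg (show (Subsheaf.whole P.F).deg ≠ 0 from hP.oneDim)] at this
    exact absurd this (by simp)
  push Not at h
  exact XSheaf.isPure_of_torsionSubsheaf h.1 h.2

/-! ### Subsheaves generated by sections of a twist -/

namespace Subsheaf

variable {F : XSheaf} {ι : Type*} {h : ι → F.M01} {k : ℕ}

theorem shift_mem_span_translates_univ {y : F.M01} (q : ℤ)
    (hy : y ∈ Submodule.span ℂ (Set.range (translates h))) :
    shift q y ∈ Submodule.span ℂ (Set.range (translates h)) := by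
  have e : Set.range (translates h) = translates h '' {x | x.2 ∈ Set.univ} := by simp
  rw [e] at hy ⊢
  exact shift_mem_span_translates q (by simp) hy

theorem fibMap_mem_span_translates (hf : ∀ i j, F.fibMap i (h j) ∈ Submodule.span ℂ (Set.range h))
    (i : Fin 3) {S : Set ℤ} {y : F.M01}
    (hy : y ∈ Submodule.span ℂ (translates h '' {x | x.2 ∈ S})) :
    F.fibMap i y ∈ Submodule.span ℂ (translates h '' {x | x.2 ∈ S}) := by
  induction hy using Submodule.span_induction with
  | mem y hy =>
    obtain ⟨x, hx, rfl⟩ := hy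
    rw [translates, F.fibMap_shift]
    exact shift_mem_span_translates_of_mem hx (hf i x.1)
  | zero => simp
  | add a b _ _ ha hb => rw [map_add]; exact Submodule.add_mem _ ha hb
  | smul c a _ ha => rw [map_smul]; exact Submodule.smul_mem _ _ ha

theorem fibMap_eq_zero_of_mem_span_translates {i : Fin 3} (hf : ∀ j, F.fibMap i (h j) = 0)
    {y : F.M01} (hy : y ∈ Submodule.span ℂ (Set.range (translates h))) : F.fibMap i y = 0 := by
  induction hy using Submodule.span_induction with
  | mem y hy =>
    obtain ⟨x, rfl⟩ := hy
    rw [translates, F.fibMap_shift, hf, map_zero]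
  | zero => simp
  | add a b _ _ ha hb => rw [map_add, ha, hb, add_zero]
  | smul c a _ ha => rw [map_smul, ha, smul_zero]

theorem exists_shift_mem_span_translates {y : F.M01}
    (hy : y ∈ Submodule.span ℂ (Set.range (translates h))) :
    ∃ n : ℕ, y ∈ Submodule.span ℂ (translates h '' {x | x.2 ∈ Set.Icc (-n : ℤ) n}) := by
  induction hy using Submodule.span_induction with
  | mem y hy =>
    obtain ⟨x, rfl⟩ := hy
    exact ⟨x.2.natAbs, Submodule.subset_span
      ⟨x, show x.2 ∈ Set.Icc _ _ from ⟨by omega, by omega⟩, rfl⟩⟩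
  | zero => exact ⟨0, Submodule.zero_mem _⟩
  | add a b _ _ ha hb =>
    obtain ⟨n, hn⟩ := ha
    obtain ⟨m, hm⟩ := hb
    refine ⟨n + m, Submodule.add_mem _ (Submodule.span_mono (Set.image_mono ?_) hn)
      (Submodule.span_mono (Set.image_mono ?_) hm)⟩ <;>
    · intro x hx
      simp at hx ⊢
      omega
  | smul c a _ ha =>
    obtain ⟨n, hn⟩ := ha
    exact ⟨n, Submodule.smul_mem _ _ hn⟩

/-- The subsheaf `V ⊗ O(k)`, for a space `V` of sections of the `(-k)`-th twist with basis `h`. -/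
def ofSections (h : ι → F.M01) (k : ℕ) (h0 : ∀ j, h j ∈ LinearMap.range F.res0C)
    (h1 : ∀ j, shift k (h j) ∈ LinearMap.range F.res1C)
    (hf0 : ∀ j, F.fibMap 0 (h j) = 0) (hf1 : ∀ j, F.fibMap 1 (h j) = 0)
    (hf2 : ∀ j, F.fibMap 2 (h j) ∈ Submodule.span ℂ (Set.range h)) : Subsheaf F :=
  have hf : ∀ i j, F.fibMap i (h j) ∈ Submodule.span ℂ (Set.range h) := by
    intro i j
    fin_cases i
    · exact (hf0 j).symm ▸ Submodule.zero_mem _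
    · exact (hf1 j).symm ▸ Submodule.zero_mem _
    · exact hf2 j
  ofLattice (Submodule.span ℂ (translates h '' {x | x.2 ∈ Set.Ici 0}))
    (Submodule.span ℂ (translates h '' {x | x.2 ∈ Set.Iic (k : ℤ)}))
    (Submodule.span ℂ (Set.range (translates h)))
    (fun _ hy => shift_mem_span_translates 1 (by simp; omega) hy)
    (fun i _ hy => fibMap_mem_span_translates hf i hy)
    (fun _ hy => shift_mem_span_translates (-1) (by simp; omega) hy)
    (fun i y hy => by
      have hy' := Submodule.span_mono (Set.image_subset_range _ _) hy
      fin_cases i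
      · change shift _ (F.fibMap 0 y) ∈ _
        rw [fibMap_eq_zero_of_mem_span_translates hf0 hy', map_zero]; exact Submodule.zero_mem _
      · change shift _ (F.fibMap 1 y) ∈ _
        rw [fibMap_eq_zero_of_mem_span_translates hf1 hy', map_zero]; exact Submodule.zero_mem _
      · exact (shift_zero (F.fibMap 2 y)).symm ▸ fibMap_mem_span_translates hf 2 hy)
    (fun q _ hy => shift_mem_span_translates_univ q hy)
    (fun i y hy => by
      have e : Set.range (translates h) = translates h '' {x | x.2 ∈ Set.univ} := by simp
      rw [e] at hy ⊢
      exact fibMap_mem_span_translates hf i hy)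
    (Submodule.span_le.2 (by
      rintro _ ⟨x, hx, rfl⟩
      rw [SetLike.mem_coe, ← image0_whole]
      refine shift_mem_of_le (fun y hy => (whole F).shift_mem_image0 hy) hx ?_
      rw [image0_whole]; exact h0 x.1))
    (Submodule.span_le.2 (by
      rintro _ ⟨x, hx, rfl⟩
      rw [SetLike.mem_coe, ← image1_whole]
      have := shift_mem_of_nonpos (fun y hy => (whole F).shift_mem_image1 hy)
        (q := x.2 - k) (by simp at hx; omega) (by rw [image1_whole]; exact h1 x.1)
      rwa [shift_shift, sub_add_cancel] at this))
    (Submodule.span_mono (Set.image_subset_range _ _))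
    (Submodule.span_mono (Set.image_subset_range _ _))
    (fun y hy => by
      obtain ⟨n, hn⟩ := exists_shift_mem_span_translates hy
      exact ⟨n, shift_mem_span_translates n (by simp; omega) hn⟩)
    (fun y hy => by
      obtain ⟨n, hn⟩ := exists_shift_mem_span_translates hy
      exact ⟨n, shift_mem_span_translates (-n) (by simp; omega) hn⟩)

/-- This is `H¹(O(k)) = 0`: as `k ≥ 0`, every exponent is at least `0` or at most `k`. -/
theorem span_translates_le_sup (h : ι → F.M01) (k : ℕ) :
    Submodule.span ℂ (Set.range (translates h)) ≤
      Submodule.span ℂ (translates h '' {x | x.2 ∈ Set.Ici 0}) ⊔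
      Submodule.span ℂ (translates h '' {x | x.2 ∈ Set.Iic (k : ℤ)}) := by
  rw [← Submodule.span_union, ← Set.image_union, ← Set.image_univ]
  refine Submodule.span_mono (Set.image_mono ?_)
  intro x _
  rcases le_total 0 x.2 with hx | hx
  · exact Or.inl hx
  · exact Or.inr (by simp; omega)

/-- `H¹` vanishes and `H⁰` has the basis `z ^ q h_j` with `0 ≤ q ≤ k`. -/
theorem chi_eq_of_translates [Fintype ι] (N : Subsheaf F) (hpure : F.IsPure)
    (hli : LinearIndependent ℂ (translates h))
    (e0 : N.image0 = Submodule.span ℂ (translates h '' {x | x.2 ∈ Set.Ici 0}))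
    (e1 : N.image1 = Submodule.span ℂ (translates h '' {x | x.2 ∈ Set.Iic (k : ℤ)}))
    (e : N.N01.restrictScalars ℂ ≤ Submodule.span ℂ (Set.range (translates h))) :
    N.chi = Fintype.card ι * (k + 1) := by
  rw [N.chi_eq hpure.injective0 hpure.injective1, e0, e1, span_image_inf_span_image hli,
    finrank_span_image hli]
  · have : ({x | x.2 ∈ Set.Ici 0} ∩ {x | x.2 ∈ Set.Iic (k : ℤ)} : Set (ι × ℤ))
        = (Finset.univ ×ˢ Finset.Icc (0 : ℤ) k : Finset (ι × ℤ)) := by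
      ext x; simp
    rw [this, Set.ncard_coe_finset]
    simp
  · rw [e0, e1]; exact e.trans (span_translates_le_sup h k)

/-- The rank is the dimension of the fibre at `Z_0`. Evaluation kills exactly the part with
exponents at least `1`, so it identifies the span of `h`, the part with exponent `0`, with the
fibre. -/
theorem deg_eq_of_translates [Fintype ι] (N : Subsheaf F) (hpure : F.IsPure)
    (hfin : Module.Finite (Polynomial ℂ) F.M0) (hli : LinearIndependent ℂ (translates h))
    (e0 : N.image0 = Submodule.span ℂ (translates h '' {x | x.2 ∈ Set.Ici 0})) :
    N.deg = Fintype.card ι := by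
  obtain ⟨ev, hsurj, hker⟩ := N.exists_evaluation hfin hpure.torsionFree hpure.injective0
  have hh : ∀ j, h j ∈ N.image0 := fun j => by
    rw [e0]; exact Submodule.subset_span ⟨(j, 0), by simp, shift_zero _⟩
  have hli' : LinearIndependent ℂ h := by
    have := hli.comp (fun j => (j, (0 : ℤ))) (fun i j hij => congrArg Prod.fst hij)
    convert this using 1
    funext j; exact (shift_zero _).symm
  let f : Submodule.span ℂ (Set.range h) →ₗ[ℂ] (Fin N.deg → ℂ) :=
    ev ∘ₗ Submodule.inclusion (Submodule.span_le.2 (by rintro _ ⟨j, rfl⟩; exact hh j))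
  have hinj : Function.Injective f := by
    rw [injective_iff_map_eq_zero]
    rintro ⟨v, hv⟩ hv0
    have h1 : shift (-1) v ∈ N.image0 := (hker _).1 hv0
    have h2 : v ∈ Submodule.span ℂ (translates h '' {x | x.2 ∈ Set.Ici 1}) := by
      rw [e0] at h1
      have := shift_mem_span_translates (S' := Set.Ici 1) 1 (by simp) h1
      rwa [shift_shift, add_neg_cancel, shift_zero] at this
    have h3 : v ∈ Submodule.span ℂ (translates h '' {x | x.2 ∈ ({0} : Set ℤ)}) := by
      have := shift_mem_span_translates_of_mem (S := {0}) rfl hv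
      rwa [shift_zero] at this
    have h4 : v ∈ (⊥ : Submodule ℂ F.M01) := by
      rw [← (hli.disjoint_span_image (s := {x | x.2 ∈ Set.Ici (1 : ℤ)})
        (t := {x | x.2 ∈ ({0} : Set ℤ)}) ?_).eq_bot]
      · exact ⟨h2, h3⟩
      · rw [Set.disjoint_left]
        intro x hx hx'
        simp at hx hx'
        omega
    exact Subtype.ext h4
  have hsurj' : Function.Surjective f := by
    intro c
    obtain ⟨⟨a, ha⟩, rfl⟩ := hsurj c
    have ha' : a ∈ Submodule.span ℂ (translates h '' {x | x.2 ∈ ({0} : Set ℤ)}) ⊔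
        Submodule.span ℂ (translates h '' {x | x.2 ∈ Set.Ici (1 : ℤ)}) := by
      rw [← Submodule.span_union, ← Set.image_union]
      rw [e0] at ha
      refine Submodule.span_mono (Set.image_mono ?_) ha
      intro x hx
      simp at hx ⊢
      omega
    obtain ⟨v, hv, a', ha1, rfl⟩ := Submodule.mem_sup.1 ha'
    have hv' : v ∈ Submodule.span ℂ (Set.range h) := by
      refine Submodule.span_mono ?_ hv
      rintro _ ⟨⟨j, q⟩, hx, rfl⟩
      obtain rfl : q = 0 := hx
      exact ⟨j, (shift_zero _).symm⟩
    have ha0 : a' ∈ N.image0 := by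
      rw [e0]
      refine Submodule.span_mono (Set.image_mono ?_) ha1
      intro x hx
      simp at hx ⊢
      omega
    refine ⟨⟨v, hv'⟩, ?_⟩
    have h5 : ev ⟨a', ha0⟩ = 0 := by
      refine (hker _).2 (e0.symm.le ?_)
      exact shift_mem_span_translates (-1) (by simp) ha1
    have hv0 : v ∈ N.image0 := by
      have := N.image0.sub_mem ha ha0
      rwa [add_sub_cancel_right] at this
    have h6 : (⟨v + a', ha⟩ : N.image0) = ⟨v, hv0⟩ + ⟨a', ha0⟩ := rfl
    rw [h6, map_add, h5, add_zero]
    rfl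
  have h7 := (LinearEquiv.ofBijective f ⟨hinj, hsurj'⟩).finrank_eq
  rw [finrank_span_eq_card hli'] at h7
  simpa using h7.symm

end Subsheaf

/-! ### Normal forms -/

/-- The boxes of a sequence of columns of heights `e 0, …, e k`. -/
abbrev Box {k : ℕ} (e : Fin (k + 1) → ℕ) : Type := Σ p : Fin (k + 1), Fin (e p)

/-- The weight of `z ^ q x₃ ^ a y_p`, where `y_p` has weight `t₀ ^ (-p)`. -/
def weight {k : ℕ} (p : Fin (k + 1)) (a : ℕ) (q : ℤ) : Character :=
  (q - p) • tchar 0 + a • tchar 3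

/-- The weights of the basis in a normal form. -/
def boxWeight {k : ℕ} {e : Fin (k + 1) → ℕ} (x : Box e × ℤ) : Character :=
  weight x.1.1 x.1.2 x.2

theorem weight_add_base {k : ℕ} (p : Fin (k + 1)) (a : ℕ) (q q' : ℤ) :
    weight p a (q + q') = weight p a q + q' • tchar 0 := by
  rw [weight, weight, add_sub_right_comm, add_smul]; abel

theorem weight_succ {k : ℕ} (p : Fin (k + 1)) (a : ℕ) (q : ℤ) :
    weight p (a + 1) q = weight p a q + tchar 3 := by
  rw [weight, weight, add_smul, one_smul]; abel

/-- The images of generators `y_p` under the powers of `x₃`. -/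
def chain (F : XSheaf) {k : ℕ} (e : Fin (k + 1) → ℕ) (y : Fin (k + 1) → F.M01) (i : Box e) :
    F.M01 :=
  (F.fibMap 2 ^ (i.2 : ℕ)) (y i.1)

/-- A presentation of a pair as the direct sum of the sheaves `O(k) ⊗ ℂ[x₃] / x₃ ^ (e p)`, with the
section `∑ z ^ p`: over the overlap, `z ^ q x₃ ^ a y_p` is a basis. -/
structure NormalForm (P : SheafPair) (k : ℕ) (e : Fin (k + 1) → ℕ) where
  y : Fin (k + 1) → P.F.M01
  b : Module.Basis (Box e × ℤ) ℂ P.F.M01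
  b_eq : ⇑b = translates (chain P.F e y)
  nil : ∀ p, (P.F.fibMap 2 ^ e p) (y p) = 0
  fib_zero : ∀ v, P.F.fibMap 0 v = 0
  fib_one : ∀ v, P.F.fibMap 1 v = 0
  inj0 : Function.Injective P.F.res0C
  inj1 : Function.Injective P.F.res1C
  range0 : LinearMap.range P.F.res0C = Submodule.span ℂ (b '' {x | x.2 ∈ Set.Ici 0})
  range1 : LinearMap.range P.F.res1C = Submodule.span ℂ (b '' {x | x.2 ∈ Set.Iic (k : ℤ)})
  sec : P.F.res0C P.s0 = ∑ p : Fin (k + 1), shift (p : ℤ) (y p)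

namespace NormalForm

variable {P : SheafPair} {k : ℕ} {e : Fin (k + 1) → ℕ} (B : NormalForm P k e)

theorem b_apply (x : Box e × ℤ) :
    B.b x = shift x.2 ((P.F.fibMap 2 ^ (x.1.2 : ℕ)) (B.y x.1.1)) := by
  rw [B.b_eq]; rfl

theorem shift_b (q : ℤ) (x : Box e × ℤ) : shift q (B.b x) = B.b (x.1, x.2 + q) := by
  rw [b_apply, b_apply, shift_shift, add_comm]

theorem b_eq_shift (x : Box e × ℤ) : B.b x = shift x.2 (B.b (x.1, 0)) := by
  rw [shift_b, zero_add]

theorem fib_b (x : Box e × ℤ) : P.F.fibMap 2 (B.b x) =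
    if h : (x.1.2 : ℕ) + 1 < e x.1.1 then B.b (⟨x.1.1, ⟨x.1.2 + 1, h⟩⟩, x.2) else 0 := by
  rw [b_apply, P.F.fibMap_shift, ← Module.End.mul_apply (P.F.fibMap 2), ← pow_succ']
  split_ifs with h
  · rw [b_apply]
  · have : (x.1.2 : ℕ) + 1 = e x.1.1 := by have := x.1.2.2; omega
    rw [this, B.nil, map_zero]

theorem y_eq (p : Fin (k + 1)) :
    B.y p = if h : 0 < e p then B.b (⟨p, ⟨0, h⟩⟩, 0) else 0 := by
  split_ifs with h
  · rw [b_apply, shift_zero]; rfl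
  · have := B.nil p
    rwa [Nat.eq_zero_of_not_pos h] at this

theorem translates_mem (x : Box e × ℤ) : B.b x ∈ weightSpan (K := ℂ) B.b boxWeight (boxWeight x) :=
  self_mem_weightSpan _ _ _

theorem map_mem_weightSpan (f : P.F.M01 →ₗ[ℂ] P.F.M01) (c : Character)
    (h : ∀ x, f (B.b x) ∈ weightSpan (K := ℂ) B.b boxWeight (boxWeight x + c)) {χ : Character}
    {v : P.F.M01} (hv : v ∈ weightSpan (K := ℂ) B.b boxWeight χ) :
    f v ∈ weightSpan (K := ℂ) B.b boxWeight (χ + c) := by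
  rw [weightSpan] at hv
  induction hv using Submodule.span_induction with
  | mem y hy => obtain ⟨x, rfl, rfl⟩ := hy; exact h x
  | zero => rw [map_zero]; exact Submodule.zero_mem _
  | add a b _ _ ha hb => rw [map_add]; exact Submodule.add_mem _ ha hb
  | smul c a _ ha => rw [map_smul]; exact Submodule.smul_mem _ _ ha

theorem shift_mem_weightSpan (q : ℤ) {χ : Character} {v : P.F.M01}
    (hv : v ∈ weightSpan (K := ℂ) B.b boxWeight χ) :
    shift q v ∈ weightSpan (K := ℂ) B.b boxWeight (χ + q • tchar 0) := by
  refine B.map_mem_weightSpan (shift q) _ (fun x => ?_) hv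
  rw [shift_b, boxWeight, ← weight_add_base]
  exact B.translates_mem (x.1, x.2 + q)

theorem fib_mem_weightSpan {χ : Character} {v : P.F.M01}
    (hv : v ∈ weightSpan (K := ℂ) B.b boxWeight χ) :
    P.F.fibMap 2 v ∈ weightSpan (K := ℂ) B.b boxWeight (χ + tchar 3) := by
  refine B.map_mem_weightSpan (P.F.fibMap 2) _ (fun x => ?_) hv
  rw [fib_b]
  split_ifs with h
  · have := B.translates_mem (⟨x.1.1, ⟨x.1.2 + 1, h⟩⟩, x.2)
    rwa [boxWeight, weight_succ] at this
  · exact Submodule.zero_mem _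

theorem y_mem_weightSpan (p : Fin (k + 1)) :
    B.y p ∈ weightSpan (K := ℂ) B.b boxWeight (weight p 0 0) := by
  rw [y_eq]
  split_ifs with h
  · exact B.translates_mem (⟨p, ⟨0, h⟩⟩, 0)
  · exact Submodule.zero_mem _

theorem sec_mem_weightSpan :
    P.F.res0C P.s0 ∈ weightSpan (K := ℂ) B.b boxWeight 0 := by
  rw [B.sec]
  refine Submodule.sum_mem _ fun p _ => ?_
  convert B.shift_mem_weightSpan p (B.y_mem_weightSpan p) using 1
  rw [← weight_add_base, weight]; simp

theorem res1C_s1 : P.F.res1C P.s1 = P.F.res0C P.s0 := P.glue.symm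

/-- The image of `f` is spanned by weight vectors, so the grading of the overlap restricts to it,
and injectivity of `f` carries it back to `M`. -/
theorem isInternal_comap {M : Type} [AddCommGroup M] [Module ℂ M] (f : M →ₗ[ℂ] P.F.M01)
    (hf : Function.Injective f) (S : Set (Box e × ℤ))
    (hr : LinearMap.range f = Submodule.span ℂ (B.b '' S)) :
    DirectSum.IsInternal fun χ => (weightSpan (K := ℂ) B.b boxWeight χ).comap f := by
  have hW := isInternal_weightSpan B.b (boxWeight (e := e))
  rw [DirectSum.isInternal_submodule_iff_iSupIndep_and_iSup_eq_top] at hW ⊢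
  constructor
  · rw [iSupIndep_def]
    intro χ
    rw [Submodule.disjoint_def]
    intro a ha ha'
    have h1 : (⨆ ψ, ⨆ (_ : ψ ≠ χ), (weightSpan (K := ℂ) B.b boxWeight ψ).comap f) ≤
        (⨆ ψ, ⨆ (_ : ψ ≠ χ), weightSpan (K := ℂ) B.b boxWeight ψ).comap f :=
      iSup₂_le fun ψ hψ a ha => Submodule.mem_iSup_of_mem ψ (Submodule.mem_iSup_of_mem hψ ha)
    have := Submodule.disjoint_def.1 (hW.1 χ) (f a) ha (h1 ha')
    exact hf (this.trans (map_zero f).symm)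
  · rw [eq_top_iff]
    intro a _
    have ha : f a ∈ Submodule.map f (⨆ χ, (weightSpan (K := ℂ) B.b boxWeight χ).comap f) := by
      have h2 : Submodule.span ℂ (B.b '' S) ≤
          Submodule.map f (⨆ χ, (weightSpan (K := ℂ) B.b boxWeight χ).comap f) := by
        rw [Submodule.span_le]
        rintro _ ⟨x, hx, rfl⟩
        have h3 : B.b x ∈ LinearMap.range f := hr ▸ Submodule.subset_span ⟨x, hx, rfl⟩
        obtain ⟨c, hc⟩ := h3
        refine ⟨c, Submodule.mem_iSup_of_mem (boxWeight x) ?_, hc⟩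
        rw [Submodule.mem_comap, hc]
        exact B.translates_mem x
      exact h2 (hr ▸ LinearMap.mem_range_self f a)
    obtain ⟨c, hc, hca⟩ := ha
    rwa [← hf hca]

/-- The equivariant structure given by a normal form. -/
def equivariantStructure : EquivariantStructure P where
  G0 χ := (weightSpan (K := ℂ) B.b boxWeight χ).comap P.F.res0C
  G1 χ := (weightSpan (K := ℂ) B.b boxWeight χ).comap P.F.res1C
  G01 := weightSpan (K := ℂ) B.b boxWeight
  internal0 := B.isInternal_comap _ B.inj0 _ B.range0
  internal1 := B.isInternal_comap _ B.inj1 _ B.range1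
  internal01 := isInternal_weightSpan _ _
  base0 χ a ha := by
    rw [Submodule.mem_comap, P.F.res0C_base]
    simpa using B.shift_mem_weightSpan 1 ha
  fib0 i χ a ha := by
    rw [Submodule.mem_comap, P.F.res0C_fib]
    fin_cases i
    · exact (B.fib_zero _).symm ▸ Submodule.zero_mem _
    · exact (B.fib_one _).symm ▸ Submodule.zero_mem _
    · exact B.fib_mem_weightSpan ha
  base1 χ a ha := by
    rw [Submodule.mem_comap, P.F.res1C_base]
    have := B.shift_mem_weightSpan (-1) ha
    rwa [neg_one_smul, ← sub_eq_add_neg] at this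
  fib1 i χ a ha := by
    rw [Submodule.mem_comap, P.F.res1C_fib]
    fin_cases i
    · change shift 1 (P.F.fibMap 0 (P.F.res1C a)) ∈ _
      rw [B.fib_zero, map_zero]; exact Submodule.zero_mem _
    · change shift 1 (P.F.fibMap 1 (P.F.res1C a)) ∈ _
      rw [B.fib_one, map_zero]; exact Submodule.zero_mem _
    · change shift 0 (P.F.fibMap 2 (P.F.res1C a)) ∈ _
      rw [shift_zero]
      exact B.fib_mem_weightSpan ha
  base01 q χ v hv := B.shift_mem_weightSpan q hv
  fib_01 i χ v hv := by
    rw [← XSheaf.fibMap_apply]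
    fin_cases i
    · exact (B.fib_zero _).symm ▸ Submodule.zero_mem _
    · exact (B.fib_one _).symm ▸ Submodule.zero_mem _
    · exact B.fib_mem_weightSpan hv
  res_0 χ a ha := ha
  res_1 χ a ha := ha
  s_0 := B.sec_mem_weightSpan
  s_1 := by
    rw [Submodule.mem_comap, res1C_s1]; exact B.sec_mem_weightSpan

variable (E : EquivariantStructure P)

theorem G0_eq (B : NormalForm P k e) (E : EquivariantStructure P) (χ : Character) :
    E.G0 χ = (E.G01 χ).comap P.F.res0C :=
  IsInternal.eq_comap E.internal0 E.internal01 _ B.inj0 E.res_0 χ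

theorem G1_eq (B : NormalForm P k e) (E : EquivariantStructure P) (χ : Character) :
    E.G1 χ = (E.G01 χ).comap P.F.res1C :=
  IsInternal.eq_comap E.internal1 E.internal01 _ B.inj1 E.res_1 χ

theorem shift_mem_span_b (q : ℤ) {S S' : Set ℤ} (hS : ∀ a ∈ S, q + a ∈ S') {v : P.F.M01}
    (hv : v ∈ Submodule.span ℂ (B.b '' {x | x.2 ∈ S})) :
    shift q v ∈ Submodule.span ℂ (B.b '' {x | x.2 ∈ S'}) := by
  rw [B.b_eq] at hv ⊢
  exact shift_mem_span_translates q hS hv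

theorem y_mem_span_zero (p : Fin (k + 1)) :
    B.y p ∈ Submodule.span ℂ (B.b '' {x | x.2 ∈ ({0} : Set ℤ)}) := by
  rw [y_eq]
  split_ifs with h
  · exact Submodule.subset_span ⟨_, rfl, rfl⟩
  · exact Submodule.zero_mem _

theorem span_inf (S S' : Set ℤ) :
    Submodule.span ℂ (B.b '' {x | x.2 ∈ S}) ⊓ Submodule.span ℂ (B.b '' {x | x.2 ∈ S'}) =
      Submodule.span ℂ (B.b '' {x | x.2 ∈ S ∩ S'}) :=
  span_image_inf_span_image B.b.linearIndependent _ _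

/-- A section of the `k`-th twist has exponents at least `0` from one chart and at most `0` from the
other, so it lies in the constant layer `V`. -/
theorem mem_span_zero_of_mem_range {v : P.F.M01} (h0 : v ∈ LinearMap.range P.F.res0C)
    (h1 : shift k v ∈ LinearMap.range P.F.res1C) :
    v ∈ Submodule.span ℂ (B.b '' {x | x.2 ∈ ({0} : Set ℤ)}) := by
  have e : ({0} : Set ℤ) = Set.Ici 0 ∩ Set.Iic 0 := by ext; simp; omega
  rw [e, ← B.span_inf, ← B.range0]
  refine ⟨h0, ?_⟩
  rw [B.range1] at h1
  have := B.shift_mem_span_b (-k) (S' := Set.Iic 0) (by simp) h1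
  rwa [shift_shift, neg_add_cancel, shift_zero] at this

theorem y_mem_ranges (p : Fin (k + 1)) :
    B.y p ∈ LinearMap.range P.F.res0C ∧ shift k (B.y p) ∈ LinearMap.range P.F.res1C := by
  constructor
  · rw [B.range0]
    exact Submodule.span_mono (Set.image_mono (by intro x hx; simp at hx ⊢; omega))
      (B.y_mem_span_zero p)
  · rw [B.range1]
    exact B.shift_mem_span_b k (by simp) (B.y_mem_span_zero p)

/-- The decomposition by the power of `z` is direct. -/
theorem eq_zero_of_sum_shift_eq_zero {c : Fin (k + 1) → P.F.M01}
    (hc : ∀ p, c p ∈ Submodule.span ℂ (B.b '' {x | x.2 ∈ ({0} : Set ℤ)}))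
    (h : ∑ p : Fin (k + 1), shift (p : ℤ) (c p) = 0) (p : Fin (k + 1)) : c p = 0 := by
  have h1 : shift (p : ℤ) (c p) = -∑ p' ∈ Finset.univ.erase p, shift (p' : ℤ) (c p') := by
    rw [eq_neg_iff_add_eq_zero, ← h]
    exact Finset.add_sum_erase _ (fun p : Fin (k + 1) => shift ((p : ℕ) : ℤ) (c p))
      (Finset.mem_univ p)
  have h2 : shift (p : ℤ) (c p) ∈ Submodule.span ℂ (B.b '' {x | x.2 ∈ ({(p : ℤ)} : Set ℤ)}) :=
    B.shift_mem_span_b p (by simp) (hc p)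
  have h3 : shift (p : ℤ) (c p) ∈ Submodule.span ℂ (B.b '' {x | x.2 ∈ ({(p : ℤ)}ᶜ : Set ℤ)}) := by
    rw [h1]
    refine Submodule.neg_mem _ (Submodule.sum_mem _ fun p' hp' => ?_)
    refine B.shift_mem_span_b p' ?_ (hc p')
    have := Fin.val_ne_of_ne (Finset.ne_of_mem_erase hp')
    simp; omega
  have h4 : shift (p : ℤ) (c p) ∈ (⊥ : Submodule ℂ P.F.M01) := by
    have := Submodule.mem_inf.2 ⟨h2, h3⟩
    rw [B.span_inf] at this
    simpa using this
  rw [Submodule.mem_bot, ← map_zero (shift (p : ℤ))] at h4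
  exact shift_injective _ h4

/-- Invariance of the section pins down the weights. Weight components of `y_p` are again sections
of the `k`-th twist, so they lie in the constant layer. Every component of `∑ z ^ p y_p` of non-zero
weight vanishes, hence so does each of its coefficients as a polynomial in `z`, and only weight `t₀
^ (-p)` survives in `y_p`. -/
theorem y_mem_G01 (p : Fin (k + 1)) : B.y p ∈ E.G01 (weight p 0 0) := by
  have hinj : ∀ q : ℤ, Function.Injective fun χ : Character => χ + q • tchar 0 :=
    fun q => add_left_injective _
  have hs : ∀ (q : ℤ) χ (v : P.F.M01), component E.internal01 (χ + q • tchar 0) (shift q v)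
      = shift q (component E.internal01 χ v) := fun q χ v =>
    component_comm E.internal01 E.internal01 (shift q) _ (hinj q) (E.base01 q) χ v
  have hr0 : ∀ χ a, component E.internal01 χ (P.F.res0C a) =
      P.F.res0C (component E.internal0 χ a) :=
    component_comm E.internal0 E.internal01 P.F.res0C id Function.injective_id E.res_0
  have hr1 : ∀ χ b, component E.internal01 χ (P.F.res1C b) =
      P.F.res1C (component E.internal1 χ b) :=
    component_comm E.internal1 E.internal01 P.F.res1C id Function.injective_id E.res_1
  refine mem_of_component_eq_zero E.internal01 fun ψ hψ => ?_
  -- This is the component of the section of weight `ψ + p • tchar 0`. Removing `z ^ p'` lowers the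
  -- weight by `p' • tchar 0`, and the coefficient with `p' = p` is the component of `y_p` of weight
  -- `ψ`.
  have hsum : ∑ p' : Fin (k + 1), shift (p' : ℤ)
      (component E.internal01 (ψ + ((p : ℤ) - p') • tchar 0) (B.y p')) = 0 := by
    have h1 : component E.internal01 (ψ + (p : ℤ) • tchar 0) (P.F.res0C P.s0) = 0 := by
      rw [XSheaf.res0C_apply, component_of_mem E.internal01 (E.res_0 0 _ E.s_0), if_neg]
      intro h
      apply hψ
      rw [eq_neg_of_add_eq_zero_left h, weight]
      simp
    rw [← h1, B.sec, map_sum]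
    refine Finset.sum_congr rfl fun p' _ => ?_
    rw [← hs, add_assoc, ← add_smul]
    simp
  have := B.eq_zero_of_sum_shift_eq_zero (fun p' => ?_) hsum p
  · simpa using this
  · obtain ⟨⟨a, ha⟩, b, hb⟩ := B.y_mem_ranges p'
    refine B.mem_span_zero_of_mem_range ?_ ?_
    · rw [← ha, hr0]
      exact LinearMap.mem_range_self _ _
    · rw [← hs, ← hb, hr1]
      exact LinearMap.mem_range_self _ _

theorem b_mem_G01 (x : Box e × ℤ) : B.b x ∈ E.G01 (boxWeight x) := by
  have h : ∀ a : ℕ, (P.F.fibMap 2 ^ a) (B.y x.1.1) ∈ E.G01 (weight x.1.1 a 0) := by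
    intro a
    induction a with
    | zero => exact B.y_mem_G01 E _
    | succ a ih =>
      rw [pow_succ', Module.End.mul_apply, weight_succ]
      exact E.fib_01 2 _ _ ih
  have := E.base01 x.2 _ _ (h x.1.2)
  rw [← weight_add_base, zero_add] at this
  rw [b_apply]
  exact this

theorem G01_eq : E.G01 = weightSpan (K := ℂ) B.b boxWeight := by
  refine (IsInternal.eq_of_le (isInternal_weightSpan B.b boxWeight) E.internal01 fun χ => ?_).symm
  rw [weightSpan, Submodule.span_le]
  rintro _ ⟨x, rfl, rfl⟩
  exact B.b_mem_G01 E x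

theorem eq_equivariantStructure : E = B.equivariantStructure := by
  have h01 := B.G01_eq E
  have h0 : E.G0 = B.equivariantStructure.G0 := funext fun χ => by rw [B.G0_eq, h01]; rfl
  have h1 : E.G1 = B.equivariantStructure.G1 := funext fun χ => by rw [B.G1_eq, h01]; rfl
  have h01' : E.G01 = B.equivariantStructure.G01 := h01
  cases E
  congr

theorem existsUnique_equivariantStructure (B : NormalForm P k e) :
    ∃! _ : EquivariantStructure P, True :=
  ⟨B.equivariantStructure, trivial, fun E _ => B.eq_equivariantStructure E⟩

theorem isSupportedOnY (B : NormalForm P k e) : P.F.IsSupportedOnY := by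
  refine ⟨fun a => B.inj0 ?_, fun b => B.inj1 ?_⟩
  · rw [P.F.res0C_fib, B.fib_one, map_zero]
  · rw [P.F.res1C_fib, B.fib_one, map_zero, map_zero]

end NormalForm

/-! ### Isomorphisms covering a torus element -/

namespace SheafPair.TwistIso

variable {t : Fin 4 → ℂˣ} {P Q : SheafPair} (i : TwistIso t P Q)

theorem e01_shift_one (v : P.F.M01) : i.e01 (shift 1 v) = (t 0 : ℂ) • shift 1 (i.e01 v) :=
  i.e01_base v

theorem e01_shift (q : ℤ) (v : P.F.M01) :
    i.e01 (shift q v) = ((t 0 ^ q : ℂˣ) : ℂ) • shift q (i.e01 v) := by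
  induction q using Int.induction_on with
  | zero => simp [shift_zero]
  | succ n ih =>
    have := i.e01_shift_one (shift n v)
    rw [ih, shift_shift, map_smul, shift_shift, smul_smul] at this
    rw [add_comm, this, zpow_add, zpow_one, Units.val_mul]
  | pred n ih =>
    have := i.e01_shift_one (shift (-n - 1) v)
    rw [shift_shift, show (1 : ℤ) + (-n - 1) = -n by ring, ih] at this
    have h2 := congrArg (shift (-1)) this
    rw [map_smul, map_smul, shift_shift, shift_shift, neg_add_cancel, shift_zero] at h2
    have h3 : ((t 0 : ℂˣ) : ℂ) ≠ 0 := (t 0).ne_zero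
    apply smul_right_injective _ h3
    change (t 0 : ℂ) • _ = (t 0 : ℂ) • _
    rw [← h2, smul_smul, ← Units.val_mul, ← zpow_one_add, show (1 : ℤ) + (-n - 1) = -n by ring]
    congr 2
    ring_nf

theorem e01_fibMap (v : P.F.M01) (j : Fin 3) :
    i.e01 (P.F.fibMap j v) = (t j.succ : ℂ) • Q.F.fibMap j (i.e01 v) := i.e01_fib j v

theorem e01_fibMap_pow (a : ℕ) (v : P.F.M01) :
    i.e01 ((P.F.fibMap 2 ^ a) v) = ((t 3 : ℂ) ^ a) • (Q.F.fibMap 2 ^ a) (i.e01 v) := by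
  induction a with
  | zero => simp
  | succ a ih =>
    rw [pow_succ', Module.End.mul_apply, i.e01_fibMap, ih, map_smul, smul_smul,
      pow_succ' (Q.F.fibMap 2),
      Module.End.mul_apply, pow_succ']
    rfl

theorem map_range0 :
    (LinearMap.range P.F.res0C).map i.e01.toLinearMap = LinearMap.range Q.F.res0C := by
  ext v
  constructor
  · rintro ⟨_, ⟨a, rfl⟩, rfl⟩
    exact ⟨i.e0 a, (i.e_res0 a).symm⟩
  · rintro ⟨a, rfl⟩
    refine ⟨P.F.res0C (i.e0.symm a), ⟨_, rfl⟩, ?_⟩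
    exact (i.e_res0 _).trans (by rw [i.e0.apply_symm_apply]; rfl)

theorem map_range1 :
    (LinearMap.range P.F.res1C).map i.e01.toLinearMap = LinearMap.range Q.F.res1C := by
  ext v
  constructor
  · rintro ⟨_, ⟨a, rfl⟩, rfl⟩
    exact ⟨i.e1 a, (i.e_res1 a).symm⟩
  · rintro ⟨a, rfl⟩
    refine ⟨P.F.res1C (i.e1.symm a), ⟨_, rfl⟩, ?_⟩
    exact (i.e_res1 _).trans (by rw [i.e1.apply_symm_apply]; rfl)

end SheafPair.TwistIso

/-! ### Isomorphism, uniqueness and numerical invariants of normal forms -/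

namespace NormalForm

variable {P Q : SheafPair} {k : ℕ} {e : Fin (k + 1) → ℕ}

section twistIso

variable (B : NormalForm P k e) (B' : NormalForm Q k e) (t : Fin 4 → ℂˣ)

/-- The value of the weight of a basis vector at a point of the torus. -/
def boxScalar (x : Box e × ℤ) : ℂˣ := t 0 ^ (x.2 - (x.1.1 : ℤ)) * t 3 ^ (x.1.2 : ℕ)

/-- The map that takes the basis of one normal form to a multiple of the basis of another. -/
def twist01 : P.F.M01 ≃ₗ[ℂ] Q.F.M01 := B.b.equiv (B'.b.unitsSMul (boxScalar t)) (Equiv.refl _)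

theorem twist01_b (x : Box e × ℤ) : twist01 B B' t (B.b x) = (boxScalar t x : ℂ) • B'.b x := by
  rw [twist01, Module.Basis.equiv_apply, Module.Basis.unitsSMul_apply]; rfl

theorem map_twist01 (S : Set (Box e × ℤ)) :
    (Submodule.span ℂ (B.b '' S)).map (twist01 B B' t).toLinearMap =
      Submodule.span ℂ (B'.b '' S) := by
  rw [Submodule.map_span]
  refine le_antisymm (Submodule.span_le.2 ?_) (Submodule.span_le.2 ?_)
  · rintro _ ⟨_, ⟨x, hx, rfl⟩, rfl⟩
    rw [LinearEquiv.coe_coe, twist01_b]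
    exact Submodule.smul_mem _ _ (Submodule.subset_span ⟨x, hx, rfl⟩)
  · rintro _ ⟨x, hx, rfl⟩
    have : B'.b x = ((boxScalar t x)⁻¹ : ℂˣ).val • twist01 B B' t (B.b x) := by
      rw [twist01_b, smul_smul, ← Units.val_mul, inv_mul_cancel, Units.val_one, one_smul]
    rw [this]
    exact Submodule.smul_mem _ _ (Submodule.subset_span ⟨_, ⟨x, hx, rfl⟩, rfl⟩)

/-- An isomorphism of modules of sections over a chart, from one over the overlap. -/
def chartEquiv {M M' W W' : Type*} [AddCommGroup M] [Module ℂ M] [AddCommGroup M'] [Module ℂ M']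
    [AddCommGroup W] [Module ℂ W] [AddCommGroup W'] [Module ℂ W'] (f : M →ₗ[ℂ] W) (f' : M' →ₗ[ℂ] W')
    (hf : Function.Injective f) (hf' : Function.Injective f') (g : W ≃ₗ[ℂ] W')
    (h : (LinearMap.range f).map g.toLinearMap = LinearMap.range f') : M ≃ₗ[ℂ] M' :=
  (LinearEquiv.ofInjective f hf).trans
    ((g.submoduleMap (LinearMap.range f)).trans
      ((LinearEquiv.ofEq _ _ h).trans (LinearEquiv.ofInjective f' hf').symm))

theorem chartEquiv_apply {M M' W W' : Type*} [AddCommGroup M] [Module ℂ M] [AddCommGroup M']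
    [Module ℂ M'] [AddCommGroup W] [Module ℂ W] [AddCommGroup W'] [Module ℂ W'] (f : M →ₗ[ℂ] W)
    (f' : M' →ₗ[ℂ] W') (hf : Function.Injective f) (hf' : Function.Injective f') (g : W ≃ₗ[ℂ] W')
    (h : (LinearMap.range f).map g.toLinearMap = LinearMap.range f') (a : M) :
    f' (chartEquiv f f' hf hf' g h a) = g (f a) := by
  have := LinearEquiv.apply_symm_apply (LinearEquiv.ofInjective f' hf')
    (LinearEquiv.ofEq _ _ h (g.submoduleMap (LinearMap.range f) (LinearEquiv.ofInjective f hf a)))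
  exact congrArg Subtype.val this

theorem twist01_shift (v : P.F.M01) :
    twist01 B B' t (shift 1 v) = (t 0 : ℂ) • shift 1 (twist01 B B' t v) := by
  have : (twist01 B B' t).toLinearMap ∘ₗ shift 1
      = (t 0 : ℂ) • (shift 1 ∘ₗ (twist01 B B' t).toLinearMap) := by
    refine B.b.ext fun x => ?_
    simp only [LinearMap.comp_apply, LinearEquiv.coe_coe, LinearMap.smul_apply, shift_b, twist01_b,
      map_smul, smul_smul]
    congr 1
    rw [← Units.val_mul]
    congr 1
    simp only [boxScalar]
    rw [← mul_assoc, ← zpow_one_add]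
    congr 2
    ring
  exact LinearMap.congr_fun this v

theorem twist01_fib (j : Fin 3) (v : P.F.M01) :
    twist01 B B' t (P.F.fibMap j v) = (t j.succ : ℂ) • Q.F.fibMap j (twist01 B B' t v) := by
  have h2 : twist01 B B' t (P.F.fibMap 2 v) = (t 3 : ℂ) • Q.F.fibMap 2 (twist01 B B' t v) := by
    have : (twist01 B B' t).toLinearMap ∘ₗ P.F.fibMap 2
        = (t 3 : ℂ) • (Q.F.fibMap 2 ∘ₗ (twist01 B B' t).toLinearMap) := by
      refine B.b.ext fun x => ?_
      simp only [LinearMap.comp_apply, LinearEquiv.coe_coe, LinearMap.smul_apply, fib_b, twist01_b,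
        map_smul, smul_smul]
      split_ifs with h
      · rw [twist01_b]
        congr 1
        rw [← Units.val_mul]
        congr 1
        simp only [boxScalar]
        rw [pow_succ']
        exact mul_left_comm _ _ _
      · simp
    exact LinearMap.congr_fun this v
  fin_cases j
  · change twist01 B B' t (P.F.fibMap 0 v) = _ • Q.F.fibMap 0 _
    rw [B.fib_zero, B'.fib_zero, map_zero, smul_zero]
  · change twist01 B B' t (P.F.fibMap 1 v) = _ • Q.F.fibMap 1 _
    rw [B.fib_one, B'.fib_one, map_zero, smul_zero]
  · exact h2

theorem twist01_y (p : Fin (k + 1)) :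
    twist01 B B' t (B.y p) = ((t 0 ^ (-(p : ℤ)) : ℂˣ) : ℂ) • B'.y p := by
  rw [y_eq, y_eq]
  split_ifs with h
  · rw [twist01_b]
    simp [boxScalar]
  · simp

/-- Two pairs with the same normal form are isomorphic, over any element of the torus. -/
def twistIso : SheafPair.TwistIso t P Q :=
  have h0 := B'.range0 ▸ B.range0 ▸ map_twist01 B B' t _
  have h1 := B'.range1 ▸ B.range1 ▸ map_twist01 B B' t _
  have hs : twist01 B B' t (P.F.res0C P.s0) = Q.F.res0C Q.s0 := by
    have hshift : ∀ (n : ℕ) v, twist01 B B' t (shift n v)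
        = ((t 0 : ℂ) ^ n) • shift n (twist01 B B' t v) := by
      intro n v
      induction n with
      | zero => simp [shift_zero]
      | succ n ih =>
        have := twist01_shift B B' t (shift n v)
        rw [ih, shift_shift, map_smul, shift_shift, smul_smul, ← pow_succ'] at this
        rw [Nat.cast_succ, add_comm, this]
    rw [B.sec, B'.sec, map_sum]
    refine Finset.sum_congr rfl fun p _ => ?_
    rw [hshift, twist01_y, map_smul, smul_smul]
    have h3 : ((t 0 : ℂˣ) : ℂ) ≠ 0 := (t 0).ne_zero
    simp [h3]
  let e0 := chartEquiv P.F.res0C Q.F.res0C B.inj0 B'.inj0 (twist01 B B' t) h0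
  let e1 := chartEquiv P.F.res1C Q.F.res1C B.inj1 B'.inj1 (twist01 B B' t) h1
  have he0 : ∀ a, Q.F.res0C (e0 a) = twist01 B B' t (P.F.res0C a) :=
    chartEquiv_apply _ _ B.inj0 B'.inj0 _ h0
  have he1 : ∀ a, Q.F.res1C (e1 a) = twist01 B B' t (P.F.res1C a) :=
    chartEquiv_apply _ _ B.inj1 B'.inj1 _ h1
  { e0 := e0
    e1 := e1
    e01 := twist01 B B' t
    e0_base := fun a => B'.inj0 (by
      rw [he0, P.F.res0C_base, twist01_shift, map_smul, Q.F.res0C_base, he0])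
    e0_fib := fun i a => B'.inj0 (by
      rw [he0, P.F.res0C_fib, twist01_fib, map_smul, Q.F.res0C_fib, he0])
    e1_base := fun a => B'.inj1 (by
      rw [he1, P.F.res1C_base, map_smul, Q.F.res1C_base, he1]
      have := twist01_shift B B' t (shift (-1) (P.F.res1C a))
      rw [shift_shift, add_neg_cancel, shift_zero] at this
      rw [this, map_smul, shift_shift, neg_add_cancel, shift_zero, smul_smul,
        inv_mul_cancel₀ (t 0).ne_zero, one_smul])
    e1_fib := fun i a => B'.inj1 (by
      rw [he1, P.F.res1C_fib, map_smul, Q.F.res1C_fib, he1]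
      fin_cases i
      · change twist01 B B' t (shift 1 (P.F.fibMap 0 (P.F.res1C a)))
          = _ • shift 1 (Q.F.fibMap 0 _)
        rw [B.fib_zero, B'.fib_zero, map_zero, map_zero, map_zero, smul_zero]
      · change twist01 B B' t (shift 1 (P.F.fibMap 1 (P.F.res1C a)))
          = _ • shift 1 (Q.F.fibMap 1 _)
        rw [B.fib_one, B'.fib_one, map_zero, map_zero, map_zero, smul_zero]
      · change twist01 B B' t (shift 0 (P.F.fibMap 2 (P.F.res1C a)))
          = (t 3 : ℂ) • shift 0 (Q.F.fibMap 2 _)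
        rw [shift_zero, shift_zero]
        exact twist01_fib B B' t 2 _)
    e01_base := twist01_shift B B' t
    e01_fib := twist01_fib B B' t
    e_res0 := fun a => (he0 a).symm
    e_res1 := fun a => (he1 a).symm
    e_s0 := B'.inj0 ((he0 _).trans hs)
    e_s1 := B'.inj1 ((he1 _).trans (by rw [res1C_s1, res1C_s1]; exact hs)) }

end twistIso

/-- Normal forms are carried over by isomorphisms of pairs. -/
def ofIso (i : SheafPair.TwistIso 1 P Q) (B : NormalForm P k e) : NormalForm Q k e :=
  have hs : ∀ q v, i.e01 (shift q v) = shift q (i.e01 v) := fun q v => by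
    rw [i.e01_shift]; simp
  have hf : ∀ j v, i.e01 (P.F.fibMap j v) = Q.F.fibMap j (i.e01 v) := fun j v => by
    rw [i.e01_fibMap]; simp
  have hp : ∀ a v, i.e01 ((P.F.fibMap 2 ^ a) v) = (Q.F.fibMap 2 ^ a) (i.e01 v) := fun a v => by
    rw [i.e01_fibMap_pow]; simp
  { y := fun p => i.e01 (B.y p)
    b := B.b.map i.e01
    b_eq := funext fun x => by
      rw [Module.Basis.map_apply, B.b_apply, hs, hp]; rfl
    nil := fun p => by rw [← hp, B.nil, map_zero]
    fib_zero := fun v => by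
      obtain ⟨v, rfl⟩ := i.e01.surjective v
      rw [← hf, B.fib_zero, map_zero]
    fib_one := fun v => by
      obtain ⟨v, rfl⟩ := i.e01.surjective v
      rw [← hf, B.fib_one, map_zero]
    inj0 := fun a a' h => by
      obtain ⟨a, rfl⟩ := i.e0.surjective a
      obtain ⟨a', rfl⟩ := i.e0.surjective a'
      rw [XSheaf.res0C_apply, XSheaf.res0C_apply, ← i.e_res0, ← i.e_res0] at h
      rw [B.inj0 (i.e01.injective h)]
    inj1 := fun a a' h => by
      obtain ⟨a, rfl⟩ := i.e1.surjective a
      obtain ⟨a', rfl⟩ := i.e1.surjective a'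
      rw [XSheaf.res1C_apply, XSheaf.res1C_apply, ← i.e_res1, ← i.e_res1] at h
      rw [B.inj1 (i.e01.injective h)]
    range0 := by
      rw [← i.map_range0, B.range0, Submodule.map_span, ← Set.image_comp]
      congr 2
    range1 := by
      rw [← i.map_range1, B.range1, Submodule.map_span, ← Set.image_comp]
      congr 2
    sec := by
      rw [XSheaf.res0C_apply, ← i.e_s0, ← i.e_res0, ← XSheaf.res0C_apply, B.sec, map_sum]
      exact Finset.sum_congr rfl fun p _ => hs _ _ }

theorem pow_fib_y_eq_zero_iff (B : NormalForm P k e) (p : Fin (k + 1)) (a : ℕ) :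
    (P.F.fibMap 2 ^ a) (B.y p) = 0 ↔ e p ≤ a := by
  constructor
  · intro h
    by_contra! ha
    have := B.b.ne_zero (⟨p, ⟨a, ha⟩⟩, 0)
    rw [B.b_apply, shift_zero] at this
    exact this h
  · intro h
    obtain ⟨c, rfl⟩ := Nat.exists_eq_add_of_le h
    rw [add_comm, pow_add, Module.End.mul_apply, B.nil, map_zero]

/-- Both families `y` are the coefficients of the same section with respect to the powers of `z`, so
they agree, and `e p` is the nilpotency order of `x₃` on `y p`. -/
theorem unique {e' : Fin (k + 1) → ℕ} (B : NormalForm P k e) (B' : NormalForm P k e') : e = e' := by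
  have hy : ∀ p, B.y p - B'.y p = 0 := by
    refine B.eq_zero_of_sum_shift_eq_zero (fun p => ?_) ?_
    · refine B.mem_span_zero_of_mem_range (Submodule.sub_mem _ (B.y_mem_ranges p).1
        (B'.y_mem_ranges p).1) ?_
      rw [map_sub]
      exact Submodule.sub_mem _ (B.y_mem_ranges p).2 (B'.y_mem_ranges p).2
    · simp only [map_sub, Finset.sum_sub_distrib]
      rw [← B.sec, ← B'.sec, sub_self]
  funext p
  refine eq_of_forall_ge_iff fun a => ?_
  rw [← B.pow_fib_y_eq_zero_iff, ← B'.pow_fib_y_eq_zero_iff, sub_eq_zero.1 (hy p)]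

theorem card_box : Fintype.card (Box e) = ∑ p, e p := by simp

theorem N01_le (B : NormalForm P k e) (N : Subsheaf P.F) :
    N.N01.restrictScalars ℂ ≤ Submodule.span ℂ (Set.range (translates (chain P.F e B.y))) := by
  rw [← B.b_eq, B.b.span_eq]; exact le_top

theorem linearIndependent_laurent (B : NormalForm P k e) :
    LinearIndependent (LaurentPolynomial ℂ) (chain P.F e B.y) := by
  classical
  -- The coordinates over `ℂ` of `g` times a generator are the coefficients of `g`, so a Laurent
  -- relation is a family of relations over `ℂ`.
  have hrepr : ∀ (g : LaurentPolynomial ℂ) (i j : Box e) (q : ℤ),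
      B.b.repr (g • chain P.F e B.y i) (j, q) = if i = j then g.coeff q else 0 := by
    intro g i j q
    induction g using LaurentPolynomial.induction_on' with
    | add g g' hg hg' =>
      rw [add_smul, map_add, Finsupp.add_apply, hg, hg']
      split_ifs <;> simp
    | C_mul_T n r =>
      have h1 : (LaurentPolynomial.C r * LaurentPolynomial.T n : LaurentPolynomial ℂ)
          • chain P.F e B.y i = r • B.b (i, n) := by
        rw [mul_smul, B.b_eq]
        exact algebraMap_smul (LaurentPolynomial ℂ) r _
      rw [h1, map_smul, B.b.repr_self, Finsupp.smul_apply, Finsupp.single_apply]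
      rw [← LaurentPolynomial.single_eq_C_mul_T, AddMonoidAlgebra.coeff_single,
        Finsupp.single_apply]
      simp only [Prod.mk.injEq, smul_eq_mul]
      split_ifs <;> simp_all
  rw [Fintype.linearIndependent_iff]
  intro g hg i
  ext q
  have h2 := congrArg (fun v => B.b.repr v (i, q)) hg
  simp only [map_sum, Finsupp.coe_finsetSum, Finset.sum_apply, hrepr, map_zero,
    Finsupp.coe_zero, Pi.zero_apply] at h2
  simpa using h2

/-- The basis of a normal form over the Laurent polynomials. -/
def laurentBasis (B : NormalForm P k e) : Module.Basis (Box e) (LaurentPolynomial ℂ) P.F.M01 :=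
  Module.Basis.mk B.linearIndependent_laurent (by
    intro v _
    have hv : v ∈ Submodule.span ℂ (Set.range B.b) := by rw [B.b.span_eq]; trivial
    induction hv using Submodule.span_induction with
    | mem v hv =>
      obtain ⟨x, rfl⟩ := hv
      rw [B.b_eq]
      exact Submodule.smul_mem _ _ (Submodule.subset_span ⟨x.1, rfl⟩)
    | zero => exact Submodule.zero_mem _
    | add a b _ _ ha hb => exact Submodule.add_mem _ (ha trivial) (hb trivial)
    | smul c a _ ha =>
      rw [← algebraMap_smul (LaurentPolynomial ℂ) c a]
      exact Submodule.smul_mem _ _ (ha trivial))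

theorem laurentBasis_apply (B : NormalForm P k e) (i : Box e) : B.laurentBasis i = B.b (i, 0) := by
  rw [laurentBasis, Module.Basis.mk_apply, B.b_eq]
  exact (shift_zero _).symm

theorem isPure (B : NormalForm P k e) : P.F.IsPure where
  injective0 := B.inj0
  injective1 := B.inj1
  torsionFree := by
    have hfree : Module.Free (LaurentPolynomial ℂ) P.F.M01 := Module.Free.of_basis B.laurentBasis
    rw [Module.isTorsionFree_iff_smul_eq_zero]
    intro p a h
    have h1 : Polynomial.toLaurent p • P.F.res0C a = 0 := by
      rw [← P.F.res0C_smul, h, map_zero]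
    rcases smul_eq_zero.1 h1 with h2 | h2
    · exact Or.inl ((map_eq_zero_iff _ Polynomial.toLaurent_injective).1 h2)
    · exact Or.inr ((map_eq_zero_iff _ B.inj0).1 h2)

theorem isCoherentCompact (B : NormalForm P k e) : P.F.IsCoherentCompact := by
  classical
  constructor
  · have h : ∀ i : Box e, ∃ a, P.F.res0C a = B.b (i, 0) := fun i => by
      have : B.b (i, 0) ∈ LinearMap.range P.F.res0C := by
        rw [B.range0]; exact Submodule.subset_span ⟨(i, 0), by simp, rfl⟩
      exact this
    choose g hg using h
    refine ⟨⟨Finset.univ.image g, eq_top_iff.2 fun a _ => ?_⟩⟩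
    have ha : P.F.res0C a ∈ ((Submodule.span (Polynomial ℂ) (Set.range g)).restrictScalars ℂ).map
        P.F.res0C := by
      have h1 : Submodule.span ℂ (B.b '' {x | x.2 ∈ Set.Ici 0}) ≤
          ((Submodule.span (Polynomial ℂ) (Set.range g)).restrictScalars ℂ).map P.F.res0C := by
        rw [Submodule.span_le]
        rintro _ ⟨⟨i, q⟩, hq, rfl⟩
        lift q to ℕ using hq
        refine ⟨(Polynomial.X ^ q : Polynomial ℂ) • g i,
          Submodule.smul_mem _ _ (Submodule.subset_span (Set.mem_range_self i)), ?_⟩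
        rw [P.F.res0C_smul, hg, Polynomial.toLaurent_X_pow, B.b_eq_shift (i, (q : ℤ))]
        rfl
      exact h1 (B.range0 ▸ LinearMap.mem_range_self _ a)
    obtain ⟨a', ha', h2⟩ := ha
    rw [Finset.coe_image, Finset.coe_univ, Set.image_univ, ← B.inj0 h2]
    exact ha'
  -- The local generators of `O(k)` over `U_∞` have exponent `k`, the largest one allowed there.
  · have h : ∀ i : Box e, ∃ a, P.F.res1C a = B.b (i, k) := fun i => by
      have : B.b (i, k) ∈ LinearMap.range P.F.res1C := by
        rw [B.range1]; exact Submodule.subset_span ⟨(i, k), by simp, rfl⟩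
      exact this
    choose g hg using h
    have hpow : ∀ (n : ℕ) a, P.F.res1C ((Polynomial.X ^ n : Polynomial ℂ) • a)
        = shift (-n) (P.F.res1C a) := by
      intro n a
      induction n with
      | zero => simp [shift_zero]
      | succ n ih =>
        rw [pow_succ', mul_smul]
        have := P.F.res1C_base ((Polynomial.X ^ n : Polynomial ℂ) • a)
        rw [ih, shift_shift] at this
        refine this.trans ?_
        congr 2
        push_cast; ring
    refine ⟨⟨Finset.univ.image g, eq_top_iff.2 fun a _ => ?_⟩⟩
    have ha : P.F.res1C a ∈ ((Submodule.span (Polynomial ℂ) (Set.range g)).restrictScalars ℂ).map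
        P.F.res1C := by
      have h1 : Submodule.span ℂ (B.b '' {x | x.2 ∈ Set.Iic (k : ℤ)}) ≤
          ((Submodule.span (Polynomial ℂ) (Set.range g)).restrictScalars ℂ).map P.F.res1C := by
        rw [Submodule.span_le]
        rintro _ ⟨⟨i, q⟩, hq, rfl⟩
        obtain ⟨n, rfl⟩ : ∃ n : ℕ, q = k - n := ⟨(k - q).toNat, by simp at hq; omega⟩
        refine ⟨(Polynomial.X ^ n : Polynomial ℂ) • g i,
          Submodule.smul_mem _ _ (Submodule.subset_span (Set.mem_range_self i)), ?_⟩
        rw [hpow, hg, B.shift_b]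
        rfl
      exact h1 (B.range1 ▸ LinearMap.mem_range_self _ a)
    obtain ⟨a', ha', h2⟩ := ha
    rw [Finset.coe_image, Finset.coe_univ, Set.image_univ, ← B.inj1 h2]
    exact ha'

theorem deg_eq (B : NormalForm P k e) : P.deg = ∑ p, e p := by
  rw [← card_box]
  refine (Subsheaf.whole P.F).deg_eq_of_translates (h := chain P.F e B.y) B.isPure
    B.isCoherentCompact.1 (B.b_eq ▸ B.b.linearIndependent) ?_
  rw [Subsheaf.image0_whole, B.range0, B.b_eq]

theorem chi_eq (B : NormalForm P k e) : P.chi = (∑ p, e p : ℕ) * (k + 1) := by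
  rw [← card_box]
  refine (Subsheaf.whole P.F).chi_eq_of_translates (h := chain P.F e B.y) B.isPure
    (B.b_eq ▸ B.b.linearIndependent) ?_ ?_ (B.N01_le _)
  · rw [Subsheaf.image0_whole, B.range0, B.b_eq]
  · rw [Subsheaf.image1_whole, B.range1, B.b_eq]

end NormalForm

/-! ### Čech computation of `χ_X(F)` and `χ_{ℙ¹}(π_* F, π_* F ⊗ L)` -/

namespace NormalForm

variable {P : SheafPair} {k : ℕ} {e : Fin (k + 1) → ℕ} (B : NormalForm P k e)
  (E : EquivariantStructure P)

theorem map_G0 (μ : Character) : (E.G0 μ).map P.F.res0C =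
    Submodule.span ℂ (B.b '' {x | boxWeight x = μ ∧ 0 ≤ x.2}) := by
  rw [B.G0_eq, B.G01_eq, Submodule.map_comap_eq, B.range0, weightSpan,
    span_image_inf_span_image B.b.linearIndependent, Set.inter_comm]
  rfl

theorem map_G1 (μ : Character) : (E.G1 μ).map P.F.res1C =
    Submodule.span ℂ (B.b '' {x | boxWeight x = μ ∧ x.2 ≤ k}) := by
  rw [B.G1_eq, B.G01_eq, Submodule.map_comap_eq, B.range1, weightSpan,
    span_image_inf_span_image B.b.linearIndependent, Set.inter_comm]
  rfl

theorem chiX_eq (B : NormalForm P k e) (E : EquivariantStructure P) (μ : Character) : E.chiX μ =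
    ((Finset.univ ×ˢ Finset.Icc (0 : ℤ) k).filter
      fun x : Box e × ℤ => boxWeight x = μ).card := by
  rw [EquivariantStructure.chiX, twoTermEuler_prod_eq P.F.cech_apply
    (fun a _ h => B.inj0 (h.trans (map_zero _).symm))
    (fun a _ h => B.inj1 (h.trans (map_zero _).symm)), B.map_G0, B.map_G1,
    span_image_inf_span_image B.b.linearIndependent, finrank_span_image B.b.linearIndependent]
  · rw [← Set.ncard_coe_finset]
    congr 2
    ext x
    simp
    tauto
  · rw [B.map_G0, B.map_G1, B.G01_eq, weightSpan, ← Submodule.span_union, ← Set.image_union]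
    refine Submodule.span_mono (Set.image_mono fun x hx => ?_)
    rcases le_total 0 x.2 with h | h
    · exact Or.inl ⟨hx, h⟩
    · exact Or.inr ⟨hx, by omega⟩

section Hom

open EquivariantStructure

variable (ν μ : Character)

theorem mem_span_and {p q : Box e × ℤ → Prop} {v : P.F.M01} :
    v ∈ Submodule.span ℂ (B.b '' {x | p x ∧ q x}) ↔
      v ∈ Submodule.span ℂ (B.b '' {x | p x}) ∧ v ∈ Submodule.span ℂ (B.b '' {x | q x}) := by
  rw [← Submodule.mem_inf, span_image_inf_span_image B.b.linearIndependent]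
  rfl

theorem end01_shift (φ : End01 P.F) (q : ℤ) (v : P.F.M01) : φ (shift q v) = shift q (φ v) :=
  φ.map_smul _ v

theorem end01_mem (φ : End01 P.F) {S : Set (Box e × ℤ)} {N : Submodule ℂ P.F.M01}
    (h : ∀ x ∈ S, φ (B.b x) ∈ N) {v : P.F.M01} (hv : v ∈ Submodule.span ℂ (B.b '' S)) :
    φ v ∈ N := by
  induction hv using Submodule.span_induction with
  | mem v hv => obtain ⟨x, hx, rfl⟩ := hv; exact h x hx
  | zero => rw [map_zero]; exact N.zero_mem
  | add a b _ _ ha hb => rw [map_add]; exact N.add_mem ha hb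
  | smul c a _ ha =>
    rw [← algebraMap_smul (LaurentPolynomial ℂ) c a, map_smul, algebraMap_smul]
    exact N.smul_mem c ha

theorem shift_mem_span_weight {q : ℤ} {χ χ' : Character} (h : χ' = χ + q • tchar 0) {v : P.F.M01}
    (hv : v ∈ Submodule.span ℂ (B.b '' {x | boxWeight x = χ})) :
    shift q v ∈ Submodule.span ℂ (B.b '' {x | boxWeight x = χ'}) := by
  subst h; exact B.shift_mem_weightSpan q hv

theorem boxWeight_shift (i : Box e) (q : ℤ) :
    boxWeight (i, q) = boxWeight (i, 0) + q • tchar 0 := by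
  rw [boxWeight, boxWeight, ← weight_add_base, zero_add]

/-- An endomorphism over the Laurent polynomials commutes with powers of `z`, so its degree can be
tested on the generators with exponent `0`. -/
theorem mem_homDeg_iff (φ : End01 P.F) : φ ∈ homDeg E.G01 (μ - ν) ↔
    ∀ i, φ (B.b (i, 0)) ∈
      Submodule.span ℂ (B.b '' {x | boxWeight x = boxWeight (i, 0) + (μ - ν)}) := by
  constructor
  · intro h i
    have := h _ _ (B.b_mem_G01 E (i, 0))
    rwa [B.G01_eq] at this
  · intro h χ v hv
    rw [B.G01_eq] at hv ⊢
    refine B.end01_mem φ ?_ hv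
    rintro ⟨i, q⟩ hx
    rw [B.b_eq_shift, end01_shift]
    refine B.shift_mem_span_weight ?_ (h i)
    rw [← show boxWeight (i, q) = χ from hx, boxWeight_shift]
    abel

/-- Being regular over `U₀` means that the matrix entries contain no negative powers of `z`. The
chart endomorphism is recovered from `φ` because restriction is injective. -/
theorem mem_map_hom0_iff (φ : End01 P.F) :
    φ ∈ (E.hom0 ν μ).map (LinearMap.snd ℂ (End0 P.F) (End01 P.F)) ↔
    ∀ i, φ (B.b (i, 0)) ∈ Submodule.span ℂ
      (B.b '' {x | boxWeight x = boxWeight (i, 0) + (μ - ν) ∧ 0 ≤ x.2}) := by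
  simp only [B.mem_span_and]
  constructor
  · rintro ⟨⟨φ0, φ1⟩, ⟨-, h1, h2⟩, rfl⟩ i
    refine ⟨(B.mem_homDeg_iff E ν μ _).1 h1 i, ?_⟩
    have h3 : B.b (i, 0) ∈ LinearMap.range P.F.res0C := by
      rw [B.range0]; exact Submodule.subset_span ⟨(i, 0), by simp, rfl⟩
    obtain ⟨a, ha⟩ := h3
    rw [← ha]
    change φ1 (P.F.res0C a) ∈ _
    rw [show φ1 (P.F.res0C a) = P.F.res0C (φ0 a) from h2 a]
    exact B.range0 ▸ LinearMap.mem_range_self _ _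
  · intro h
    have hdeg := (B.mem_homDeg_iff E ν μ φ).2 fun i => (h i).1
    have hr : ∀ a, φ (P.F.res0C a) ∈ LinearMap.range P.F.res0C := by
      intro a
      have ha : P.F.res0C a ∈ Submodule.span ℂ (B.b '' {x | x.2 ∈ Set.Ici 0}) :=
        B.range0 ▸ LinearMap.mem_range_self _ _
      refine B.end01_mem φ ?_ ha
      rintro ⟨i, q⟩ hq
      rw [B.b_eq_shift, end01_shift, B.range0]
      refine B.shift_mem_span_b q (S := Set.Ici 0) ?_ (h i).2
      intro q' hq'
      simp at hq hq' ⊢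
      omega
    choose g hg using hr
    refine ⟨(⟨⟨g, fun a b => B.inj0 ?_⟩, fun p a => B.inj0 ?_⟩, φ),
      ⟨?_, hdeg, fun a => (hg a).symm⟩,
      rfl⟩
    · rw [map_add, hg, hg, hg, map_add, map_add]
    · rw [hg, P.F.res0C_smul, map_smul, RingHom.id_apply, P.F.res0C_smul, hg]
    · intro χ a ha
      rw [B.G0_eq] at ha ⊢
      rw [Submodule.mem_comap]
      change P.F.res0C (g a) ∈ E.G01 (χ + (μ - ν))
      rw [hg]
      exact hdeg χ _ ha

theorem res1C_smul (p : Polynomial ℂ) (b : P.F.M1) :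
    P.F.res1C (p • b) = LaurentPolynomial.invert (Polynomial.toLaurent p) • P.F.res1C b := by
  change P.F.res1 ((MvPolynomial.C p : ChartRing) • b) = _
  have : rho1 (MvPolynomial.C p)
      = MvPolynomial.C (LaurentPolynomial.invert (Polynomial.toLaurent p)) :=
    MvPolynomial.eval₂Hom_C _ _ _
  rw [P.F.res1.map_smulₛₗ, this]; rfl

/-- The `k` of the source cancels against that of the target: regularity over `U_∞` bounds the
exponents of the matrix entries by `-l`, the bound for sections of `O(-l Z_∞)` written in terms of
`e₀`. -/
theorem mem_map_hom1_iff (l : ℤ) (φ : End01 P.F) :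
    φ ∈ (E.hom1 l ν μ).map (LinearMap.snd ℂ (End1 P.F) (End01 P.F)) ↔
    ∀ i, φ (B.b (i, 0)) ∈ Submodule.span ℂ
      (B.b '' {x | boxWeight x = boxWeight (i, 0) + (μ - ν) ∧ x.2 ≤ -l}) := by
  simp only [B.mem_span_and]
  constructor
  · rintro ⟨⟨φ0, φ1⟩, ⟨-, h1, h2⟩, rfl⟩ i
    refine ⟨(B.mem_homDeg_iff E ν μ _).1 h1 i, ?_⟩
    have h3 : B.b (i, k) ∈ LinearMap.range P.F.res1C := by
      rw [B.range1]; exact Submodule.subset_span ⟨(i, k), by simp, rfl⟩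
    obtain ⟨a, ha⟩ := h3
    have h4 : B.b (i, 0) = shift (-k) (P.F.res1C a) := by
      rw [ha, B.shift_b, add_neg_cancel]
    rw [h4]
    change φ1 (shift (-k) (P.F.res1C a)) ∈ _
    rw [end01_shift, show φ1 (P.F.res1C a) = shift (-l) (P.F.res1C (φ0 a)) from h2 a, shift_shift]
    have h5 : P.F.res1C (φ0 a) ∈ Submodule.span ℂ (B.b '' {x | x.2 ∈ Set.Iic (k : ℤ)}) :=
      B.range1 ▸ LinearMap.mem_range_self _ _
    exact B.shift_mem_span_b _ (S' := Set.Iic (-l)) (by simp; omega) h5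
  · intro h
    have hdeg := (B.mem_homDeg_iff E ν μ φ).2 fun i => (h i).1
    have hr : ∀ a, shift l (φ (P.F.res1C a)) ∈ LinearMap.range P.F.res1C := by
      intro a
      have ha : P.F.res1C a ∈ Submodule.span ℂ (B.b '' {x | x.2 ∈ Set.Iic (k : ℤ)}) :=
        B.range1 ▸ LinearMap.mem_range_self _ _
      refine Submodule.mem_comap.1 (B.end01_mem φ (N := (LinearMap.range P.F.res1C).comap (shift l))
        ?_ ha)
      rintro ⟨i, q⟩ hq
      rw [Submodule.mem_comap, B.b_eq_shift, end01_shift, B.range1, shift_shift]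
      refine B.shift_mem_span_b _ (S := Set.Iic (-l)) ?_ (h i).2
      intro q' hq'
      simp at hq hq' ⊢
      omega
    choose g hg using hr
    refine ⟨(⟨⟨g, fun a b => B.inj1 ?_⟩, fun p a => B.inj1 ?_⟩, φ), ⟨?_, hdeg, fun a => ?_⟩, rfl⟩
    · rw [map_add, hg, hg, hg, map_add, map_add, map_add]
    · rw [hg, res1C_smul, map_smul, RingHom.id_apply, res1C_smul, hg]
      exact smul_comm _ _ _
    · intro χ a ha
      rw [B.G1_eq] at ha ⊢
      rw [Submodule.mem_comap]
      change P.F.res1C (g a) ∈ E.G01 (χ + (μ - ν + l • tchar 0))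
      rw [hg]
      have := E.base01 l _ _ (hdeg χ _ ha)
      rwa [add_assoc] at this
    · change φ (P.F.res1C a) = shift (-l) (P.F.res1C (g a))
      rw [hg, shift_shift, neg_add_cancel, shift_zero]

theorem finite_boxWeight (S : Set ℤ) (hS : S.Finite) (χ : Character) :
    {x : Box e × ℤ | boxWeight x = χ ∧ x.2 ∈ S}.Finite :=
  (Set.Finite.prod Set.finite_univ hS).subset fun _ hx => ⟨trivial, hx.2⟩

/-- `Hom(π_* F, π_* F ⊗ L)` is a sum of copies of `O(-l)`, one for each matrix entry. For `l ≤ 1`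
its `H¹` vanishes, and `H⁰` consists of the entries with exponents from `0` to `-l`. -/
theorem chiP1_eq_sum (B : NormalForm P k e) (E : EquivariantStructure P)
    (ν μ : Character) (l : ℤ) (hl : l ≤ 1) : E.chiP1 l ν μ =
    ∑ i : Box e, ({x : Box e × ℤ | boxWeight x = boxWeight (i, 0) + (μ - ν) ∧
      x.2 ∈ Set.Icc 0 (-l)}.ncard : ℤ) := by
  rw [EquivariantStructure.chiP1, twoTermEuler_prod_eq
    (f₀ := LinearMap.snd ℂ (End0 P.F) (End01 P.F)) (f₁ := LinearMap.snd ℂ (End1 P.F) (End01 P.F))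
    (fun a b => rfl)]
  · let T : Box e → Submodule ℂ P.F.M01 := fun i => Submodule.span ℂ
      (B.b '' {x | boxWeight x = boxWeight (i, 0) + (μ - ν) ∧ x.2 ∈ Set.Icc 0 (-l)})
    -- Endomorphisms of a free module are arbitrary families of values on a basis, so the dimension
    -- splits as a sum over the generators.
    let Φ : (Box e → P.F.M01) ≃ₗ[ℂ] End01 P.F := B.laurentBasis.constr ℂ
    have hΦ : ∀ m i, Φ m (B.b (i, 0)) = m i := fun m i => by
      rw [← B.laurentBasis_apply]; exact Module.Basis.constr_basis _ _ _ _
    have hT : (Submodule.map (LinearMap.snd ℂ (End0 P.F) (End01 P.F)) (E.hom0 ν μ) ⊓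
        Submodule.map (LinearMap.snd ℂ (End1 P.F) (End01 P.F)) (E.hom1 l ν μ)) =
        (Submodule.pi Set.univ T).map Φ.toLinearMap := by
      ext φ
      obtain ⟨m, rfl⟩ := Φ.surjective φ
      rw [Submodule.mem_inf, B.mem_map_hom0_iff, B.mem_map_hom1_iff, show Φ m ∈ Submodule.map
        Φ.toLinearMap (Submodule.pi Set.univ T) ↔ m ∈ Submodule.pi Set.univ T from
          ⟨fun ⟨m', h, h'⟩ => Φ.injective h' ▸ h, fun h => ⟨m, h, rfl⟩⟩]
      simp only [hΦ, Submodule.mem_pi, Set.mem_univ, true_implies, T,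
        Set.mem_Icc, B.mem_span_and]
      rw [← forall_and]
      refine forall_congr' fun i => ?_
      tauto
    have hfin : ∀ i, FiniteDimensional ℂ (T i) := fun i => by
      have := (finite_boxWeight (e := e) (Set.Icc 0 (-l)) (Set.finite_Icc _ _)
        (boxWeight (i, 0) + (μ - ν))).image B.b
      exact FiniteDimensional.span_of_finite ℂ this
    let Ψ : Submodule.pi Set.univ T ≃ₗ[ℂ] (∀ i, T i) :=
      { toFun := fun m i => ⟨m.1 i, m.2 i trivial⟩
        invFun := fun m => ⟨fun i => m i, fun i _ => (m i).2⟩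
        map_add' := fun _ _ => rfl
        map_smul' := fun _ _ => rfl
        left_inv := fun _ => rfl
        right_inv := fun _ => rfl }
    rw [hT, (Submodule.equivMapOfInjective Φ.toLinearMap Φ.injective _).symm.finrank_eq,
      Ψ.finrank_eq, Module.finrank_pi_fintype, Nat.cast_sum]
    exact Finset.sum_congr rfl fun i _ => by rw [finrank_span_image B.b.linearIndependent]
  · rintro ⟨φ0, φ1⟩ ⟨-, -, h⟩ rfl
    refine Prod.ext (LinearMap.ext fun a => B.inj0 ?_) rfl
    rw [← h a]; simp
  · rintro ⟨φ0, φ1⟩ ⟨-, -, h⟩ rfl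
    refine Prod.ext (LinearMap.ext fun a => B.inj1 (shift_injective (-l) ?_)) rfl
    refine (h a).symm.trans ?_
    simp
  · intro φ hφ
    rw [B.mem_homDeg_iff] at hφ
    have hsplit : ∀ i, ∃ u v, u ∈ Submodule.span ℂ
        (B.b '' {x | boxWeight x = boxWeight (i, 0) + (μ - ν) ∧ 0 ≤ x.2}) ∧ v ∈ Submodule.span ℂ
        (B.b '' {x | boxWeight x = boxWeight (i, 0) + (μ - ν) ∧ x.2 ≤ -l}) ∧
        φ (B.b (i, 0)) = u + v := by
      intro i
      have h1 : φ (B.b (i, 0)) ∈ Submodule.span ℂ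
        (B.b '' {x | boxWeight x = boxWeight (i, 0) + (μ - ν) ∧ 0 ≤ x.2}) ⊔ Submodule.span ℂ
        (B.b '' {x | boxWeight x = boxWeight (i, 0) + (μ - ν) ∧ x.2 ≤ -l}) := by
        rw [← Submodule.span_union, ← Set.image_union]
        refine Submodule.span_mono (Set.image_mono fun x hx => ?_) (hφ i)
        rcases le_or_gt 0 x.2 with h | h
        · exact Or.inl ⟨hx, h⟩
        -- The only place where `l ≤ 1` enters: a negative exponent is at most `-1 ≤ -l`, which
        -- leaves no gap and gives `H¹ = 0`.
        · exact Or.inr ⟨hx, by omega⟩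
      obtain ⟨u, hu, v, hv, huv⟩ := Submodule.mem_sup.1 h1
      exact ⟨u, v, hu, hv, huv.symm⟩
    choose u v hu hv huv using hsplit
    let Φ : (Box e → P.F.M01) ≃ₗ[ℂ] End01 P.F := B.laurentBasis.constr ℂ
    have hΦ : ∀ m i, Φ m (B.b (i, 0)) = m i := fun m i => by
      rw [← B.laurentBasis_apply]; exact Module.Basis.constr_basis _ _ _ _
    refine Submodule.mem_sup.2 ⟨Φ u, ?_, Φ v, ?_, ?_⟩
    · rw [B.mem_map_hom0_iff]; intro i; rw [hΦ]; exact hu i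
    · rw [B.mem_map_hom1_iff]; intro i; rw [hΦ]; exact hv i
    · refine B.laurentBasis.ext fun i => ?_
      rw [laurentBasis_apply, LinearMap.add_apply, hΦ, hΦ, huv]

/-- `O(-1)` has no cohomology, so the two summands of `χ_Y` that involve the factor `O(-Z_∞)`
disappear. -/
theorem chiP1_one (B : NormalForm P k e) (E : EquivariantStructure P)
    (ν μ : Character) : E.chiP1 1 ν μ = 0 := by
  rw [B.chiP1_eq_sum E ν μ 1 le_rfl]
  simp

theorem chiP1_zero (B : NormalForm P k e) (E : EquivariantStructure P)
    (ν μ : Character) : E.chiP1 0 ν μ = ∑ i : Box e, ∑ j : Box e,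
    if boxWeight (j, 0) - boxWeight (i, 0) + ν = μ then 1 else 0 := by
  rw [B.chiP1_eq_sum E ν μ 0 (by norm_num)]
  refine Finset.sum_congr rfl fun i _ => ?_
  rw [Finset.sum_boole]
  have : {x : Box e × ℤ | boxWeight x = boxWeight (i, 0) + (μ - ν) ∧ x.2 ∈ Set.Icc 0 (-0)} =
      (Finset.univ.filter fun j : Box e => boxWeight (j, 0) - boxWeight (i, 0) + ν = μ).map
        ⟨fun j => (j, (0 : ℤ)), fun _ _ h => congrArg Prod.fst h⟩ := by
    ext ⟨j, q⟩
    simp only [Set.mem_ofPred_eq, Finset.coe_map, Set.mem_image, Finset.mem_coe, Finset.mem_filter,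
      Finset.mem_univ, true_and, Set.mem_Icc]
    constructor
    · rintro ⟨h, h1, h2⟩
      obtain rfl : q = 0 := by omega
      exact ⟨j, by rw [h]; abel, rfl⟩
    · rintro ⟨j, h, hj⟩
      obtain ⟨rfl, rfl⟩ := Prod.mk.inj hj
      exact ⟨by rw [← h]; abel, le_rfl, by simp⟩
  rw [this, Set.ncard_coe_finset, Finset.card_map]

end Hom

end NormalForm

/-! ### Products -/

section Products

variable {K : Type*} [Field K]

theorem prod_Icc_one (n : ℕ) (f : ℕ → K) :
    ∏ c ∈ Finset.Icc 1 n, f c = ∏ c ∈ Finset.range n, f (c + 1) := by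
  rw [← Finset.Ico_add_one_right_eq_Icc, Finset.prod_Ico_eq_prod_range]
  simp [add_comm]

/-- Both sides are, up to sign, the product of `v + s` over `-n ≤ s ≤ m`. -/
theorem prod_shift_mul_prod_shift (v : K) (m n : ℕ) :
    (∏ a ∈ Finset.range m, (v + (a - n))) * (∏ a ∈ Finset.range n, (-v + (a - m))) * (v + (m - n)) =
      v * (∏ c ∈ Finset.Icc 1 m, (c + v)) * ∏ c ∈ Finset.Icc 1 n, (c - v) := by
  set f : ℕ → K := fun t => v - n + t with hf
  have h1 : ∏ t ∈ Finset.range (m + 1 + n), f t =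
      (∏ a ∈ Finset.range m, f a) * f m * ∏ a ∈ Finset.range n, f (m + 1 + a) := by
    rw [Finset.prod_range_add, Finset.prod_range_succ]
  have h2 : ∏ t ∈ Finset.range (n + 1 + m), f t =
      (∏ a ∈ Finset.range n, f a) * f n * ∏ a ∈ Finset.range m, f (n + 1 + a) := by
    rw [Finset.prod_range_add, Finset.prod_range_succ]
  have h3 : ∏ a ∈ Finset.range m, (v + (a - n)) = ∏ a ∈ Finset.range m, f a :=
    Finset.prod_congr rfl fun a _ => by rw [hf]; ring
  have h4 : ∏ a ∈ Finset.range n, (-v + (a - m)) =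
      (-1) ^ n * ∏ a ∈ Finset.range n, f (m + 1 + a) := by
    rw [← Finset.prod_range_reflect]
    have : (-1 : K) ^ n = ∏ _a ∈ Finset.range n, (-1 : K) := by simp
    rw [this, ← Finset.prod_mul_distrib]
    refine Finset.prod_congr rfl fun a ha => ?_
    have h5 : ((n - 1 - a : ℕ) : K) = n - 1 - a := by
      have := Finset.mem_range.1 ha
      rw [Nat.cast_sub (by omega), Nat.cast_sub (by omega), Nat.cast_one]
    rw [h5, hf]; push_cast; ring
  have h5 : ∏ c ∈ Finset.Icc 1 n, ((c : K) - v) = (-1) ^ n * ∏ a ∈ Finset.range n, f a := by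
    rw [prod_Icc_one n (fun c => (c : K) - v), ← Finset.prod_range_reflect]
    have : (-1 : K) ^ n = ∏ _a ∈ Finset.range n, (-1 : K) := by simp
    rw [this, ← Finset.prod_mul_distrib]
    refine Finset.prod_congr rfl fun a ha => ?_
    have h5 : ((n - 1 - a : ℕ) : K) = n - 1 - a := by
      have := Finset.mem_range.1 ha
      rw [Nat.cast_sub (by omega), Nat.cast_sub (by omega), Nat.cast_one]
    rw [hf]; push_cast [h5]; ring
  have h6 : ∏ c ∈ Finset.Icc 1 m, ((c : K) + v) = ∏ a ∈ Finset.range m, f (n + 1 + a) := by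
    rw [prod_Icc_one m (fun c => (c : K) + v)]
    refine Finset.prod_congr rfl fun a _ => ?_
    rw [hf]; push_cast; ring
  have h7 : f m = v + (m - n) := by rw [hf]; ring
  have h8 : f n = v := by rw [hf]; ring
  rw [show n + 1 + m = m + 1 + n by ring, h1, h7, h8] at h2
  rw [h3, h4, h5, h6]
  linear_combination (-1) ^ n * h2

theorem prod_range_sub_self (n : ℕ) :
    ∏ a ∈ Finset.range n, ((a : K) - n) = (-1) ^ n * n.factorial := by
  rw [← Finset.prod_range_reflect, ← Finset.prod_range_add_one_eq_factorial, Nat.cast_prod]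
  have : (-1 : K) ^ n = ∏ _a ∈ Finset.range n, (-1 : K) := by simp
  rw [this, ← Finset.prod_mul_distrib]
  refine Finset.prod_congr rfl fun a ha => ?_
  have := Finset.mem_range.1 ha
  rw [Nat.cast_sub (by omega), Nat.cast_sub (by omega)]
  push_cast; ring

theorem prod_Ioi_sub {k : ℕ} (i : Fin (k + 1)) (f : ℕ → K) :
    ∏ j ∈ Finset.Ioi i, f (j - i) = ∏ b ∈ Finset.Icc 1 (k - i), f b := by
  refine Finset.prod_bij (fun j _ => (j : ℕ) - i) ?_ ?_ ?_ (fun _ _ => rfl)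
  · intro j hj
    have := Fin.lt_def.1 (Finset.mem_Ioi.1 hj)
    rw [Finset.mem_Icc]; omega
  · intro j hj j' hj' h
    have := Fin.lt_def.1 (Finset.mem_Ioi.1 hj)
    have := Fin.lt_def.1 (Finset.mem_Ioi.1 hj')
    ext; omega
  · intro b hb
    rw [Finset.mem_Icc] at hb
    exact ⟨⟨b + i, by omega⟩, by rw [Finset.mem_Ioi, Fin.lt_def]; simp; omega, by simp⟩

theorem prod_Iio_sub {k : ℕ} (j : Fin (k + 1)) (f : ℕ → K) :
    ∏ i ∈ Finset.Iio j, f (j - i) = ∏ b ∈ Finset.Icc 1 (j : ℕ), f b := by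
  refine Finset.prod_bij (fun i _ => (j : ℕ) - i) ?_ ?_ ?_ (fun _ _ => rfl)
  · intro i hi
    have := Fin.lt_def.1 (Finset.mem_Iio.1 hi)
    rw [Finset.mem_Icc]; omega
  · intro i hi i' hi' h
    have := Fin.lt_def.1 (Finset.mem_Iio.1 hi)
    have := Fin.lt_def.1 (Finset.mem_Iio.1 hi')
    ext; omega
  · intro b hb
    rw [Finset.mem_Icc] at hb
    refine ⟨⟨j - b, by omega⟩, ?_, ?_⟩
    · rw [Finset.mem_Iio, Fin.lt_def]
      change (j : ℕ) - b < j
      omega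
    · change (j : ℕ) - (j - b) = b
      omega

theorem prod_Ioi_comm {k : ℕ} (f : Fin (k + 1) → Fin (k + 1) → K) :
    ∏ i, ∏ j ∈ Finset.Ioi i, f i j = ∏ j, ∏ i ∈ Finset.Iio j, f i j :=
  Finset.prod_comm' fun i j => by simp

theorem prod_prod_eq_diag_mul {k : ℕ} (f : Fin (k + 1) → Fin (k + 1) → K) :
    ∏ i, ∏ j, f i j = (∏ i, f i i) * ∏ i, ∏ j ∈ Finset.Ioi i, (f i j * f j i) := by
  have h : ∀ i : Fin (k + 1), ∏ j, f i j =
      f i i * ((∏ j ∈ Finset.Ioi i, f i j) * ∏ j ∈ Finset.Iio i, f i j) := by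
    intro i
    rw [← Finset.mul_prod_erase _ _ (Finset.mem_univ i)]
    congr 1
    rw [← Finset.prod_union]
    · refine Finset.prod_congr ?_ fun _ _ => rfl
      ext j
      simp only [Finset.mem_erase, Finset.mem_univ, and_true, Finset.mem_union, Finset.mem_Ioi,
        Finset.mem_Iio]
      exact ⟨fun h => (lt_or_gt_of_ne h).symm, fun h => h.elim ne_of_gt ne_of_lt⟩
    · rw [Finset.disjoint_left]
      intro j hj hj'
      exact lt_asymm (Finset.mem_Ioi.1 hj) (Finset.mem_Iio.1 hj')
  simp only [h, Finset.prod_mul_distrib]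
  rw [prod_Ioi_comm fun i j => f j i]

/-- For fixed `j` the differences `j - i` run through `1, …, j` and give `j!`. This is the source of
the prefactor `1! 2! ⋯ k!`. -/
theorem prod_Ioi_natCast {k : ℕ} : ∏ i : Fin (k + 1), ∏ j ∈ Finset.Ioi i, (((j - i : ℕ) : ℕ) : K) =
    ∏ i ∈ Finset.Icc 1 k, (i.factorial : K) := by
  rw [prod_Ioi_comm]
  have h : ∀ j : Fin (k + 1), ∏ i ∈ Finset.Iio j, (((j - i : ℕ) : ℕ) : K) =
      ((j : ℕ).factorial : K) := by
    intro j
    rw [prod_Iio_sub j (fun b => (b : K)), prod_Icc_one, ← Finset.prod_range_add_one_eq_factorial,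
      Nat.cast_prod]
  simp only [h]
  rw [Fin.prod_univ_eq_prod_range (fun j => (j.factorial : K)), Finset.prod_range_succ',
    prod_Icc_one]
  simp

/-- The product over all pairs of columns, in terms of the factors in the closed formula. -/
theorem prod_pairs {k : ℕ} (e : Fin (k + 1) → ℕ) (u : K)
    (hu : ∀ a b : ℤ, a ≠ 0 ∨ b ≠ 0 → (a : K) + b * u ≠ 0) :
    (-1) ^ (∑ i, e i) * ∏ i : Fin (k + 1), ∏ j : Fin (k + 1), ∏ a ∈ Finset.range (e i),
        ((((j : ℕ) : K) - ((i : ℕ) : K)) * u + ((a : K) - e j))⁻¹ =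
      (∏ i ∈ Finset.Icc 1 k, (i.factorial : K))⁻¹ * ((1 / ∏ i, ((e i).factorial : K)) *
        (∏ i : Fin (k + 1), ∏ j ∈ Finset.Ioi i,
          ((((j : ℕ) : K) - ((i : ℕ) : K)) + ((e i : K) - (e j : K)) * u⁻¹)) *
        ∏ i : Fin (k + 1), ((∏ a ∈ Finset.Icc 1 (e i), ∏ b ∈ Finset.Icc 1 (k - (i : ℕ)),
            1 / ((a : K) + (b : K) * u)) *
          (∏ a ∈ Finset.Icc 1 (e i), ∏ b ∈ Finset.Icc 1 (i : ℕ),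
            1 / ((a : K) - (b : K) * u)))) := by
  have hu0 : u ≠ 0 := by simpa using hu 0 1 (by simp)
  have hchar : ∀ n : ℕ, n ≠ 0 → (n : K) ≠ 0 := fun n hn => by
    simpa using hu n 0 (Or.inl (by exact_mod_cast hn))
  -- The diagonal contributes the factorials `e_i!`, each with a sign `(-1) ^ e_i`.
  have hdiag : ∀ i : Fin (k + 1), ∏ a ∈ Finset.range (e i),
      ((((i : ℕ) : K) - ((i : ℕ) : K)) * u + ((a : K) - e i))⁻¹ =
      (-1) ^ e i * ((e i).factorial : K)⁻¹ := by
    intro i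
    simp only [sub_self, zero_mul, zero_add]
    rw [Finset.prod_inv_distrib, prod_range_sub_self, mul_inv, ← inv_pow, inv_neg_one]
  -- For `i < j` apply `prod_shift_mul_prod_shift` with `v = (j - i) u`. The quotient `(v + e_i -
  -- e_j) / v` becomes the factor with `u⁻¹` divided by `j - i`; the rest gives the two products
  -- over `a`.
  have hpair : ∀ i : Fin (k + 1), ∀ j ∈ Finset.Ioi i,
      (∏ a ∈ Finset.range (e i), ((((j : ℕ) : K) - ((i : ℕ) : K)) * u + ((a : K) - e j))⁻¹) *
      (∏ a ∈ Finset.range (e j), ((((i : ℕ) : K) - ((j : ℕ) : K)) * u + ((a : K) - e i))⁻¹) =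
      ((((j - i : ℕ) : ℕ) : K))⁻¹ *
      ((((j : ℕ) : K) - ((i : ℕ) : K)) + ((e i : K) - (e j : K)) * u⁻¹) *
      (∏ a ∈ Finset.Icc 1 (e i), 1 / ((a : K) + (((j - i : ℕ) : ℕ) : K) * u)) *
      (∏ a ∈ Finset.Icc 1 (e j), 1 / ((a : K) - (((j - i : ℕ) : ℕ) : K) * u)) := by
    intro i j hij
    have hlt := Fin.lt_def.1 (Finset.mem_Ioi.1 hij)
    have hsub : (((j - i : ℕ) : ℕ) : K) =
      ((j : ℕ) : K) - ((i : ℕ) : K) := Nat.cast_sub hlt.le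
    have hb : (((j - i : ℕ) : ℕ) : K) ≠ 0 := hchar _ (by omega)
    rw [← hsub, show ((i : ℕ) : K) - ((j : ℕ) : K) = -(((j - i : ℕ) : ℕ) : K) by rw [hsub]; ring]
    have hb0 : (((j - i : ℕ) : ℕ) : ℤ) ≠ 0 := by omega
    generalize ((j - i : ℕ) : ℕ) = b at hb hb0 ⊢
    have key := prod_shift_mul_prod_shift ((b : K) * u) (e i) (e j)
    have hn : ∀ s : ℤ, (b : K) * u + s ≠ 0 := fun s => by
      rw [add_comm]; exact_mod_cast hu s b (Or.inr hb0)
    have h1 : ∏ a ∈ Finset.range (e i), ((b : K) * u + (a - e j)) ≠ 0 :=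
      Finset.prod_ne_zero_iff.2 fun a _ => by exact_mod_cast hn (a - e j)
    have h2 : ∏ a ∈ Finset.range (e j), (-((b : K) * u) + (a - e i)) ≠ 0 :=
      Finset.prod_ne_zero_iff.2 fun a _ h => hn (e i - a) (by push_cast; linear_combination -h)
    have h3 : ∏ c ∈ Finset.Icc 1 (e i), ((c : K) + b * u) ≠ 0 :=
      Finset.prod_ne_zero_iff.2 fun a _ h => hn a (by push_cast; linear_combination h)
    have h4 : ∏ c ∈ Finset.Icc 1 (e j), ((c : K) - b * u) ≠ 0 :=
      Finset.prod_ne_zero_iff.2 fun a _ h => hn (-a) (by push_cast; linear_combination -h)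
    simp only [one_div, Finset.prod_inv_distrib, neg_mul]
    rw [← mul_inv, inv_mul_eq_div, div_mul_eq_mul_div, ← div_eq_mul_inv, ← div_eq_mul_inv,
      inv_eq_one_div]
    rw [div_div, div_div, div_eq_div_iff (mul_ne_zero h1 h2)
      (mul_ne_zero h3 (mul_ne_zero hb h4))]
    have h5 : ((b : K) + ((e i : K) - e j) * u⁻¹) * u = b * u + (e i - e j) := by
      rw [add_mul, inv_mul_cancel_right₀ hu0]
    apply mul_right_cancel₀ hu0
    linear_combination -key + (-(∏ a ∈ Finset.range (e i), ((b : K) * u + (a - e j))) *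
      (∏ a ∈ Finset.range (e j), (-((b : K) * u) + (a - e i)))) * h5
  rw [prod_prod_eq_diag_mul, Finset.prod_congr rfl fun i _ => hdiag i,
    Finset.prod_congr rfl fun i _ => Finset.prod_congr rfl (hpair i)]
  simp only [Finset.prod_mul_distrib, Finset.prod_inv_distrib]
  rw [prod_Ioi_natCast, Finset.prod_pow_eq_pow_sum]
  have e1 : ∏ i : Fin (k + 1), ∏ j ∈ Finset.Ioi i,
      ∏ a ∈ Finset.Icc 1 (e i), 1 / ((a : K) + (((j - i : ℕ) : ℕ) : K) * u) =
      ∏ i : Fin (k + 1), ∏ a ∈ Finset.Icc 1 (e i), ∏ b ∈ Finset.Icc 1 (k - (i : ℕ)),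
            1 / ((a : K) + (b : K) * u) := by
    refine Finset.prod_congr rfl fun i _ => ?_
    rw [Finset.prod_comm]
    exact Finset.prod_congr rfl fun a _ => prod_Ioi_sub i fun b => 1 / ((a : K) + (b : K) * u)
  have e2 : ∏ i : Fin (k + 1), ∏ j ∈ Finset.Ioi i,
      ∏ a ∈ Finset.Icc 1 (e j), 1 / ((a : K) - (((j - i : ℕ) : ℕ) : K) * u) =
      ∏ i : Fin (k + 1), ∏ a ∈ Finset.Icc 1 (e i), ∏ b ∈ Finset.Icc 1 (i : ℕ),
            1 / ((a : K) - (b : K) * u) := by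
    rw [prod_Ioi_comm]
    refine Finset.prod_congr rfl fun i _ => ?_
    rw [Finset.prod_comm]
    exact Finset.prod_congr rfl fun a _ => prod_Iio_sub i fun b => 1 / ((a : K) - (b : K) * u)
  rw [e1, e2]
  -- The signs from the diagonal cancel the sign in front of the left side.
  have h9 : ((-1 : K) ^ ∑ i, e i) * (-1) ^ ∑ i, e i = 1 := by
    rw [← mul_pow]; simp
  rw [one_div]
  linear_combination ((∏ i, ((e i).factorial : K))⁻¹ *
    ((∏ i ∈ Finset.Icc 1 k, (i.factorial : K))⁻¹ *
    (∏ i : Fin (k + 1), ∏ j ∈ Finset.Ioi i,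
      ((((j : ℕ) : K) - ((i : ℕ) : K)) + ((e i : K) - (e j : K)) * u⁻¹)) *
    (∏ i : Fin (k + 1), ∏ a ∈ Finset.Icc 1 (e i), ∏ b ∈ Finset.Icc 1 (k - (i : ℕ)),
            1 / ((a : K) + (b : K) * u)) *
    (∏ i : Fin (k + 1), ∏ a ∈ Finset.Icc 1 (e i), ∏ b ∈ Finset.Icc 1 (i : ℕ),
            1 / ((a : K) - (b : K) * u)))) * h9

end Products

/-! ### Euler classes -/

/-- The character `t₀ ^ b t₃ ^ a`. -/
def planeChar (b a : ℤ) : Character := b • tchar 0 + a • tchar 3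

theorem planeChar_eq_zero_iff (b a : ℤ) : planeChar b a = 0 ↔ b = 0 ∧ a = 0 := by
  constructor
  · intro h
    have h0 := congrFun h 0
    have h1 := congrFun h 1
    simp [planeChar, tchar] at h0 h1
    omega
  · rintro ⟨rfl, rfl⟩
    simp [planeChar]

theorem charClass_planeChar (b a : ℤ) : charClass (planeChar b a) = b * lam 0 + a * lam 3 := by
  simp [charClass, planeChar, tchar, lam]
  ring

theorem charClass_neg (w : Character) : charClass (-w) = -charClass w := by
  simp [charClass]
  ring

/-- `λ₃` involves `λ₁` and `λ₀` does not, so the two are independent over `ℤ`. -/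
theorem smul_lam_add_smul_lam_ne_zero (b a : ℤ) (h : b ≠ 0 ∨ a ≠ 0) :
    (b : Lam) * lam 0 + a * lam 3 ≠ 0 := by
  intro h0
  have h1 : algebraMap (MvPolynomial (Fin 4) ℚ) Lam
      (MvPolynomial.C (b : ℚ) * MvPolynomial.X 0 + MvPolynomial.C (a : ℚ) *
        (-(MvPolynomial.X 0 + MvPolynomial.X 1 + MvPolynomial.X 2))) = 0 := by
    rw [← h0]
    simp [lam]
  rw [map_eq_zero_iff _ (IsFractionRing.injective (MvPolynomial (Fin 4) ℚ) Lam)] at h1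
  -- At `λ₁ = 1` and all other variables zero only `-a` survives; at `λ₀ = 1` the value is `b - a`.
  have h2 := congrArg (MvPolynomial.eval ![0, 1, 0, 0]) h1
  have h3 := congrArg (MvPolynomial.eval ![1, 0, 0, 0]) h1
  simp at h2 h3
  have h4 : a = 0 := h2
  subst h4
  have h5 : b = 0 := by simpa using h3
  omega

theorem lam_three_ne_zero : lam 3 ≠ 0 := by
  simpa using smul_lam_add_smul_lam_ne_zero 0 1 (by simp)

/-- The multiplicities of a finite family of characters. -/
def multiplicity {X : Type*} (T : Finset X) (g : X → Character) (w : Character) : ℤ :=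
  ∑ x ∈ T, if g x = w then 1 else 0

section multiplicity

variable {X : Type*} (T : Finset X) (g : X → Character)

theorem multiplicity_eq_card (w : Character) :
    multiplicity T g w = (T.filter fun x => g x = w).card := by
  rw [multiplicity, Finset.sum_boole]

theorem support_multiplicity_subset : Function.support (multiplicity T g) ⊆ T.image g := by
  intro w hw
  rw [Function.mem_support, multiplicity_eq_card] at hw
  have : (T.filter fun x => g x = w).Nonempty := by
    rw [← Finset.card_pos]; omega
  obtain ⟨x, hx⟩ := this
  rw [Finset.mem_filter] at hx
  exact Finset.mem_coe.2 (Finset.mem_image.2 ⟨x, hx⟩)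

theorem finprod_zpow_multiplicity (f : Character → Lam) :
    ∏ᶠ w, f w ^ multiplicity T g w = ∏ x ∈ T, f (g x) := by
  rw [finprod_eq_prod_of_mulSupport_subset (s := T.image g), Finset.prod_comp]
  · refine Finset.prod_congr rfl fun w _ => ?_
    rw [multiplicity_eq_card, zpow_natCast]
  · refine fun w hw => support_multiplicity_subset T g ?_
    rw [Function.mem_mulSupport] at hw
    rw [Function.mem_support]
    intro h
    rw [h, zpow_zero] at hw
    exact hw rfl

theorem finprod_zpow_neg_multiplicity (f : Character → Lam) :
    ∏ᶠ w, f w ^ (-multiplicity T g w) = ∏ x ∈ T, (f (g x))⁻¹ := by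
  rw [← finprod_zpow_multiplicity T g fun w => (f w)⁻¹]
  exact finprod_congr fun w => by rw [zpow_neg, inv_zpow]

end multiplicity

/-! ### Weights and contribution of a normal form -/

namespace NormalForm

variable {P : SheafPair} {k : ℕ} {e : Fin (k + 1) → ℕ}

/-- The weights in `χ_X(F)`. -/
abbrev sectionIndex {k : ℕ} (e : Fin (k + 1) → ℕ) :
    Finset (Σ _ : Fin (k + 1), Σ _ : Fin (k + 1), ℕ) :=
  Finset.univ.sigma fun i => Finset.univ.sigma fun _ => Finset.range (e i)

theorem boxWeight_eq (x : Box e × ℤ) : boxWeight x = planeChar (x.2 - x.1.1) x.1.2 := by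
  rw [boxWeight, weight, planeChar, natCast_zsmul]

theorem boxWeight_sub (i j : Box e) :
    boxWeight (j, 0) - boxWeight (i, 0) = planeChar (i.1 - j.1) (j.2 - i.2) := by
  rw [boxWeight_eq, boxWeight_eq, planeChar, planeChar, planeChar, sub_smul, sub_smul, sub_smul,
    sub_smul]
  simp only [zero_smul]
  abel

theorem chiX_eq_multiplicity (B : NormalForm P k e) (E : EquivariantStructure P) :
    E.chiX = multiplicity (sectionIndex e) fun x => planeChar (x.2.1 - x.1) x.2.2 := by
  funext μ
  rw [B.chiX_eq, multiplicity, Finset.sum_sigma, ← Finset.sum_boole, Finset.sum_product,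
    Fintype.sum_sigma]
  refine Finset.sum_congr rfl fun p _ => ?_
  rw [Finset.sum_sigma, Finset.sum_comm]
  simp only [boxWeight_eq]
  have h1 : ∀ f : ℤ → ℤ, ∑ q ∈ Finset.Icc (0 : ℤ) k, f q = ∑ q : Fin (k + 1), f q := by
    intro f
    rw [Fin.sum_univ_eq_sum_range (fun q => f q)]
    refine Finset.sum_bij' (fun q _ => q.toNat) (fun q _ => (q : ℤ)) ?_ ?_ ?_ ?_ ?_
    · intro q hq; simp at hq ⊢; omega
    · intro q hq; simp at hq ⊢; omega
    · intro q hq; simp at hq ⊢; omega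
    · intro q hq; simp
    · intro q hq; simp at hq; rw [Int.toNat_of_nonneg hq.1]
  rw [h1]
  refine Finset.sum_congr rfl fun q _ => ?_
  exact Fin.sum_univ_eq_sum_range
    (fun a => if planeChar ((q : ℤ) - p) a = μ then (1 : ℤ) else 0) _

/-- What is left of `χ_Y(F, F)` is `(1 - t₃⁻¹) ∑ t₀ ^ (j - i) t₃ ^ (a - a')` over pairs of boxes
`(i, a)`, `(j, a')`. Summation over `a' < e j` telescopes to `t₃ ^ a - t₃ ^ (a - e j)`, whose first
term cancels against `χ_X(F)`. -/
theorem halfClass_eq_multiplicity (B : NormalForm P k e) (E : EquivariantStructure P)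
    (μ : Character) :
    E.halfClass μ = -multiplicity (sectionIndex e)
      (fun x => planeChar (x.2.1 - x.1) (x.2.2 - e x.2.1)) μ := by
  let δ : ℤ → ℤ → ℤ := fun b a => if planeChar b a = μ then 1 else 0
  -- Used with `c = 0` for the untwisted term and with `c = 1` for the twist by `t₃⁻¹`.
  have hchi : ∀ (c : ℤ) ν, ν = planeChar 0 (-c) → E.chiP1 0 ν μ =
      ∑ i : Fin (k + 1), ∑ j : Fin (k + 1),
      ∑ a ∈ Finset.range (e i), ∑ a' ∈ Finset.range (e j), δ (j - i) (a - a' - c) := by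
    rintro c _ rfl
    rw [B.chiP1_zero, Finset.sum_comm, Fintype.sum_sigma]
    refine Finset.sum_congr rfl fun i _ => ?_
    have h2 : ∀ a : Fin (e i), ∑ x : Box e, (if boxWeight ((⟨i, a⟩ : Box e), 0) - boxWeight (x, 0)
        + planeChar 0 (-c) = μ then (1 : ℤ) else 0) =
        ∑ j : Fin (k + 1), ∑ a' ∈ Finset.range (e j), δ (j - i) (a - a' - c) := by
      intro a
      rw [Fintype.sum_sigma]
      refine Finset.sum_congr rfl fun j _ => ?_
      rw [← Fin.sum_univ_eq_sum_range (fun a' => δ (j - i) (a - a' - c))]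
      refine Finset.sum_congr rfl fun a' _ => ?_
      rw [boxWeight_sub]
      have : planeChar ((j : ℤ) - i) ((a : ℤ) - a') + planeChar 0 (-c)
          = planeChar (j - i) (a - a' - c) := by
        rw [planeChar, planeChar, planeChar, zero_smul, zero_add, add_assoc, ← add_smul,
          ← sub_eq_add_neg]
      simp only [this, δ]
    rw [Finset.sum_congr rfl fun a _ => h2 a, Finset.sum_comm]
    refine Finset.sum_congr rfl fun j _ => ?_
    exact Fin.sum_univ_eq_sum_range
      (fun a => ∑ a' ∈ Finset.range (e j), δ (j - i) (a - a' - c)) (e i)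
  rw [EquivariantStructure.halfClass, EquivariantStructure.chiY, B.chiP1_one, B.chiP1_one,
    hchi 0 0 (by simp [planeChar]), hchi 1 (-tchar 3) (by simp [planeChar]), B.chiX_eq_multiplicity,
    multiplicity, multiplicity]
  simp only [Finset.sum_sigma, zero_add, add_zero, sub_zero, ← Finset.sum_neg_distrib,
    ← Finset.sum_add_distrib,
    ← Finset.sum_sub_distrib]
  refine Finset.sum_congr rfl fun i _ => Finset.sum_congr rfl fun j _ =>
    Finset.sum_congr rfl fun a _ => ?_
  have h3 := Finset.sum_range_sub' (fun a' : ℕ => δ (j - i) (a - a')) (e j)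
  have h4 : ∑ a' ∈ Finset.range (e j), (δ (j - i) (a - a') - δ (j - i) (a - a' - 1)) =
      ∑ a' ∈ Finset.range (e j), (δ (j - i) (a - a') - δ (j - i) (a - (a' + 1 : ℕ))) := by
    refine Finset.sum_congr rfl fun a' _ => ?_
    push_cast
    rw [sub_add_eq_sub_sub]
  rw [h4, h3]
  simp only [δ, Nat.cast_zero, sub_zero]
  ring

/-- A trivial weight would require `i = j` and `a = e i`, but `a < e i`. -/
theorem halfClass_zero (B : NormalForm P k e) (E : EquivariantStructure P) : E.halfClass 0 = 0 := by
  rw [B.halfClass_eq_multiplicity, multiplicity, neg_eq_zero]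
  refine Finset.sum_eq_zero fun x hx => if_neg ?_
  rw [planeChar_eq_zero_iff]
  rintro ⟨h1, h2⟩
  simp only [Finset.mem_sigma, Finset.mem_univ, true_and, Finset.mem_range] at hx
  have h3 : x.2.1 = x.1 := Fin.ext (by omega)
  rw [h3] at h2
  omega

theorem finite_support_chiX (B : NormalForm P k e) (E : EquivariantStructure P) :
    (Function.support E.chiX).Finite := by
  rw [B.chiX_eq_multiplicity]
  exact (Finset.finite_toSet _).subset (support_multiplicity_subset _ _)

theorem finite_support_halfClass (B : NormalForm P k e) (E : EquivariantStructure P) :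
    (Function.support E.halfClass).Finite := by
  refine (Finset.finite_toSet _).subset fun μ hμ => support_multiplicity_subset (sectionIndex e)
    (fun x => planeChar (x.2.1 - x.1) (x.2.2 - e x.2.1)) ?_
  rw [Function.mem_support, B.halfClass_eq_multiplicity] at hμ
  rw [Function.mem_support]
  exact fun h => hμ (by rw [h, neg_zero])

/-- The summand of the closed formula for the columns of heights `e`. -/
def formulaTerm (k : ℕ) (e : Fin (k + 1) → ℕ) : Lam :=
  (1 / ∏ i, ((e i).factorial : ResolvedConifold.Lam)) *
        (∏ i : Fin (k + 1), ∏ j ∈ Finset.Ioi i,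
          ((((j : ℕ) : ResolvedConifold.Lam) - ((i : ℕ) : ResolvedConifold.Lam)) +
            ((e i : ResolvedConifold.Lam) - (e j : ResolvedConifold.Lam)) *
              (ResolvedConifold.lam 3 / ResolvedConifold.lam 0))) *
        ∏ i : Fin (k + 1),
          ((∏ a ∈ Finset.range (e i), ∏ b ∈ Finset.Icc (-((i : ℕ) : ℤ)) ((k : ℤ) - ((i : ℕ) : ℤ)),
              (ResolvedConifold.mm / ResolvedConifold.lam 3 - (a : ResolvedConifold.Lam) -
                (b : ResolvedConifold.Lam) *
                  (ResolvedConifold.lam 0 / ResolvedConifold.lam 3))) *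
            (∏ a ∈ Finset.Icc 1 (e i), ∏ b ∈ Finset.Icc 1 (k - (i : ℕ)),
              1 / ((a : ResolvedConifold.Lam) + (b : ResolvedConifold.Lam) *
                (ResolvedConifold.lam 0 / ResolvedConifold.lam 3))) *
            (∏ a ∈ Finset.Icc 1 (e i), ∏ b ∈ Finset.Icc 1 (i : ℕ),
              1 / ((a : ResolvedConifold.Lam) - (b : ResolvedConifold.Lam) *
                (ResolvedConifold.lam 0 / ResolvedConifold.lam 3))))

/-- Every weight is divided by `λ₃`, leaving expressions in `u = λ₀ / λ₃` and `m / λ₃`. As `χ(F) = d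
(k + 1)`, its sign is the prefactor, and the remaining sign `(-1) ^ d` is the one that `prod_pairs`
absorbs. -/
theorem contribution_eq (B : NormalForm P k e) (E : EquivariantStructure P) :
    contribution E = (-1) ^ ((∑ i, e i) * (k + 1)) / (∏ i ∈ Finset.Icc 1 k, (i.factorial : Lam)) *
      formulaTerm k e := by
  have hx := lam_three_ne_zero
  set x := lam 3 with hxdef
  set u := lam 0 / lam 3 with hudef
  have hxu : lam 0 = u * x := by rw [hudef, div_mul_cancel₀ _ hx]
  have h1 : eulerClass E.halfClass = ∏ i : Fin (k + 1), ∏ j : Fin (k + 1), ∏ a ∈ Finset.range (e i),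
      (x⁻¹ * ((((j : ℕ) : Lam) - ((i : ℕ) : Lam)) * u + ((a : Lam) - e j))⁻¹) := by
    have : eulerClass E.halfClass = ∏ᶠ w, charClass w ^ (-multiplicity (sectionIndex e)
      (fun x => planeChar (x.2.1 - x.1) (x.2.2 - e x.2.1)) w) :=
      finprod_congr fun w => by rw [B.halfClass_eq_multiplicity]
    rw [this, finprod_zpow_neg_multiplicity]
    simp only [Finset.prod_sigma, charClass_planeChar]
    refine Finset.prod_congr rfl fun i _ => Finset.prod_congr rfl fun j _ =>
      Finset.prod_congr rfl fun a _ => ?_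
    rw [← mul_inv, hxu]
    congr 1
    push_cast; ring
  have h2 : eulerClassDualTwist E.chiX = ∏ i : Fin (k + 1), ∏ j : Fin (k + 1),
      ∏ a ∈ Finset.range (e i), (x * (mm / x - a - (((j : ℤ) - (i : ℤ) : ℤ) : Lam) * u)) := by
    rw [eulerClassDualTwist, B.chiX_eq_multiplicity, finprod_zpow_multiplicity (sectionIndex e) _
      fun w => mm + charClass (-w)]
    simp only [Finset.prod_sigma, charClass_planeChar, charClass_neg]
    refine Finset.prod_congr rfl fun i _ => Finset.prod_congr rfl fun j _ =>
      Finset.prod_congr rfl fun a _ => ?_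
    rw [hxu]
    field_simp
    push_cast; ring
  have h3 : ∀ i : Fin (k + 1), ∏ j : Fin (k + 1), ∏ a ∈ Finset.range (e i),
      (mm / x - a - (((j : ℤ) - (i : ℤ) : ℤ) : Lam) * u) =
      ∏ a ∈ Finset.range (e i), ∏ b ∈ Finset.Icc (-((i : ℕ) : ℤ)) ((k : ℤ) - ((i : ℕ) : ℤ)),
        (mm / x - (a : Lam) - (b : Lam) * u) := by
    intro i
    rw [Finset.prod_comm]
    refine Finset.prod_congr rfl fun a _ => ?_
    refine Finset.prod_bij' (fun j _ => (j : ℤ) - (i : ℤ))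
      (fun b hb => ⟨(b + i).toNat, by rw [Finset.mem_Icc] at hb; omega⟩) ?_ ?_ ?_ ?_ ?_
    · intro j _; rw [Finset.mem_Icc]; omega
    · intro b _; exact Finset.mem_univ _
    · intro j _; exact Fin.ext (by simp)
    · intro b hb
      rw [Finset.mem_Icc] at hb
      simp only
      omega
    · intro j _; rfl
  have h4 : (-1 : Lam) ^ (P.chi + P.deg : ℤ)
      = (-1) ^ ((∑ i, e i) * (k + 1)) * (-1) ^ (∑ i, e i) := by
    rw [B.chi_eq, B.deg_eq, ← pow_add, ← zpow_natCast]
    push_cast; rfl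
  have h5 := prod_pairs e u (fun a b hab => by
    have := smul_lam_add_smul_lam_ne_zero b a hab.symm
    rw [hxu] at this
    intro h
    apply this
    linear_combination x * h)
  have h6 : lam 3 / lam 0 = u⁻¹ := by rw [hudef, inv_div]
  rw [contribution, formulaTerm, h1, h2, h4, h6]
  rw [← hxdef, ← hudef]
  simp only [Finset.prod_mul_distrib] at h5 ⊢
  simp only [← h3]
  -- Both Euler classes are indexed by the same triples `(i, j, a)`, so the powers of `λ₃` taken out
  -- of them cancel.
  have hX : (∏ i : Fin (k + 1), ∏ _j : Fin (k + 1), ∏ _a ∈ Finset.range (e i), x⁻¹) *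
      (∏ i : Fin (k + 1), ∏ _j : Fin (k + 1), ∏ _a ∈ Finset.range (e i), x) = 1 := by
    simp only [← Finset.prod_mul_distrib]
    simp [hx]
  set X1 := ∏ i : Fin (k + 1), ∏ _j : Fin (k + 1), ∏ _a ∈ Finset.range (e i), x⁻¹
  set X2 := ∏ i : Fin (k + 1), ∏ _j : Fin (k + 1), ∏ _a ∈ Finset.range (e i), x
  set M := ∏ i : Fin (k + 1), ∏ j : Fin (k + 1), ∏ a ∈ Finset.range (e i),
      (mm / x - a - (((j : ℤ) - (i : ℤ) : ℤ) : Lam) * u)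
  set R := ∏ i : Fin (k + 1), ∏ j : Fin (k + 1), ∏ a ∈ Finset.range (e i),
      ((((j : ℕ) : Lam) - ((i : ℕ) : Lam)) * u + ((a : Lam) - e j))⁻¹
  linear_combination (-1) ^ ((∑ i, e i) * (k + 1)) * M * h5 +
    (-1) ^ ((∑ i, e i) * (k + 1)) * (-1) ^ (∑ i, e i) * R * M * hX

end NormalForm

/-! ### Slope bounds for subsheaves -/

namespace Subsheaf

variable {F : XSheaf} (N : Subsheaf F)

theorem eq_bot_of_deg_eq_zero (hfin : Module.Finite (Polynomial ℂ) F.M0) (hpure : F.IsPure)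
    (h : N.deg = 0) : N.N0 = ⊥ ∧ N.N1 = ⊥ := by
  have hfinN : Module.Finite (Polynomial ℂ) N.N0 :=
    inferInstanceAs (Module.Finite (Polynomial ℂ) (N.N0.restrictScalars (Polynomial ℂ)))
  have htf := hpure.torsionFree
  have htfN : Module.IsTorsionFree (Polynomial ℂ) N.N0 :=
    inferInstanceAs (Module.IsTorsionFree (Polynomial ℂ) (N.N0.restrictScalars (Polynomial ℂ)))
  have h0 : N.N0 = ⊥ := by
    rw [Submodule.eq_bot_iff]
    intro a ha
    have hfree : Module.Free (Polynomial ℂ) N.N0 :=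
      inferInstanceAs (Module.Free (Polynomial ℂ) (N.N0.restrictScalars (Polynomial ℂ)))
    let β : Module.Basis (Fin N.deg) (Polynomial ℂ) N.N0 := Module.finBasis (Polynomial ℂ) N.N0
    have : IsEmpty (Fin N.deg) := by rw [h]; infer_instance
    refine congrArg Subtype.val (β.repr.injective (Finsupp.ext fun i => ?_) : (⟨a, ha⟩ : N.N0) = 0)
    exact isEmptyElim i
  refine ⟨h0, (Submodule.eq_bot_iff _).2 fun b hb => hpure.injective1 ?_⟩
  have h1 : F.res1C b ∈ N.N01 := N.image1_le_N01 ⟨b, hb, rfl⟩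
  have h2 : F.res0 '' ((⊥ : Submodule ChartRing F.M0) : Set F.M0) = {0} := by simp
  rw [N01, h0, h2, Submodule.span_zero_singleton, Submodule.mem_bot] at h1
  rw [h1, map_zero]

theorem finrank_twistSections_zero_le (hfin : Module.Finite (Polynomial ℂ) F.M0) (hpure : F.IsPure)
    (k : ℕ) (hbot : twistSections N.image0 N.image1 (k + 1) = ⊥) :
    Module.finrank ℂ (twistSections N.image0 N.image1 k) ≤ N.deg ∧
    Module.finrank ℂ (twistSections N.image0 N.image1 0) ≤
      Module.finrank ℂ (twistSections N.image0 N.image1 k) + k * N.deg := by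
  obtain ⟨ev, -, hker⟩ := N.exists_evaluation hfin hpure.torsionFree hpure.injective0
  have h1 := finrank_twistSections_le_succ (B := N.image1) ev (fun a h => (hker a).1 h) k
    (by rw [hbot]; infer_instance)
  have h2 := finrank_twistSections_le_add (B := N.image1) ev (fun a h => (hker a).1 h) k 0
    (by rw [zero_add]; exact h1.1)
  rw [hbot, finrank_bot, Module.finrank_fin_fun] at h1
  rw [zero_add, Module.finrank_fin_fun] at h2
  exact ⟨by omega, h2.2⟩

/-- Without sections of the twist by `-(k + 1)` one has `h⁰(N(-k)) ≤ deg N`, and each of the `k`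
further twists adds at most `deg N`; finally `χ ≤ h⁰`. -/
theorem chi_le_mul_deg (hfin : Module.Finite (Polynomial ℂ) F.M0) (hpure : F.IsPure) (k : ℕ)
    (hbot : twistSections N.image0 N.image1 (k + 1) = ⊥) : N.chi ≤ (k + 1) * N.deg := by
  have h1 := N.finrank_twistSections_zero_le hfin hpure k hbot
  have h2 := N.chi_le hpure.injective0 hpure.injective1
  have h3 : Module.finrank ℂ (twistSections N.image0 N.image1 0) ≤ N.deg + k * N.deg := by omega
  zify at h3
  linarith

/-- A subsheaf of extremal slope is generated by its sections of the extremal twist. -/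
theorem exists_sub_mem (hfin : Module.Finite (Polynomial ℂ) F.M0) (hpure : F.IsPure) (k : ℕ)
    (hbot : twistSections N.image0 N.image1 (k + 1) = ⊥) (hchi : (k + 1) * N.deg ≤ N.chi) :
    ∀ a ∈ N.image0, ∃ v ∈ twistSections N.image0 N.image1 k, shift (-1) (a - v) ∈ N.image0 := by
  obtain ⟨ev, -, hker⟩ := N.exists_evaluation hfin hpure.torsionFree hpure.injective0
  refine exists_sub_mem_of_finrank_le ev (fun a h => (hker a).1 h) hbot ?_
  have h1 := (N.finrank_twistSections_zero_le hfin hpure k hbot).2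
  have h2 := N.chi_le hpure.injective0 hpure.injective1
  rw [Module.finrank_fin_fun]
  zify at h1 ⊢
  linarith

end Subsheaf

/-! ### Stability of normal forms -/

namespace NormalForm

variable {P : SheafPair} {k : ℕ} {e : Fin (k + 1) → ℕ} (B : NormalForm P k e)

/-- The coefficient of `z ^ q`. -/
def layer (q : ℤ) : P.F.M01 →ₗ[ℂ] P.F.M01 :=
  B.b.constr ℂ fun x => if x.2 = q then B.b (x.1, 0) else 0

theorem layer_shift (q q' : ℤ) {v : P.F.M01}
    (hv : v ∈ Submodule.span ℂ (B.b '' {x | x.2 ∈ ({0} : Set ℤ)})) :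
    B.layer q (shift q' v) = if q' = q then v else 0 := by
  induction hv using Submodule.span_induction with
  | mem v hv =>
    obtain ⟨⟨i, j⟩, hj, rfl⟩ := hv
    obtain rfl : j = 0 := hj
    rw [shift_b, layer, Module.Basis.constr_basis]
    simp only [zero_add]
  | zero => simp
  | add a b _ _ ha hb => rw [map_add, map_add, ha, hb]; split_ifs <;> simp
  | smul c a _ ha => rw [map_smul, map_smul, ha]; split_ifs <;> simp

theorem layer_sec (B : NormalForm P k e) (p : Fin (k + 1)) :
    B.layer p (P.F.res0C P.s0) = B.y p := by
  rw [B.sec, map_sum, Finset.sum_eq_single p]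
  · rw [B.layer_shift _ _ (B.y_mem_span_zero p), if_pos rfl]
  · intro p' _ hp'
    rw [B.layer_shift _ _ (B.y_mem_span_zero p'), if_neg]
    exact fun h => hp' (Fin.ext (by exact_mod_cast h))
  · simp

theorem twistSections_eq_bot (B : NormalForm P k e) (N : Subsheaf P.F) :
    twistSections N.image0 N.image1 (k + 1) = ⊥ := by
  rw [Submodule.eq_bot_iff]
  rintro v ⟨h0, h1⟩
  have h0' : v ∈ LinearMap.range P.F.res0C := LinearMap.map_le_range h0
  have h1' : shift (k + 1 : ℤ) v ∈ LinearMap.range P.F.res1C := LinearMap.map_le_range h1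
  rw [B.range0] at h0'
  rw [B.range1] at h1'
  have h2 := B.shift_mem_span_b (-(k + 1 : ℤ)) (S' := Set.Iio 0) (by simp; omega) h1'
  rw [shift_shift, neg_add_cancel, shift_zero] at h2
  have h3 := Submodule.mem_inf.2 ⟨h0', h2⟩
  rw [B.span_inf] at h3
  have e : (Set.Ici 0 ∩ Set.Iio 0 : Set ℤ) = ∅ := by ext; simp
  simpa [e] using h3

theorem slope_whole (B : NormalForm P k e) (hd : P.deg ≠ 0) :
    (Subsheaf.whole P.F).slope = (((k + 1 : ℕ) : ℚ) : WithTop ℚ) := by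
  rw [Subsheaf.slope, if_neg (show (Subsheaf.whole P.F).deg ≠ 0 from hd)]
  congr 1
  change (P.chi : ℚ) / (P.deg : ℚ) = _
  rw [div_eq_iff (by exact_mod_cast hd), B.chi_eq, B.deg_eq]
  push_cast; ring

theorem eq_top_of_mem (B : NormalForm P k e) (N : Subsheaf P.F)
    (h : ∀ i : Box e, B.b (i, 0) ∈ twistSections N.image0 N.image1 k) : N.N0 = ⊤ ∧ N.N1 = ⊤ := by
  constructor
  · rw [eq_top_iff]
    intro a _
    have h1 : LinearMap.range P.F.res0C ≤ N.image0 := by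
      rw [B.range0, Submodule.span_le]
      rintro _ ⟨⟨i, q⟩, hq, rfl⟩
      rw [B.b_eq_shift]
      exact shift_mem_of_le (fun y hy => N.shift_mem_image0 hy) hq (h i).1
    obtain ⟨a', ha', h2⟩ := h1 (LinearMap.mem_range_self _ a)
    rw [← B.inj0 h2]; exact ha'
  · rw [eq_top_iff]
    intro a _
    have h1 : LinearMap.range P.F.res1C ≤ N.image1 := by
      rw [B.range1, Submodule.span_le]
      rintro _ ⟨⟨i, q⟩, hq, rfl⟩
      have h3 := shift_mem_of_nonpos (fun y hy => N.shift_mem_image1 hy)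
        (q := q - k) (by simp at hq; omega) (h i).2
      rw [shift_shift, sub_add_cancel] at h3
      rw [B.b_eq_shift]
      exact h3
    obtain ⟨a', ha', h2⟩ := h1 (LinearMap.mem_range_self _ a)
    rw [← B.inj1 h2]; exact ha'

/-- By `hsurj` the section expands in powers of `z` with coefficients in the sections of the `k`-th
twist of `N`. The expansion agrees with the one in the normal form, so the coefficient of `z ^ p` is
`y_p`. -/
theorem y_mem_twistSections (B : NormalForm P k e) (N : Subsheaf P.F)
    (h0 : P.s0 ∈ N.N0) (h1 : P.s1 ∈ N.N1)
    (hsurj : ∀ a ∈ N.image0, ∃ v ∈ twistSections N.image0 N.image1 k, shift (-1) (a - v) ∈ N.image0)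
    (p : Fin (k + 1)) : B.y p ∈ twistSections N.image0 N.image1 k := by
  set V := twistSections N.image0 N.image1 k
  have hs1 : P.F.res0C P.s0 ∈ N.image1 := ⟨P.s1, h1, P.glue.symm⟩
  -- Induction depth `k` is taken below because there `shift (n - k)` is the identity, and the
  -- section already lies in the image of `U₀`.
  have hs0 : shift ((k : ℕ) - (k : ℤ)) (P.F.res0C P.s0) ∈ N.image0 := by
    rw [sub_self, shift_zero]; exact ⟨P.s0, h0, rfl⟩
  have h2 := mem_span_translates_of_mem_right (h := (Subtype.val : V → P.F.M01))
    (fun y hy => N.shift_mem_image1 hy) (by rw [Subtype.range_coe]; exact Submodule.subset_span)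
    hsurj k hs1 hs0
  have h3 : ∀ v ∈ V, v ∈ Submodule.span ℂ (B.b '' {x | x.2 ∈ ({0} : Set ℤ)}) := fun v hv =>
    B.mem_span_zero_of_mem_range (LinearMap.map_le_range hv.1) (LinearMap.map_le_range hv.2)
  rw [← B.layer_sec]
  have h4 : Submodule.span ℂ (translates (Subtype.val : V → P.F.M01) '' {x | x.2 ∈ Set.Iic (k : ℤ)})
      ≤ V.comap (B.layer p) := by
    rw [Submodule.span_le]
    rintro _ ⟨x, -, rfl⟩
    rw [SetLike.mem_coe, Submodule.mem_comap, translates, B.layer_shift _ _ (h3 _ x.1.2)]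
    split_ifs
    · exact x.1.2
    · exact V.zero_mem
  exact h4 h2

/-- No subsheaf has sections of the twist by `-(k + 1)`, which bounds all slopes by `k + 1`. A
subsheaf that reaches this slope and contains the section contains all `y_p`, hence all `x₃ ^ a
y_p`, hence everything. -/
theorem isJSStable (B : NormalForm P k e) (hd : P.deg ≠ 0) : P.IsJSStable where
  coherent := B.isCoherentCompact
  oneDim := hd
  semistable N hN := by
    by_cases h : N.deg = 0
    · have := N.eq_bot_of_deg_eq_zero B.isCoherentCompact.1 B.isPure h
      tauto
    rw [B.slope_whole hd, Subsheaf.slope, if_neg h, WithTop.coe_le_coe,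
      div_le_iff₀ (by exact_mod_cast Nat.pos_of_ne_zero h)]
    exact_mod_cast N.chi_le_mul_deg B.isCoherentCompact.1 B.isPure k (B.twistSections_eq_bot N)
  section_ne := by
    left
    intro h
    apply hd
    rw [B.deg_eq]
    refine Finset.sum_eq_zero fun p _ => ?_
    have h1 := B.layer_sec p
    rw [h, map_zero, map_zero] at h1
    exact Nat.le_zero.1 ((B.pow_fib_y_eq_zero_iff p 0).1 h1.symm)
  stable N h0 h1 hne := by
    by_contra hlt
    rw [not_lt, B.slope_whole hd] at hlt
    have hchi : (k + 1) * (N.deg : ℤ) ≤ N.chi := by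
      -- A subsheaf of rank `0` has slope `∞`, so the slope inequality says nothing about it. By
      -- purity it is zero, and it cannot contain a non-zero section.
      by_cases h : N.deg = 0
      · obtain ⟨hb0, -⟩ := N.eq_bot_of_deg_eq_zero B.isCoherentCompact.1 B.isPure h
        exfalso
        rw [hb0, Submodule.mem_bot] at h0
        apply hd
        rw [B.deg_eq]
        refine Finset.sum_eq_zero fun p _ => ?_
        have h1 := B.layer_sec p
        rw [h0, map_zero, map_zero] at h1
        exact Nat.le_zero.1 ((B.pow_fib_y_eq_zero_iff p 0).1 h1.symm)
      · rw [Subsheaf.slope, if_neg h, WithTop.coe_le_coe,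
          le_div_iff₀ (by exact_mod_cast Nat.pos_of_ne_zero h)] at hlt
        exact_mod_cast hlt
    have hy := B.y_mem_twistSections N h0 h1 (N.exists_sub_mem B.isCoherentCompact.1 B.isPure k
      (B.twistSections_eq_bot N) hchi)
    have hfib : ∀ v ∈ twistSections N.image0 N.image1 k,
        P.F.fibMap 2 v ∈ twistSections N.image0 N.image1 k := fun v hv => by
      refine ⟨N.fib_mem_image0 2 hv.1, ?_⟩
      have h2 := N.fib_mem_image1 2 hv.2
      rw [P.F.fibMap_shift] at h2
      rw [SetLike.mem_coe, Submodule.mem_comap, ← shift_zero (shift (k : ℤ) (P.F.fibMap 2 v))]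
      exact h2
    have hpow : ∀ (a : ℕ) p, (P.F.fibMap 2 ^ a) (B.y p) ∈ twistSections N.image0 N.image1 k := by
      intro a p
      induction a with
      | zero => exact hy p
      | succ a ih => rw [pow_succ', Module.End.mul_apply]; exact hfib _ ih
    have htop := B.eq_top_of_mem N fun i => by
      rw [B.b_apply, shift_zero]; exact hpow _ _
    tauto

end NormalForm

/-! ### Expansions in powers of `z` -/

section Lattice

variable {W : Type*} [AddCommGroup W] [Module ℂ W] [Module (LaurentPolynomial ℂ) W]
  [SMulCommClass (LaurentPolynomial ℂ) ℂ W]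

/-- The constant coefficient is minus a multiple of `z`, hence zero by `hsep`; divide by `z` and
repeat. -/
theorem eq_zero_of_sum_shift_eq_zero {A V : Submodule ℂ W} (hA : ∀ y ∈ A, shift 1 y ∈ A)
    (hVA : V ≤ A) (hsep : ∀ v ∈ V, shift (-1) v ∈ A → v = 0) {n : ℕ} {c : Fin n → W}
    (hc : ∀ p, c p ∈ V) (h : ∑ p : Fin n, shift (p : ℤ) (c p) = 0) (p : Fin n) : c p = 0 := by
  induction n with
  | zero => exact p.elim0
  | succ n ih =>
    rw [Fin.sum_univ_succ] at h
    have e : ∑ i : Fin n, shift ((i.succ : ℕ) : ℤ) (c i.succ) =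
        shift 1 (∑ i : Fin n, shift (i : ℤ) (c i.succ)) := by
      rw [map_sum]
      refine Finset.sum_congr rfl fun i _ => ?_
      rw [shift_shift, Fin.val_succ]
      push_cast
      rw [add_comm]
    rw [e, Fin.val_zero, Nat.cast_zero, shift_zero] at h
    have h0 : c 0 = 0 := by
      refine hsep _ (hc 0) ?_
      rw [eq_neg_of_add_eq_zero_left h, map_neg, shift_shift, neg_add_cancel, shift_zero]
      exact A.neg_mem (A.sum_mem fun i _ => shift_mem_of_le hA (by omega) (hVA (hc _)))
    rw [h0, zero_add, ← map_zero (shift 1)] at h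
    refine Fin.cases h0 (fun i => ?_) p
    exact ih (fun i => hc i.succ) (shift_injective _ h) i

theorem exists_eq_sum_shift {ι : Type*} {h : ι → W} {V : Submodule ℂ W} (hV : ∀ i, h i ∈ V) {k : ℕ}
    {y : W} (hy : y ∈ Submodule.span ℂ (translates h '' {x | x.2 ∈ Set.Icc (0 : ℤ) k})) :
    ∃ v : Fin (k + 1) → W, (∀ p, v p ∈ V) ∧ y = ∑ p : Fin (k + 1), shift (p : ℤ) (v p) := by
  induction hy using Submodule.span_induction with
  | mem y hy =>
    obtain ⟨⟨i, q⟩, hq, rfl⟩ := hy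
    obtain ⟨hq0, hqk⟩ : 0 ≤ q ∧ q ≤ k := hq
    lift q to ℕ using hq0
    refine ⟨Pi.single ⟨q, by omega⟩ (h i), fun p => ?_, ?_⟩
    · rcases eq_or_ne p ⟨q, by omega⟩ with rfl | hp
      · rw [Pi.single_eq_same]; exact hV i
      · rw [Pi.single_eq_of_ne hp]; exact V.zero_mem
    · rw [Finset.sum_eq_single ⟨q, by omega⟩]
      · rw [Pi.single_eq_same]; rfl
      · intro p _ hp
        rw [Pi.single_eq_of_ne hp, map_zero]
      · simp
  | zero => exact ⟨0, fun _ => V.zero_mem, by simp⟩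
  | add a b _ _ ha hb =>
    obtain ⟨v, hv, rfl⟩ := ha
    obtain ⟨w, hw, rfl⟩ := hb
    exact ⟨v + w, fun p => V.add_mem (hv p) (hw p), by simp [Finset.sum_add_distrib]⟩
  | smul c a _ ha =>
    obtain ⟨v, hv, rfl⟩ := ha
    exact ⟨c • v, fun p => V.smul_mem _ (hv p), by simp [Finset.smul_sum]⟩

end Lattice

namespace Subsheaf

variable {F : XSheaf} {ι : Type*} {h : ι → F.M01} {k : ℕ} (h0 : ∀ j, h j ∈ LinearMap.range F.res0C)
    (h1 : ∀ j, shift k (h j) ∈ LinearMap.range F.res1C)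
    (hf0 : ∀ j, F.fibMap 0 (h j) = 0) (hf1 : ∀ j, F.fibMap 1 (h j) = 0)
    (hf2 : ∀ j, F.fibMap 2 (h j) ∈ Submodule.span ℂ (Set.range h))

theorem image0_ofSections : (ofSections h k h0 h1 hf0 hf1 hf2).image0 =
    Submodule.span ℂ (translates h '' {x | x.2 ∈ Set.Ici 0}) := by
  unfold ofSections; exact image0_ofLattice

theorem image1_ofSections : (ofSections h k h0 h1 hf0 hf1 hf2).image1 =
    Submodule.span ℂ (translates h '' {x | x.2 ∈ Set.Iic (k : ℤ)}) := by
  unfold ofSections; exact image1_ofLattice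

theorem N01_ofSections_le : (ofSections h k h0 h1 hf0 hf1 hf2).N01.restrictScalars ℂ ≤
    Submodule.span ℂ (Set.range (translates h)) := by
  unfold ofSections; exact N01_ofLattice_le

end Subsheaf

/-! ### The space `H⁰(F(-k))` and the subsheaves it generates -/

namespace XSheaf

/-- The sections of the twist `F(-k)`, over the overlap. -/
def twistSpace (F : XSheaf) (k : ℤ) : Submodule ℂ F.M01 :=
  twistSections (Subsheaf.whole F).image0 (Subsheaf.whole F).image1 k

variable {F : XSheaf}

theorem fibMap_mem_twistSpace {k : ℤ} {v : F.M01} (hv : v ∈ F.twistSpace k) :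
    F.fibMap 2 v ∈ F.twistSpace k := by
  refine ⟨(Subsheaf.whole F).fib_mem_image0 2 hv.1, ?_⟩
  have h2 := (Subsheaf.whole F).fib_mem_image1 2 hv.2
  rw [F.fibMap_shift] at h2
  rw [SetLike.mem_coe, Submodule.mem_comap, ← shift_zero (shift k (F.fibMap 2 v))]
  exact h2

/-- As `y₁ = z x₁` and `y₂ = z x₂` are regular over `U_∞`, multiplication by `x₁` or `x₂` lands in
the sections of the next twist, of which there are none. This is why stable pairs of this class are
supported on `Y`. -/
theorem fibMap_eq_zero_of_mem_twistSpace {k : ℤ} (hbot : F.twistSpace (k + 1) = ⊥) {v : F.M01}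
    (hv : v ∈ F.twistSpace k) : F.fibMap 0 v = 0 ∧ F.fibMap 1 v = 0 := by
  constructor
  · rw [← Submodule.mem_bot ℂ, ← hbot]
    refine ⟨(Subsheaf.whole F).fib_mem_image0 0 hv.1, ?_⟩
    have h2 := (Subsheaf.whole F).fib_mem_image1 0 hv.2
    rw [F.fibMap_shift, shift_shift] at h2
    rw [SetLike.mem_coe, Submodule.mem_comap, add_comm]
    exact h2
  · rw [← Submodule.mem_bot ℂ, ← hbot]
    refine ⟨(Subsheaf.whole F).fib_mem_image0 1 hv.1, ?_⟩
    have h2 := (Subsheaf.whole F).fib_mem_image1 1 hv.2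
    rw [F.fibMap_shift, shift_shift] at h2
    rw [SetLike.mem_coe, Submodule.mem_comap, add_comm]
    exact h2

theorem eq_zero_of_shift_mem {k : ℤ} (hbot : F.twistSpace (k + 1) = ⊥) {v : F.M01}
    (hv : v ∈ F.twistSpace k) (h : shift (-1) v ∈ (Subsheaf.whole F).image0) : v = 0 := by
  have h1 : shift (-1) v ∈ F.twistSpace (k + 1) := by
    refine ⟨h, ?_⟩
    rw [SetLike.mem_coe, Submodule.mem_comap, shift_shift, add_neg_cancel_right]
    exact hv.2
  rw [hbot, Submodule.mem_bot, ← map_zero (shift (-1))] at h1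
  exact shift_injective _ h1

theorem linearIndependent_translates_of_twistSpace {k : ℤ} (hbot : F.twistSpace (k + 1) = ⊥)
    {ι : Type*} {h : ι → F.M01} (hli : LinearIndependent ℂ h) (hh : ∀ j, h j ∈ F.twistSpace k) :
    LinearIndependent ℂ (translates h) := by
  refine linearIndependent_translates (A := (Subsheaf.whole F).image0)
    (fun y hy => (Subsheaf.whole F).shift_mem_image0 hy) hli (fun j => (hh j).1) fun v hv h1 => ?_
  exact eq_zero_of_shift_mem hbot (Submodule.span_le.2 (by rintro _ ⟨j, rfl⟩; exact hh j) hv) h1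

/-- The subsheaf is `U ⊗ O(k)`, of slope `k + 1` when `U ≠ 0`. Closure under `x₃` is assumed and
`x₁, x₂` act by zero, so it is a subsheaf on `X`. It serves as test object for semistability and for
stability. -/
theorem exists_subsheaf (hfin : Module.Finite (Polynomial ℂ) F.M0) (hpure : F.IsPure) {k : ℕ}
    (hbot : F.twistSpace (k + 1) = ⊥) (U : Submodule ℂ F.M01) [FiniteDimensional ℂ U]
    (hU : U ≤ F.twistSpace k) (hU2 : ∀ v ∈ U, F.fibMap 2 v ∈ U) :
    ∃ N : Subsheaf F, N.deg = Module.finrank ℂ U ∧ N.chi = Module.finrank ℂ U * (k + 1) ∧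
      (∀ q : ℤ, 0 ≤ q → ∀ v ∈ U, shift q v ∈ N.image0) ∧
      (∀ q : ℤ, q ≤ k → ∀ v ∈ U, shift q v ∈ N.image1) := by
  obtain ⟨β⟩ : Nonempty (Module.Basis (Fin (Module.finrank ℂ U)) ℂ U) := ⟨Module.finBasis ℂ U⟩
  obtain ⟨h, hβ⟩ : ∃ h : Fin (Module.finrank ℂ U) → F.M01, ∀ j, h j = β j := ⟨_, fun _ => rfl⟩
  have hli : LinearIndependent ℂ h := by
    rw [funext hβ]; exact β.linearIndependent.map' U.subtype U.ker_subtype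
  have hspan : Submodule.span ℂ (Set.range h) = U := by
    have : Set.range h = U.subtype '' Set.range β := by
      rw [← Set.range_comp, funext hβ]; rfl
    rw [this, ← Submodule.map_span, β.span_eq, Submodule.map_top, Submodule.range_subtype]
  have hh : ∀ j, h j ∈ F.twistSpace k := fun j => hU (hβ j ▸ (β j).2)
  have hli' := linearIndependent_translates_of_twistSpace hbot hli hh
  obtain ⟨N, e0, e1, e01⟩ : ∃ N : Subsheaf F,
      N.image0 = Submodule.span ℂ (translates h '' {x | x.2 ∈ Set.Ici 0}) ∧
      N.image1 = Submodule.span ℂ (translates h '' {x | x.2 ∈ Set.Iic (k : ℤ)}) ∧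
      N.N01.restrictScalars ℂ ≤ Submodule.span ℂ (Set.range (translates h)) := by
    have h0 : ∀ j, h j ∈ LinearMap.range F.res0C := fun j => by
      rw [← Subsheaf.image0_whole]; exact (hh j).1
    have h1 : ∀ j, shift k (h j) ∈ LinearMap.range F.res1C := fun j => by
      rw [← Subsheaf.image1_whole]; exact (hh j).2
    have hf0 := fun j => (fibMap_eq_zero_of_mem_twistSpace hbot (hh j)).1
    have hf1 := fun j => (fibMap_eq_zero_of_mem_twistSpace hbot (hh j)).2
    have hf2 : ∀ j, F.fibMap 2 (h j) ∈ Submodule.span ℂ (Set.range h) := fun j => by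
      rw [hspan]; exact hU2 _ (hβ j ▸ (β j).2)
    exact ⟨Subsheaf.ofSections h k h0 h1 hf0 hf1 hf2, Subsheaf.image0_ofSections h0 h1 hf0 hf1 hf2,
      Subsheaf.image1_ofSections h0 h1 hf0 hf1 hf2, Subsheaf.N01_ofSections_le h0 h1 hf0 hf1 hf2⟩
  refine ⟨N, ?_, ?_, ?_, ?_⟩
  · rw [N.deg_eq_of_translates hpure hfin hli' e0, Fintype.card_fin]
  · rw [N.chi_eq_of_translates hpure hli' e0 e1 e01, Fintype.card_fin]
  · intro q hq v hv
    rw [e0]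
    rw [← hspan] at hv
    exact shift_mem_span_translates_of_mem (S := Set.Ici 0) hq hv
  · intro q hq v hv
    rw [e1]
    rw [← hspan] at hv
    exact shift_mem_span_translates_of_mem (S := Set.Iic (k : ℤ)) hq hv

/-- In a basis of the free `ℂ[z]`-module, the coordinates are divisible by every power of `z`. -/
theorem eq_zero_of_forall_shift_mem (hfin : Module.Finite (Polynomial ℂ) F.M0) (hpure : F.IsPure)
    {y : F.M01} (hy : y ∈ (Subsheaf.whole F).image0)
    (h : ∀ n : ℕ, shift (-n) y ∈ (Subsheaf.whole F).image0) : y = 0 := by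
  have htf := hpure.torsionFree
  have hfree : Module.Free (Polynomial ℂ) F.M0 := inferInstance
  obtain ⟨a, -, rfl⟩ := hy
  let β := Module.finBasis (Polynomial ℂ) F.M0
  have h0 : a = 0 := by
    refine β.repr.injective (Finsupp.ext fun i => ?_)
    rw [map_zero, Finsupp.zero_apply]
    ext n
    obtain ⟨a', -, h1⟩ := h (n + 1)
    have h2 : a = (Polynomial.X ^ (n + 1) : Polynomial ℂ) • a' := by
      refine hpure.injective0 ?_
      rw [F.res0C_smul, h1, Polynomial.toLaurent_X_pow]
      refine ((shift_shift _ _ _).trans ?_).symm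
      rw [add_neg_cancel, shift_zero]
    rw [h2, map_smul, Finsupp.smul_apply, smul_eq_mul, Polynomial.coeff_zero]
    exact Polynomial.X_pow_dvd_iff.1 (dvd_mul_right _ _) n (by omega)
  rw [h0, map_zero]

end XSheaf

/-! ### Structure of stable pairs of slope `k + 1` -/

namespace SheafPair.IsJSStable

variable {P : SheafPair} {k : ℕ}

theorem slope_whole (hP : P.IsJSStable) (hchi : P.chi = P.deg * (k + 1)) :
    (Subsheaf.whole P.F).slope = (((k + 1 : ℕ) : ℚ) : WithTop ℚ) := by
  rw [Subsheaf.slope, if_neg (show (Subsheaf.whole P.F).deg ≠ 0 from hP.oneDim)]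
  congr 1
  change (P.chi : ℚ) / (P.deg : ℚ) = _
  rw [div_eq_iff (by exact_mod_cast hP.oneDim), hchi]
  push_cast; ring

/-- The push-forward of a semistable sheaf of degree `d` and Euler characteristic `d (k + 1)` is a
sum of copies of `O(k)`. -/
theorem twistSpace_eq (hP : P.IsJSStable) (hchi : P.chi = P.deg * (k + 1)) :
    P.F.twistSpace (k + 1) = ⊥ ∧ FiniteDimensional ℂ (P.F.twistSpace k) ∧
      Module.finrank ℂ (P.F.twistSpace k) = P.deg := by
  have hpure := hP.isPure
  have hfin := hP.coherent.1
  have hd : 0 < P.deg := Nat.pos_of_ne_zero hP.oneDim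
  have h0 : P.deg * (k + 1) ≤ Module.finrank ℂ (P.F.twistSpace 0) := by
    have := (Subsheaf.whole P.F).chi_le hpure.injective0 hpure.injective1
    change P.chi ≤ _ at this
    rw [hchi] at this
    exact_mod_cast this
  have h0' : 0 < Module.finrank ℂ (P.F.twistSpace 0) :=
    lt_of_lt_of_le (Nat.mul_pos hd k.succ_pos) h0
  -- `finrank` is `0` for infinite-dimensional spaces, so the positive lower bound supplied by `χ`
  -- already gives finiteness.
  have hfd0 : FiniteDimensional ℂ (P.F.twistSpace 0) := Module.finite_of_finrank_pos h0'
  obtain ⟨m, hm, hbot⟩ := exists_twistSections_ne_bot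
    (fun y hy => (Subsheaf.whole P.F).shift_mem_image0 hy)
    (fun y hy h => XSheaf.eq_zero_of_forall_shift_mem hfin hpure hy h) hfd0 (fun h => by
      rw [XSheaf.twistSpace, h, finrank_bot] at h0'
      exact lt_irrefl _ h0')
  have hle := (Subsheaf.whole P.F).finrank_twistSections_zero_le hfin hpure m hbot
  obtain ⟨ev, -, hker⟩ :=
    (Subsheaf.whole P.F).exists_evaluation hfin hpure.torsionFree hpure.injective0
  have hfdm : FiniteDimensional ℂ (P.F.twistSpace m) :=
    (finrank_twistSections_le_succ (B := (Subsheaf.whole P.F).image1) ev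
      (fun a h => (hker a).1 h) m (by rw [hbot]; infer_instance)).1
  obtain ⟨N, hdeg, hchiN, hN0, -⟩ := XSheaf.exists_subsheaf hfin hpure hbot (P.F.twistSpace m)
    le_rfl fun v hv => XSheaf.fibMap_mem_twistSpace hv
  -- The subsheaf `H⁰(F(-m)) ⊗ O(m)` has slope `m + 1`, which semistability bounds by `k + 1`.
  have hmk : m ≤ k := by
    have hpos : Module.finrank ℂ (P.F.twistSpace m) ≠ 0 := fun h =>
      hm (Submodule.finrank_eq_zero.1 h : P.F.twistSpace m = ⊥)
    have hslope := hP.semistable N (Or.inl fun h => by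
      obtain ⟨v, hv, hv0⟩ := Submodule.exists_mem_ne_zero_of_ne_bot hm
      obtain ⟨a, ha, h1⟩ := hN0 0 le_rfl v hv
      rw [h] at ha
      obtain rfl : a = 0 := ha
      rw [map_zero, shift_zero] at h1
      exact hv0 h1.symm)
    rw [hP.slope_whole hchi, Subsheaf.slope, if_neg (by rw [hdeg]; exact hpos), WithTop.coe_le_coe,
      div_le_iff₀ (by rw [hdeg]; exact_mod_cast Nat.pos_of_ne_zero hpos), hchiN, hdeg] at hslope
    have h2 : Module.finrank ℂ (P.F.twistSpace m) * (m + 1) ≤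
        (k + 1) * Module.finrank ℂ (P.F.twistSpace m) := by exact_mod_cast hslope
    rw [mul_comm] at h2
    have := Nat.le_of_mul_le_mul_right h2 (Nat.pos_of_ne_zero hpos)
    omega
  -- In the other direction `d (k + 1) ≤ h⁰(F) ≤ d (m + 1)`.
  have hkm : m = k := by
    have h1 : P.deg * (k + 1) ≤ P.deg * (m + 1) := by
      have h2 : Module.finrank ℂ (P.F.twistSpace 0) ≤ P.deg + m * P.deg := by
        have h3 : Module.finrank ℂ (P.F.twistSpace m) ≤ P.deg := hle.1
        have h4 : Module.finrank ℂ (P.F.twistSpace 0) ≤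
          Module.finrank ℂ (P.F.twistSpace m) + m * P.deg := hle.2
        omega
      calc _ ≤ _ := h0
        _ ≤ _ := h2
        _ = _ := by ring
    have := Nat.le_of_mul_le_mul_left h1 hd
    omega
  subst hkm
  refine ⟨hbot, hfdm, le_antisymm hle.1 ?_⟩
  -- With `m = k`, the chain `d (k + 1) ≤ h⁰(F) ≤ h⁰(F(-k)) + k d` leaves `h⁰(F(-k)) ≥ d`.
  have h4 : Module.finrank ℂ (P.F.twistSpace 0) ≤
    Module.finrank ℂ (P.F.twistSpace m) + m * P.deg := hle.2
  nlinarith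

end SheafPair.IsJSStable

namespace SheafPair.IsJSStable

variable {P : SheafPair} {k : ℕ}

theorem exists_sub_mem (hP : P.IsJSStable) (hchi : P.chi = P.deg * (k + 1)) :
    ∀ a ∈ (Subsheaf.whole P.F).image0, ∃ v ∈ P.F.twistSpace k,
      shift (-1) (a - v) ∈ (Subsheaf.whole P.F).image0 := by
  refine (Subsheaf.whole P.F).exists_sub_mem hP.coherent.1 hP.isPure k (hP.twistSpace_eq hchi).1 ?_
  rw [mul_comm]
  exact hchi.symm.le

section Span

variable {ι : Type*} {h : ι → P.F.M01}

/-- Together with `image1_eq_span` this identifies `π_* F` with `V ⊗ O(k)` for `V = H⁰(F(-k))`. -/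
theorem image0_eq_span (hP : P.IsJSStable) (hchi : P.chi = P.deg * (k + 1))
    (hh : Submodule.span ℂ (Set.range h) = P.F.twistSpace k) : (Subsheaf.whole P.F).image0 =
      Submodule.span ℂ (translates h '' {x | x.2 ∈ Set.Ici 0}) := by
  refine le_antisymm (fun y hy => ?_) (Submodule.span_le.2 ?_)
  · obtain ⟨n, hn⟩ := P.F.exists_shift_mem_range1 y
    refine mem_span_translates_of_mem_left (k := k)
      (fun y hy => (Subsheaf.whole P.F).shift_mem_image1 hy) hh.symm.le (hP.exists_sub_mem hchi)
      (n + k) hy ?_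
    rw [Subsheaf.image1_whole]
    convert hn using 3
    push_cast; ring
  · rintro _ ⟨x, hx, rfl⟩
    have h1 : h x.1 ∈ P.F.twistSpace k := hh ▸ Submodule.subset_span ⟨_, rfl⟩
    exact shift_mem_of_le (fun y hy => (Subsheaf.whole P.F).shift_mem_image0 hy) hx h1.1

theorem image1_eq_span (hP : P.IsJSStable) (hchi : P.chi = P.deg * (k + 1))
    (hh : Submodule.span ℂ (Set.range h) = P.F.twistSpace k) : (Subsheaf.whole P.F).image1 =
      Submodule.span ℂ (translates h '' {x | x.2 ∈ Set.Iic (k : ℤ)}) := by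
  refine le_antisymm (fun y hy => ?_) (Submodule.span_le.2 ?_)
  · obtain ⟨n, hn⟩ := P.F.exists_shift_mem_range0 y
    refine mem_span_translates_of_mem_right (k := k)
      (fun y hy => (Subsheaf.whole P.F).shift_mem_image1 hy) hh.symm.le (hP.exists_sub_mem hchi)
      (n + k) hy ?_
    rw [Subsheaf.image0_whole]
    convert hn using 3
    push_cast; ring
  · rintro _ ⟨x, hx, rfl⟩
    have h1 : h x.1 ∈ P.F.twistSpace k := hh ▸ Submodule.subset_span ⟨_, rfl⟩
    have h2 := shift_mem_of_nonpos (fun y hy => (Subsheaf.whole P.F).shift_mem_image1 hy)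
      (q := x.2 - k) (by have : x.2 ≤ k := hx; omega) h1.2
    rw [shift_shift, sub_add_cancel] at h2
    exact h2

theorem span_translates_eq_top (hP : P.IsJSStable) (hchi : P.chi = P.deg * (k + 1))
    (hh : Submodule.span ℂ (Set.range h) = P.F.twistSpace k) :
    Submodule.span ℂ (Set.range (translates h)) = ⊤ := by
  rw [eq_top_iff]
  intro y _
  obtain ⟨n, hn⟩ := P.F.exists_shift_mem_range0 y
  rw [← Subsheaf.image0_whole, hP.image0_eq_span hchi hh] at hn
  have h1 := Subsheaf.shift_mem_span_translates_univ (-n)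
    (Submodule.span_mono (Set.image_subset_range _ _) hn)
  rwa [shift_shift, neg_add_cancel, shift_zero] at h1

end Span

/-- The section is regular on both charts, so only the exponents from `0` to `k` occur in it. -/
theorem exists_eq_sum_shift (hP : P.IsJSStable) (hchi : P.chi = P.deg * (k + 1)) :
    ∃ v : Fin (k + 1) → P.F.M01, (∀ p, v p ∈ P.F.twistSpace k) ∧
      P.F.res0C P.s0 = ∑ p : Fin (k + 1), shift (p : ℤ) (v p) := by
  obtain ⟨hbot, hfd, -⟩ := hP.twistSpace_eq hchi
  let β := Module.finBasis ℂ (P.F.twistSpace k)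
  obtain ⟨h, hβ⟩ : ∃ h : Fin (Module.finrank ℂ (P.F.twistSpace k)) → P.F.M01, ∀ j, h j = β j :=
    ⟨_, fun _ => rfl⟩
  have hli : LinearIndependent ℂ h := by
    rw [funext hβ]
    exact β.linearIndependent.map' (P.F.twistSpace k).subtype (P.F.twistSpace k).ker_subtype
  have hspan : Submodule.span ℂ (Set.range h) = P.F.twistSpace k := by
    have : Set.range h = (P.F.twistSpace k).subtype '' Set.range β := by
      rw [← Set.range_comp, funext hβ]; rfl
    rw [this, ← Submodule.map_span, β.span_eq, Submodule.map_top, Submodule.range_subtype]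
  have hmem : ∀ j, h j ∈ P.F.twistSpace k := fun j => hβ j ▸ (β j).2
  have hli' := XSheaf.linearIndependent_translates_of_twistSpace hbot hli hmem
  refine ResolvedConifold.exists_eq_sum_shift hmem ?_
  have h0 : P.F.res0C P.s0 ∈ (Subsheaf.whole P.F).image0 := ⟨P.s0, trivial, rfl⟩
  have h1 : P.F.res0C P.s0 ∈ (Subsheaf.whole P.F).image1 := ⟨P.s1, trivial, P.glue.symm⟩
  rw [hP.image0_eq_span hchi hspan] at h0
  rw [hP.image1_eq_span hchi hspan] at h1
  have h2 := Submodule.mem_inf.2 ⟨h0, h1⟩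
  rw [span_image_inf_span_image hli'] at h2
  exact h2

variable {v : Fin (k + 1) → P.F.M01}

theorem pow_fibMap_mem (hv : ∀ p, v p ∈ P.F.twistSpace k) (p : Fin (k + 1)) (a : ℕ) :
    (P.F.fibMap 2 ^ a) (v p) ∈ P.F.twistSpace k := by
  induction a with
  | zero => exact hv p
  | succ a ih => rw [pow_succ', Module.End.mul_apply]; exact XSheaf.fibMap_mem_twistSpace ih

/-- By stability, the coefficients of the section generate. -/
theorem span_pow_fibMap (hP : P.IsJSStable) (hchi : P.chi = P.deg * (k + 1))
    (hv : ∀ p, v p ∈ P.F.twistSpace k)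
    (hs : P.F.res0C P.s0 = ∑ p : Fin (k + 1), shift (p : ℤ) (v p)) :
    Submodule.span ℂ (Set.range fun x : Fin (k + 1) × ℕ => (P.F.fibMap 2 ^ x.2) (v x.1)) =
      P.F.twistSpace k := by
  obtain ⟨hbot, hfd, hdim⟩ := hP.twistSpace_eq hchi
  set U := Submodule.span ℂ (Set.range fun x : Fin (k + 1) × ℕ => (P.F.fibMap 2 ^ x.2) (v x.1))
  have hU : U ≤ P.F.twistSpace k := Submodule.span_le.2 (by
    rintro _ ⟨x, rfl⟩; exact pow_fibMap_mem hv _ _)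
  have hU2 : ∀ w ∈ U, P.F.fibMap 2 w ∈ U := by
    have : U ≤ U.comap (P.F.fibMap 2) := Submodule.span_le.2 (by
      rintro _ ⟨x, rfl⟩
      refine Submodule.subset_span ⟨(x.1, x.2 + 1), ?_⟩
      simp only [pow_succ', Module.End.mul_apply])
    exact this
  have hvU : ∀ p, v p ∈ U := fun p => Submodule.subset_span ⟨(p, 0), rfl⟩
  have hfdU : FiniteDimensional ℂ U := Submodule.finiteDimensional_of_le hU
  obtain ⟨N, hdeg, hchiN, hN0, hN1⟩ :=
    XSheaf.exists_subsheaf hP.coherent.1 hP.isPure hbot U hU hU2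
  have hs0 : P.s0 ∈ N.N0 := by
    have : P.F.res0C P.s0 ∈ N.image0 := by
      rw [hs]
      exact Submodule.sum_mem _ fun p _ => hN0 _ (by omega) _ (hvU p)
    obtain ⟨a, ha, h1⟩ := this
    rw [← hP.isPure.injective0 h1]; exact ha
  have hs1 : P.s1 ∈ N.N1 := by
    have : P.F.res1C P.s1 ∈ N.image1 := by
      have h2 : P.F.res1C P.s1 = P.F.res0C P.s0 := P.glue.symm
      rw [h2, hs]
      exact Submodule.sum_mem _ fun p _ => hN1 _ (by omega) _ (hvU p)
    obtain ⟨a, ha, h1⟩ := this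
    rw [← hP.isPure.injective1 h1]; exact ha
  -- The subsheaf `U ⊗ O(k)` contains the section and has slope `k + 1`, or `∞` if `U = 0`. Neither
  -- is less than the slope of `F`, so it cannot be proper.
  have htop : N.N0 = ⊤ := by
    by_contra hne
    have hlt := hP.stable N hs0 hs1 (Or.inl hne)
    rw [hP.slope_whole hchi, Subsheaf.slope] at hlt
    split_ifs at hlt with h
    · exact absurd hlt (by simp)
    · rw [WithTop.coe_lt_coe, hchiN, ← hdeg] at hlt
      have h' : (N.deg : ℚ) ≠ 0 := by exact_mod_cast h
      push_cast at hlt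
      rw [mul_div_cancel_left₀ _ h'] at hlt
      exact lt_irrefl _ hlt
  have hdegN : N.deg = P.deg := by
    rw [SheafPair.deg, Subsheaf.deg, Subsheaf.deg, htop]; rfl
  exact Submodule.eq_of_le_of_finrank_eq hU (by rw [← hdeg, hdegN, hdim])

end SheafPair.IsJSStable

/-! ### Fixed pairs and eigenvectors -/

namespace SheafPair.TwistIso

variable {P : SheafPair} {k : ℕ} {t : Fin 4 → ℂˣ} (i : TwistIso t P P)

theorem e01_mem_image0 {y : P.F.M01} (hy : y ∈ (Subsheaf.whole P.F).image0) :
    i.e01 y ∈ (Subsheaf.whole P.F).image0 := by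
  obtain ⟨a, -, rfl⟩ := hy
  exact ⟨i.e0 a, trivial, (i.e_res0 a).symm⟩

theorem e01_mem_image1 {y : P.F.M01} (hy : y ∈ (Subsheaf.whole P.F).image1) :
    i.e01 y ∈ (Subsheaf.whole P.F).image1 := by
  obtain ⟨a, -, rfl⟩ := hy
  exact ⟨i.e1 a, trivial, (i.e_res1 a).symm⟩

theorem e01_mem_twistSpace {q : ℤ} {y : P.F.M01} (hy : y ∈ P.F.twistSpace q) :
    i.e01 y ∈ P.F.twistSpace q := by
  refine ⟨i.e01_mem_image0 hy.1, ?_⟩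
  have h1 := i.e01_mem_image1 hy.2
  rw [i.e01_shift] at h1
  have h2 := Submodule.smul_mem _ ((t 0 ^ q : ℂˣ)⁻¹ : ℂ) h1
  rwa [smul_smul, inv_mul_cancel₀ (Units.ne_zero _), one_smul] at h2

/-- The isomorphism preserves the section and the space `V`. Comparing coefficients of `z ^ p` shows
that it acts on `v_p` by `t₀ ^ (-p)`. -/
theorem e01_coefficient (hbot : P.F.twistSpace (k + 1) = ⊥) {v : Fin (k + 1) → P.F.M01}
    (hv : ∀ p, v p ∈ P.F.twistSpace k)
    (hs : P.F.res0C P.s0 = ∑ p : Fin (k + 1), shift (p : ℤ) (v p)) (p : Fin (k + 1)) :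
    ((t 0 ^ (p : ℤ) : ℂˣ) : ℂ) • i.e01 (v p) = v p := by
  rw [← sub_eq_zero]
  refine eq_zero_of_sum_shift_eq_zero (A := (Subsheaf.whole P.F).image0) (V := P.F.twistSpace k)
    (fun y hy => (Subsheaf.whole P.F).shift_mem_image0 hy) inf_le_left
    (fun w hw h => XSheaf.eq_zero_of_shift_mem hbot hw h)
    (c := fun p : Fin (k + 1) => ((t 0 ^ (p : ℤ) : ℂˣ) : ℂ) • i.e01 (v p) - v p)
    (fun p => Submodule.sub_mem _ (Submodule.smul_mem _ _ (i.e01_mem_twistSpace (hv p)))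
      (hv p)) ?_ p
  simp only [map_sub, map_smul, Finset.sum_sub_distrib]
  rw [sub_eq_zero, ← hs]
  calc _ = i.e01 (P.F.res0C P.s0) := by
        rw [hs, map_sum]
        exact Finset.sum_congr rfl fun p _ => (i.e01_shift _ _).symm
    _ = _ := by
        rw [XSheaf.res0C_apply, i.e_res0, i.e_s0]

end SheafPair.TwistIso

theorem two_pow_mul_three_pow_injective :
    Function.Injective fun x : ℕ × ℕ => (2 ^ x.1 * 3 ^ x.2 : ℕ) := by
  have : Fact (Nat.Prime 3) := ⟨Nat.prime_three⟩
  have h23 : padicValNat 2 3 = 0 := padicValNat.eq_zero_of_not_dvd (by norm_num)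
  have h32 : padicValNat 3 2 = 0 := padicValNat.eq_zero_of_not_dvd (by norm_num)
  rintro ⟨a, b⟩ ⟨a', b'⟩ h
  have h2 := congrArg (padicValNat 2) h
  have h3 := congrArg (padicValNat 3) h
  simp only [padicValNat.mul (pow_ne_zero _ two_ne_zero) (pow_ne_zero _ three_ne_zero),
    padicValNat.pow, h23, h32, padicValNat_self] at h2 h3
  simp at h2 h3
  rw [h2, h3]

namespace SheafPair.IsJSStable

variable {P : SheafPair} {k : ℕ} {v : Fin (k + 1) → P.F.M01}

/-- One well-chosen torus element suffices: the vectors `x₃ ^ a v_p` are eigenvectors of its lift,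
with distinct eigenvalues. -/
theorem linearIndependent_pow_fibMap (hfix : P.IsFixed) (hbot : P.F.twistSpace (k + 1) = ⊥)
    (hv : ∀ p, v p ∈ P.F.twistSpace k)
    (hs : P.F.res0C P.s0 = ∑ p : Fin (k + 1), shift (p : ℤ) (v p)) {ι : Type*}
    {f : ι → Fin (k + 1) × ℕ} (hf : Function.Injective f)
    (hne : ∀ j, (P.F.fibMap 2 ^ (f j).2) (v (f j).1) ≠ 0) :
    LinearIndependent ℂ fun j => (P.F.fibMap 2 ^ (f j).2) (v (f j).1) := by
  -- The point `t = (1/2, 2/3, 1, 3)` of `T₀` gives `x₃ ^ a v_p` the eigenvalue `t₀ ^ (-p) t₃ ^ a =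
  -- 2 ^ p 3 ^ a`, which determines `p` and `a`.
  obtain ⟨i⟩ := hfix ![(Units.mk0 2 two_ne_zero)⁻¹, Units.mk0 2 two_ne_zero *
    (Units.mk0 3 three_ne_zero)⁻¹, 1, Units.mk0 3 three_ne_zero] (by
      simp [Fin.prod_univ_four])
  have h1 : ∀ p : Fin (k + 1), i.e01 (v p) = (2 : ℂ) ^ (p : ℕ) • v p := fun p => by
    have := i.e01_coefficient hbot hv hs p
    conv_rhs => rw [← this]
    rw [smul_smul]
    simp
  have h2 : ∀ (p : Fin (k + 1)) (a : ℕ), i.e01 ((P.F.fibMap 2 ^ a) (v p)) =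
      ((2 ^ (p : ℕ) * 3 ^ a : ℕ) : ℂ) • (P.F.fibMap 2 ^ a) (v p) := fun p a => by
    rw [i.e01_fibMap_pow, h1, map_smul, smul_smul]
    push_cast
    rw [mul_comm]
    rfl
  refine Module.End.eigenvectors_linearIndependent' i.e01.toLinearMap
    (fun j => ((2 ^ ((f j).1 : ℕ) * 3 ^ (f j).2 : ℕ) : ℂ)) (fun j j' h => hf ?_) _ fun j =>
    Module.End.hasEigenvector_iff.2 ⟨Module.End.mem_eigenspace_iff.2 (h2 _ _), hne j⟩
  have h3 := @two_pow_mul_three_pow_injective ((f j).1, (f j).2) ((f j').1, (f j').2)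
    (Nat.cast_injective (R := ℂ) h)
  rw [Prod.mk.injEq] at h3
  exact Prod.ext (Fin.ext h3.1) h3.2

/-- Otherwise the powers of `x₃` on `v_p` would be infinitely many independent vectors in the
finite-dimensional `V`. -/
theorem exists_pow_fibMap_eq_zero (hfix : P.IsFixed) (hbot : P.F.twistSpace (k + 1) = ⊥)
    (hfd : FiniteDimensional ℂ (P.F.twistSpace k)) (hv : ∀ p, v p ∈ P.F.twistSpace k)
    (hs : P.F.res0C P.s0 = ∑ p : Fin (k + 1), shift (p : ℤ) (v p)) (p : Fin (k + 1)) :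
    ∃ a, (P.F.fibMap 2 ^ a) (v p) = 0 := by
  by_contra! hcon
  have hli := linearIndependent_pow_fibMap hfix hbot hv hs (f := fun a : ℕ => (p, a))
    (fun a b h => congrArg Prod.snd h) hcon
  have hli' : LinearIndependent ℂ fun a : ℕ =>
      (⟨(P.F.fibMap 2 ^ a) (v p), pow_fibMap_mem hv p a⟩ : P.F.twistSpace k) :=
    LinearIndependent.of_comp (P.F.twistSpace k).subtype hli
  have := hli'.finite
  exact not_finite ℕ

/-- A fixed stable pair has a normal form. -/
theorem exists_normalForm (hP : P.IsJSStable) (hfix : P.IsFixed)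
    (hchi : P.chi = P.deg * (k + 1)) :
    ∃ e : Fin (k + 1) → ℕ, Nonempty (NormalForm P k e) := by
  classical
  obtain ⟨hbot, hfd, -⟩ := hP.twistSpace_eq hchi
  obtain ⟨v, hv, hs⟩ := hP.exists_eq_sum_shift hchi
  have hnil := exists_pow_fibMap_eq_zero hfix hbot hfd hv hs
  -- The height of column `p` is the nilpotency order of `x₃` on `v_p`; it is `0` exactly when `v_p
  -- = 0`.
  let e : Fin (k + 1) → ℕ := fun p => Nat.find (hnil p)
  have hli : LinearIndependent ℂ (chain P.F e v) :=
    linearIndependent_pow_fibMap hfix hbot hv hs (f := fun x : Box e => (x.1, (x.2 : ℕ)))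
      (fun x y h => by
        obtain ⟨p, a⟩ := x
        obtain ⟨q, b⟩ := y
        rw [Prod.mk.injEq] at h
        obtain ⟨h1, h2⟩ := h
        dsimp only at h1 h2
        subst h1
        rw [Fin.ext h2])
      fun x => Nat.find_min (hnil x.1) x.2.2
  have hspan : Submodule.span ℂ (Set.range (chain P.F e v)) = P.F.twistSpace k := by
    rw [← hP.span_pow_fibMap hchi hv hs]
    refine le_antisymm (Submodule.span_mono ?_) (Submodule.span_le.2 ?_)
    · rintro _ ⟨x, rfl⟩
      exact ⟨(x.1, x.2), rfl⟩
    · rintro _ ⟨⟨p, a⟩, rfl⟩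
      rcases lt_or_ge a (e p) with ha | ha
      · exact Submodule.subset_span ⟨⟨p, ⟨a, ha⟩⟩, rfl⟩
      · obtain ⟨c, rfl⟩ := Nat.exists_eq_add_of_le ha
        have h1 : (P.F.fibMap 2 ^ (e p + c)) (v p) = 0 := by
          rw [add_comm, pow_add, Module.End.mul_apply, Nat.find_spec (hnil p), map_zero]
        rw [SetLike.mem_coe]
        dsimp only
        rw [h1]
        exact Submodule.zero_mem _
  have hmem : ∀ x, chain P.F e v x ∈ P.F.twistSpace k := fun x => pow_fibMap_mem hv _ _
  have hli' := XSheaf.linearIndependent_translates_of_twistSpace hbot hli hmem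
  have htop := hP.span_translates_eq_top hchi hspan
  have hf : ∀ w, P.F.fibMap 0 w = 0 ∧ P.F.fibMap 1 w = 0 := fun w => by
    have hw : w ∈ Submodule.span ℂ (Set.range (translates (chain P.F e v))) := htop ▸ trivial
    exact ⟨Subsheaf.fibMap_eq_zero_of_mem_span_translates
        (fun j => (XSheaf.fibMap_eq_zero_of_mem_twistSpace hbot (hmem j)).1) hw,
      Subsheaf.fibMap_eq_zero_of_mem_span_translates
        (fun j => (XSheaf.fibMap_eq_zero_of_mem_twistSpace hbot (hmem j)).2) hw⟩
  exact ⟨e, ⟨{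
    y := v
    b := Module.Basis.mk hli' htop.ge
    b_eq := Module.Basis.coe_mk _ _
    nil := fun p => Nat.find_spec (hnil p)
    fib_zero := fun w => (hf w).1
    fib_one := fun w => (hf w).2
    inj0 := hP.isPure.injective0
    inj1 := hP.isPure.injective1
    range0 := by
      rw [Module.Basis.coe_mk, ← Subsheaf.image0_whole, hP.image0_eq_span hchi hspan]
    range1 := by
      rw [Module.Basis.coe_mk, ← Subsheaf.image1_whole, hP.image1_eq_span hchi hspan]
    sec := hs }⟩⟩

end SheafPair.IsJSStable

/-- A subgroup that is closed under the functions of a chart, as a module. -/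
@[reducible]
def chartModule {W : Type} [AddCommGroup W] [Module OverlapRing W] (ρ : ChartRing →+* OverlapRing)
    (A : AddSubgroup W) (hA : ∀ c, ∀ y ∈ A, ρ c • y ∈ A) : Module ChartRing A where
  smul c a := ⟨ρ c • (a : W), hA c a a.2⟩
  one_smul a := Subtype.ext (by change ρ 1 • (a : W) = a; rw [map_one, one_smul])
  mul_smul c c' a := Subtype.ext (by
    change ρ (c * c') • (a : W) = ρ c • ρ c' • (a : W); rw [map_mul, mul_smul])
  smul_zero c := Subtype.ext (smul_zero (ρ c))
  smul_add c a b := Subtype.ext (smul_add (ρ c) (a : W) b)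
  add_smul c c' a := Subtype.ext (by
    change ρ (c + c') • (a : W) = ρ c • (a : W) + ρ c' • (a : W); rw [map_add, add_smul])
  zero_smul a := Subtype.ext (by change ρ 0 • (a : W) = 0; rw [map_zero, zero_smul])

/-- The sheaf with sections in subgroups `A` and `B` of a given module over the overlap. -/
def XSheaf.ofSubgroups {W : Type} [AddCommGroup W] [Module OverlapRing W] (A B : AddSubgroup W)
    (hA : ∀ c, ∀ y ∈ A, rho0 c • y ∈ A) (hB : ∀ c, ∀ y ∈ B, rho1 c • y ∈ B)
    (hA' : ∀ y, ∃ n : ℕ, zpw n • y ∈ A) (hB' : ∀ y, ∃ n : ℕ, zpw (-n) • y ∈ B) : XSheaf :=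
  letI := chartModule rho0 A hA
  letI := chartModule rho1 B hB
  { M0 := A
    M1 := B
    M01 := W
    res0 := { toFun := Subtype.val, map_add' := fun _ _ => rfl, map_smul' := fun _ _ => rfl }
    res1 := { toFun := Subtype.val, map_add' := fun _ _ => rfl, map_smul' := fun _ _ => rfl }
    res0_surj := fun y => let ⟨n, hn⟩ := hA' y; ⟨n, ⟨_, hn⟩, rfl⟩
    res0_ker := fun a h => ⟨0, by rw [pow_zero, one_smul]; exact Subtype.ext h⟩
    res1_surj := fun y => let ⟨n, hn⟩ := hB' y; ⟨n, ⟨_, hn⟩, rfl⟩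
    res1_ker := fun a h => ⟨0, by rw [pow_zero, one_smul]; exact Subtype.ext h⟩ }

/-! ### The model of a normal form -/

section Model

variable {k : ℕ} (e : Fin (k + 1) → ℕ)

/-- The sections over the overlap of the sum of the sheaves `O(k) ⊗ ℂ[x₃] / x₃ ^ (e p)`. -/
def Model : Type := Box e → LaurentPolynomial ℂ

instance : AddCommGroup (Model e) := inferInstanceAs (AddCommGroup (Box e → LaurentPolynomial ℂ))

/-- Multiplication by `x₃`. -/
def modelEnd : Module.End (LaurentPolynomial ℂ) (Box e → LaurentPolynomial ℂ) :=
  (Pi.basisFun (LaurentPolynomial ℂ) (Box e)).constr (LaurentPolynomial ℂ) fun i =>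
    if h : (i.2 : ℕ) + 1 < e i.1 then
      Pi.basisFun (LaurentPolynomial ℂ) (Box e) ⟨i.1, ⟨i.2 + 1, h⟩⟩ else 0

/-- The action of the functions on the overlap, where `x₁` and `x₂` act by zero. -/
def modelAction : OverlapRing →+* Module.End (LaurentPolynomial ℂ) (Box e → LaurentPolynomial ℂ) :=
  -- The endomorphism ring is not commutative, so the evaluation passes through polynomials in the
  -- single endomorphism `modelEnd e`.
  ((Polynomial.aeval (modelEnd e)).toRingHom).comp
    (MvPolynomial.aeval (R := LaurentPolynomial ℂ)
      (![0, 0, Polynomial.X] : Fin 3 → Polynomial (LaurentPolynomial ℂ))).toRingHom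

theorem modelAction_C (p : LaurentPolynomial ℂ) (w : Box e → LaurentPolynomial ℂ) :
    modelAction e (MvPolynomial.C p) w = p • w := by
  simp [modelAction, Module.algebraMap_end_apply]

theorem modelAction_X (i : Fin 3) : modelAction e (MvPolynomial.X i) =
    (![0, 0, modelEnd e] : Fin 3 → _) i := by
  fin_cases i <;> simp [modelAction]

instance : Module OverlapRing (Model e) :=
  Module.compHom (Box e → LaurentPolynomial ℂ) (modelAction e)

instance : Module (LaurentPolynomial ℂ) (Model e) :=
  Module.compHom (Model e) (algebraMap (LaurentPolynomial ℂ) OverlapRing)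

instance : Module ℂ (Model e) := Module.compHom (Model e) (algebraMap ℂ OverlapRing)

instance : IsScalarTower ℂ (LaurentPolynomial ℂ) (Model e) :=
  IsScalarTower.of_algebraMap_smul fun c a => by
    change algebraMap (LaurentPolynomial ℂ) OverlapRing (algebraMap ℂ (LaurentPolynomial ℂ) c) • a
      = algebraMap ℂ OverlapRing c • a
    rw [← IsScalarTower.algebraMap_apply]

instance : SMulCommClass (LaurentPolynomial ℂ) ℂ (Model e) := IsScalarTower.to_smulCommClass'

/-- The underlying module over the Laurent polynomials is free. -/
def modelEquiv : (Box e → LaurentPolynomial ℂ) ≃ₗ[LaurentPolynomial ℂ] Model e where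
  __ := AddEquiv.refl (Box e → LaurentPolynomial ℂ)
  map_smul' p w := (modelAction_C e p w).symm

/-- The generators `x₃ ^ a y_p`. -/
def modelVec (i : Box e) : Model e := modelEquiv e (Pi.basisFun (LaurentPolynomial ℂ) (Box e) i)

theorem fib01_smul_modelVec (i : Box e) : fib01 2 • modelVec e i =
    if h : (i.2 : ℕ) + 1 < e i.1 then modelVec e ⟨i.1, ⟨i.2 + 1, h⟩⟩ else 0 := by
  change modelAction e (MvPolynomial.X 2) (Pi.basisFun (LaurentPolynomial ℂ) (Box e) i) = _
  rw [modelAction_X]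
  change modelEnd e _ = _
  rw [modelEnd, Module.Basis.constr_basis]
  split_ifs <;> rfl

theorem fib01_zero_smul (w : Model e) : fib01 0 • w = 0 := by
  change modelAction e (MvPolynomial.X 0) w = 0
  rw [modelAction_X]; rfl

theorem fib01_one_smul (w : Model e) : fib01 1 • w = 0 := by
  change modelAction e (MvPolynomial.X 1) w = 0
  rw [modelAction_X]; rfl

/-- The basis `z ^ q x₃ ^ a y_p`. -/
def modelBasis : Module.Basis (Box e × ℤ) ℂ (Model e) :=
  ((AddMonoidAlgebra.basis ℤ ℂ).smulTower
    ((Pi.basisFun (LaurentPolynomial ℂ) (Box e)).map (modelEquiv e))).reindex (Equiv.prodComm _ _)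

theorem modelBasis_eq : ⇑(modelBasis e) = translates (modelVec e) := by
  funext x
  rw [modelBasis, Module.Basis.reindex_apply, Module.Basis.smulTower_apply,
    AddMonoidAlgebra.basis_apply]
  rfl

/-- The span of the basis vectors with exponent of `z` in a given set. -/
def modelSpan (S : Set ℤ) : Submodule ℂ (Model e) :=
  Submodule.span ℂ (modelBasis e '' {x | x.2 ∈ S})

theorem shift_mem_modelSpan {S S' : Set ℤ} (q : ℤ) (h : ∀ a ∈ S, q + a ∈ S') {w : Model e}
    (hw : w ∈ modelSpan e S) : shift q w ∈ modelSpan e S' := by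
  rw [modelSpan, modelBasis_eq] at hw ⊢
  exact shift_mem_span_translates q h hw

theorem fib01_smul_mem_modelSpan {S : Set ℤ} (i : Fin 3) {w : Model e} (hw : w ∈ modelSpan e S) :
    fib01 i • w ∈ modelSpan e S := by
  fin_cases i
  · exact (fib01_zero_smul e w).symm ▸ Submodule.zero_mem _
  · exact (fib01_one_smul e w).symm ▸ Submodule.zero_mem _
  change fib01 2 • w ∈ _
  rw [modelSpan] at hw
  induction hw using Submodule.span_induction with
  | mem w hw =>
    obtain ⟨x, hx, rfl⟩ := hw
    have h1 : fib01 2 • modelBasis e x = shift x.2 (fib01 2 • modelVec e x.1) := by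
      rw [modelBasis_eq]
      exact smul_comm (fib01 2) (zpw x.2) (modelVec e x.1)
    rw [h1, fib01_smul_modelVec]
    split_ifs with h
    · refine Submodule.subset_span ⟨(⟨x.1.1, ⟨x.1.2 + 1, h⟩⟩, x.2), hx, ?_⟩
      rw [modelBasis_eq]; rfl
    · rw [map_zero]; exact Submodule.zero_mem _
  | zero => rw [smul_zero]; exact Submodule.zero_mem _
  | add a b _ _ ha hb => rw [smul_add]; exact Submodule.add_mem _ ha hb
  | smul c a _ ha =>
    have : fib01 2 • c • a = c • fib01 2 • a := smul_comm (fib01 2) (algebraMap ℂ OverlapRing c) a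
    rw [this]; exact Submodule.smul_mem _ _ ha

theorem rho0_smul_mem_modelSpan (c : ChartRing) {w : Model e} (hw : w ∈ modelSpan e (Set.Ici 0)) :
    rho0 c • w ∈ modelSpan e (Set.Ici 0) := by
  let _ : Module ChartRing (Model e) := Module.compHom (Model e) rho0
  have : IsScalarTower ℂ ChartRing (Model e) := IsScalarTower.of_algebraMap_smul fun c w => by
    change rho0 (algebraMap ℂ ChartRing c) • w = algebraMap ℂ OverlapRing c • w
    rw [rho0_algebraMap]
  refine chart_smul_mem (S := modelSpan e (Set.Ici 0)) (fun w hw => ?_) (fun i w hw => ?_) c hw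
  · change rho0 base • w ∈ _
    rw [rho0_base]
    exact shift_mem_modelSpan e 1 (by simp; omega) hw
  · change rho0 (fib i) • w ∈ _
    rw [rho0_fib]
    exact fib01_smul_mem_modelSpan e i hw

theorem rho1_smul_mem_modelSpan (c : ChartRing) {w : Model e}
    (hw : w ∈ modelSpan e (Set.Iic (k : ℤ))) : rho1 c • w ∈ modelSpan e (Set.Iic (k : ℤ)) := by
  let _ : Module ChartRing (Model e) := Module.compHom (Model e) rho1
  have : IsScalarTower ℂ ChartRing (Model e) := IsScalarTower.of_algebraMap_smul fun c w => by
    change rho1 (algebraMap ℂ ChartRing c) • w = algebraMap ℂ OverlapRing c • w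
    rw [rho1_algebraMap]
  refine chart_smul_mem (S := modelSpan e (Set.Iic (k : ℤ))) (fun w hw => ?_) (fun i w hw => ?_)
    c hw
  · change rho1 base • w ∈ _
    rw [rho1_base]
    exact shift_mem_modelSpan e (-1) (by simp; omega) hw
  · change rho1 (fib i) • w ∈ _
    rw [rho1_fib]
    fin_cases i
    · change (zpw 1 * fib01 0) • w ∈ _
      rw [mul_smul, fib01_zero_smul, smul_zero]; exact Submodule.zero_mem _
    · change (zpw 1 * fib01 1) • w ∈ _
      rw [mul_smul, fib01_one_smul, smul_zero]; exact Submodule.zero_mem _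
    · exact fib01_smul_mem_modelSpan e 2 hw

theorem exists_mem_modelSpan (w : Model e) :
    ∃ n : ℕ, w ∈ modelSpan e (Set.Icc (-n : ℤ) n) := by
  have hw : w ∈ Submodule.span ℂ (Set.range (modelBasis e)) := by
    rw [(modelBasis e).span_eq]; trivial
  induction hw using Submodule.span_induction with
  | mem w hw =>
    obtain ⟨x, rfl⟩ := hw
    exact ⟨x.2.natAbs, Submodule.subset_span
      ⟨x, show x.2 ∈ Set.Icc _ _ from ⟨by omega, by omega⟩, rfl⟩⟩
  | zero => exact ⟨0, Submodule.zero_mem _⟩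
  | add a b _ _ ha hb =>
    obtain ⟨n, hn⟩ := ha
    obtain ⟨m, hm⟩ := hb
    refine ⟨n + m, Submodule.add_mem _ (Submodule.span_mono (Set.image_mono ?_) hn)
      (Submodule.span_mono (Set.image_mono ?_) hm)⟩ <;>
    · intro x hx
      simp at hx ⊢
      omega
  | smul c a _ ha =>
    obtain ⟨n, hn⟩ := ha
    exact ⟨n, Submodule.smul_mem _ _ hn⟩

/-- The sum of the sheaves `O(k) ⊗ ℂ[x₃] / x₃ ^ (e p)`. -/
def modelSheaf : XSheaf :=
  XSheaf.ofSubgroups (modelSpan e (Set.Ici 0)).toAddSubgroup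
    (modelSpan e (Set.Iic (k : ℤ))).toAddSubgroup
    (fun c _ hy => rho0_smul_mem_modelSpan e c hy) (fun c _ hy => rho1_smul_mem_modelSpan e c hy)
    (fun y => by
      obtain ⟨n, hn⟩ := exists_mem_modelSpan e y
      exact ⟨n, shift_mem_modelSpan e n (by simp; omega) hn⟩)
    (fun y => by
      obtain ⟨n, hn⟩ := exists_mem_modelSpan e y
      exact ⟨n, shift_mem_modelSpan e (-n) (by simp; omega) hn⟩)

/-- Multiplication by `x₃`, over `ℂ`. -/
def modelFib : Model e →ₗ[ℂ] Model e where
  toFun w := fib01 2 • w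
  map_add' := smul_add _
  map_smul' c w := smul_comm (fib01 2) (algebraMap ℂ OverlapRing c) w

/-- The generators `y_p`. -/
def modelGenerator (p : Fin (k + 1)) : Model e :=
  if h : 0 < e p then modelVec e ⟨p, ⟨0, h⟩⟩ else 0

theorem modelGenerator_mem (p : Fin (k + 1)) : modelGenerator e p ∈ modelSpan e {0} := by
  rw [modelGenerator]
  split_ifs with h
  · refine Submodule.subset_span ⟨(⟨p, ⟨0, h⟩⟩, 0), rfl, ?_⟩
    rw [modelBasis_eq]; exact shift_zero _
  · exact Submodule.zero_mem _

/-- The section `∑ z ^ p y_p`. -/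
def modelSection : Model e := ∑ p : Fin (k + 1), shift (p : ℤ) (modelGenerator e p)

/-- The pair with a given normal form. -/
def modelPair : SheafPair where
  F := modelSheaf e
  s0 := ⟨modelSection e, Submodule.sum_mem _ fun p _ =>
    shift_mem_modelSpan e p (by simp) (modelGenerator_mem e p)⟩
  s1 := ⟨modelSection e, Submodule.sum_mem _ fun p _ =>
    shift_mem_modelSpan e p (by simp; omega) (modelGenerator_mem e p)⟩
  glue := rfl

theorem fibMap_pow_modelGenerator (i : Box e) :
    (modelFib e ^ (i.2 : ℕ)) (modelGenerator e i.1) = modelVec e i := by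
  obtain ⟨p, a, ha⟩ := i
  change (modelFib e ^ a) (modelGenerator e p) = _
  induction a with
  | zero =>
    rw [modelGenerator, dif_pos ha]; rfl
  | succ a ih =>
    rw [pow_succ', Module.End.mul_apply, ih (by omega)]
    refine (fib01_smul_modelVec e _).trans ?_
    rw [dif_pos ha]

theorem fibMap_pow_modelGenerator_eq_zero (p : Fin (k + 1)) :
    (modelFib e ^ e p) (modelGenerator e p) = 0 := by
  obtain h | ⟨a, ha⟩ : e p = 0 ∨ ∃ a, e p = a + 1 := by
    cases h : e p with
    | zero => exact Or.inl rfl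
    | succ a => exact Or.inr ⟨a, rfl⟩
  · rw [h, modelGenerator, dif_neg (by omega)]; rfl
  · rw [ha, pow_succ', Module.End.mul_apply]
    have := fibMap_pow_modelGenerator e ⟨p, ⟨a, by omega⟩⟩
    dsimp only at this
    rw [this]
    refine (fib01_smul_modelVec e _).trans ?_
    rw [dif_neg (by dsimp only; omega)]

/-- The normal form of the model. -/
def modelNormalForm : NormalForm (modelPair e) k e where
  y := modelGenerator e
  b := modelBasis e
  b_eq := funext fun x => (congrFun (modelBasis_eq e) x).trans
    (congrArg (fun w : Model e => shift x.2 w) (fibMap_pow_modelGenerator e x.1).symm)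
  nil := fibMap_pow_modelGenerator_eq_zero e
  fib_zero := fib01_zero_smul e
  fib_one := fib01_one_smul e
  inj0 _ _ h := Subtype.ext h
  inj1 _ _ h := Subtype.ext h
  range0 := by
    ext w
    exact ⟨fun ⟨a, ha⟩ => ha ▸ a.2, fun h => ⟨⟨w, h⟩, rfl⟩⟩
  range1 := by
    ext w
    exact ⟨fun ⟨a, ha⟩ => ha ▸ a.2, fun h => ⟨⟨w, h⟩, rfl⟩⟩
  sec := rfl

end Model

/-! ### The fixed locus and the sum over it -/

variable {k : ℕ}

theorem mem_piAntidiag_univ {d : ℕ} {e : Fin (k + 1) → ℕ} :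
    e ∈ Finset.piAntidiag (Finset.univ : Finset (Fin (k + 1))) d ↔ ∑ p, e p = d := by
  rw [Finset.mem_piAntidiag]
  exact and_iff_left fun _ _ => Finset.mem_univ _

theorem modelPair_injective {e e' : Fin (k + 1) → ℕ}
    (h : Quotient.mk SheafPair.isoSetoid (modelPair e) = Quotient.mk _ (modelPair e')) :
    e = e' := by
  obtain ⟨i⟩ : SheafPair.Iso (modelPair e) (modelPair e') := Quotient.exact h
  exact (NormalForm.ofIso i (modelNormalForm e)).unique (modelNormalForm e')

/-- Fixed stable pairs have normal forms, and pairs with equal heights are isomorphic. Conversely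
the model is stable, and `twistIso` from the model to itself over every `t` shows that it is fixed.
-/
theorem fixedLocus_eq_image (k : ℕ) {d : ℕ} (hd : 0 < d) :
    fixedLocus ((d * (k + 1) : ℕ) : ℤ) d = (fun e => Quotient.mk _ (modelPair e)) ''
      (Finset.piAntidiag (Finset.univ : Finset (Fin (k + 1))) d : Set (Fin (k + 1) → ℕ)) := by
  ext p
  constructor
  · rintro ⟨P, rfl, hP, hdeg, hchi, hfix⟩
    obtain ⟨e, ⟨B⟩⟩ := hP.exists_normalForm (k := k) hfix (by rw [hchi, hdeg]; push_cast; ring)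
    refine ⟨e, ?_, Quotient.sound ⟨NormalForm.twistIso (modelNormalForm e) B 1⟩⟩
    rw [Finset.mem_coe, mem_piAntidiag_univ, ← B.deg_eq, hdeg]
  · rintro ⟨e, he, rfl⟩
    rw [Finset.mem_coe, mem_piAntidiag_univ] at he
    have B := modelNormalForm e
    have hdeg : (modelPair e).deg = d := by rw [B.deg_eq, he]
    refine ⟨modelPair e, rfl, B.isJSStable (by omega), hdeg, ?_,
      fun t _ => ⟨NormalForm.twistIso B B t⟩⟩
    rw [B.chi_eq, he]
    push_cast; ring

/-- The chosen representative is isomorphic to the model, so it carries a transported normal form.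
`contribution_eq` holds for every equivariant structure, so the choice of one is immaterial. -/
theorem classContribution_eq (e : Fin (k + 1) → ℕ) :
    classContribution (Quotient.mk _ (modelPair e)) = (-1) ^ ((∑ i, e i) * (k + 1)) /
      (∏ i ∈ Finset.Icc 1 k, (i.factorial : Lam)) * NormalForm.formulaTerm k e := by
  obtain ⟨i⟩ : SheafPair.Iso (modelPair e) (Quotient.mk SheafPair.isoSetoid (modelPair e)).out :=
    Setoid.symm (Quotient.mk_out (modelPair e))
  have B := NormalForm.ofIso i (modelNormalForm e)
  rw [classContribution, dif_pos ⟨B.equivariantStructure⟩]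
  exact B.contribution_eq _

end ResolvedConifold
end

theorem theorem3p14 (k d n : ℕ) (hd : 0 < d) (hn : n = d * (k + 1)) :
    -- the invariant is well defined
    (ResolvedConifold.fixedLocus n d).Finite ∧
    (∀ P : ResolvedConifold.SheafPair,
      P.IsJSStable → P.deg = d → P.chi = n → P.IsFixed →
        P.F.IsSupportedOnY ∧
        (∃! _ : ResolvedConifold.EquivariantStructure P, True) ∧
        ∀ E : ResolvedConifold.EquivariantStructure P,
          (Function.support E.chiX).Finite ∧ (Function.support E.halfClass).Finite ∧
          E.halfClass 0 = 0) ∧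
    -- the formula
    ResolvedConifold.tautJS n d =
      (-1) ^ n / (∏ i ∈ Finset.Icc 1 k, (i.factorial : ResolvedConifold.Lam)) *
      ∑ e ∈ Finset.piAntidiag (Finset.univ : Finset (Fin (k + 1))) d,
        (1 / ∏ i, ((e i).factorial : ResolvedConifold.Lam)) *
        (∏ i : Fin (k + 1), ∏ j ∈ Finset.Ioi i,
          ((((j : ℕ) : ResolvedConifold.Lam) - ((i : ℕ) : ResolvedConifold.Lam)) +
            ((e i : ResolvedConifold.Lam) - (e j : ResolvedConifold.Lam)) *
              (ResolvedConifold.lam 3 / ResolvedConifold.lam 0))) *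
        ∏ i : Fin (k + 1),
          ((∏ a ∈ Finset.range (e i), ∏ b ∈ Finset.Icc (-((i : ℕ) : ℤ)) ((k : ℤ) - ((i : ℕ) : ℤ)),
              (ResolvedConifold.mm / ResolvedConifold.lam 3 - (a : ResolvedConifold.Lam) -
                (b : ResolvedConifold.Lam) *
                  (ResolvedConifold.lam 0 / ResolvedConifold.lam 3))) *
            (∏ a ∈ Finset.Icc 1 (e i), ∏ b ∈ Finset.Icc 1 (k - (i : ℕ)),
              1 / ((a : ResolvedConifold.Lam) + (b : ResolvedConifold.Lam) *
                (ResolvedConifold.lam 0 / ResolvedConifold.lam 3))) *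
            (∏ a ∈ Finset.Icc 1 (e i), ∏ b ∈ Finset.Icc 1 (i : ℕ),
              1 / ((a : ResolvedConifold.Lam) - (b : ResolvedConifold.Lam) *
                (ResolvedConifold.lam 0 / ResolvedConifold.lam 3)))) := by
  subst hn
  refine ⟨?_, fun P hP hdeg hchi hfix => ?_, ?_⟩
  · rw [ResolvedConifold.fixedLocus_eq_image k hd]
    exact (Finset.finite_toSet _).image _
  · obtain ⟨e, ⟨B⟩⟩ := hP.exists_normalForm (k := k) hfix (by rw [hchi, hdeg]; push_cast; ring)
    exact ⟨B.isSupportedOnY, B.existsUnique_equivariantStructure, fun E =>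
      ⟨B.finite_support_chiX E, B.finite_support_halfClass E, B.halfClass_zero E⟩⟩
  -- Non-isomorphism of models with different heights turns the sum over isomorphism classes into a
  -- sum over compositions of `d`.
  · rw [ResolvedConifold.tautJS, ResolvedConifold.fixedLocus_eq_image k hd,
      finsum_mem_image fun _ _ _ _ h => ResolvedConifold.modelPair_injective h,
      finsum_mem_coe_finset, Finset.mul_sum]
    refine Finset.sum_congr rfl fun e he => ?_
    rw [ResolvedConifold.mem_piAntidiag_univ] at he
    rw [ResolvedConifold.classContribution_eq, he]
    rfl
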